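/- **Setting.** Let $\Omega\subset\mathbb R^d$ be open, invariant under a discrete group of translations (the periods) and with a bounded measurable period cell (for instance a torus, a bounded domain with walls, or a periodic channel). "Field" means a $C^\infty$ function on $\Omega$ with all derivatives bounded and with the given periods; convergence of fields is uniform convergence on $\Omega$ of all space derivatives. A vector field $v$ has no flux through the walls ($v\cdot n=0$) if $\int_{\rm cell}(v\cdot\nabla\varphi+\varphi\,\nabla\cdot v)\,dx=0$ for all scalar fields $\varphi$. Let $\gamma>1$, let $\theta_0>0$ be constant, and let $\Phi,\rho_0,p_0$ be fields with $\inf\rho_0>0$, $p_0=(\rho_0\theta_0)^\gamma$, $\nabla p_0=-\rho_0\nabla\Phi$. **Scheme.** For $0<\varepsilon\le1$ and $U=(\rho,q,E,\theta_2)$ with $q=\rho{\bf u}$ put $p(U)=(\gamma-1)(E-\tfrac12\varepsilon^2\rho|{\bf u}|^2)$ and $\theta(U)=\theta_0+\varepsilon^2\theta_2$. Let $\mathcal H(U_E,U_I)$ have the components $$-\varepsilon^2\nabla\!\cdot q_E-(1-\varepsilon^2)\nabla\!\cdot q_I,$$ $$-\nabla\!\cdot(q\otimes {\bf u})_E-\nabla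 p(U_E)-\rho_E\nabla\Phi-\tfrac{1-\varepsilon^2}{\varepsilon^2}(\nabla p_I+\rho_I\nabla\Phi),$$ $$-\varepsilon^2\big(\nabla\!\cdot((E+p){\bf u})_E+q_E\!\cdot\!\nabla\Phi\big)-(1-\varepsilon^2)\big(\nabla\!\cdot(H_Iq_I)+q_I\!\cdot\!\nabla\Phi\big),$$ $$-{\bf u}_E\!\cdot\!\nabla\theta_{2,E}-\varepsilon^{-2}{\bf u}_E\!\cdot\!\nabla\theta_0,$$ where $\rho_{2,I}=(\rho_I-\rho_0)/\varepsilon^2$, $p_I=p_0+\varepsilon^2\frac{\gamma p_0}{\rho_0\theta_0}\big(\rho_0\theta_{2,E}+\theta(U_E)\rho_{2,I}\big)$ and $H_I=\frac{\gamma}{\gamma-1}\frac{p_I}{\rho_I}+\frac12\varepsilon^2\frac{|q_I|^2}{\rho_I^2}$. Given a double tableau $(\tilde A,A,b)$ with $\tilde A$ strictly lower triangular and $A$ lower triangular, one step of size $\Delta t$ from $U^0$ is, for $i=1,\dots,s$, $$U_E^{(i)}=U^0+\Delta t\sum_{j<i}\tilde a_{ij}\mathcal H(U_E^{(j)},U_I^{(j)}),\qquad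 U_I^{(i)}=U^0+\Delta t\sum_{j\le i}a_{ij}\mathcal H(U_E^{(j)},U_I^{(j)}),$$ $U^1=U^0+\Delta t\sum_i b_i\mathcal H(U_E^{(i)},U_I^{(i)})$, where all stage values are fields and each $q_I^{(i)}$ has no flux through the walls. Assume that the tableau is stiffly accurate ($b_j=a_{sj}$), that $a_{ii}\ne0$ for $i\ge2$, and that it has order $k$: for every ODE $y'=H(y,y)$ with smooth $H:\mathbb R^m\times\mathbb R^m\to\mathbb R^m$, the one-step error is $\mathcal O(h^{k+1})$ (for stage values that stay bounded). **Data.** Let the initial data $U^0(\cdot\,;\varepsilon)$ be well-prepared: as $\varepsilon\to0$, $\rho^0=\rho_0+\varepsilon^2(\rho_2^0+o(1))$, $(\rho{\bf u})^0=q_0+\varepsilon(q_1+o(1))$, $p(U^0)=p_0+\varepsilon^2(p_2^0+o(1))$, $\theta(U^0)=\theta_0+\varepsilon^2(\theta_2^0+o(1))$ with coefficients that are fields, and $\nabla\cdot q_0=0$. Let $({\bf u}^e,\rho_2^e,p_2^e,\theta_2^e)$ be smooth in $(t,x)$ on $[0,T]\times\Omega$ (all derivatives bounded, with the given periods), with no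 flux of $\rho_0{\bf u}^e$ through the walls, and solve the limit system $$\nabla\!\cdot(\rho_0{\bf u}^e)=0,\quad (\rho_0{\bf u}^e)_t+\nabla\!\cdot(\rho_0{\bf u}^e\otimes{\bf u}^e)+\nabla p_2^e=-\rho_2^e\nabla\Phi,\quad (\theta_2^e)_t+{\bf u}^e\!\cdot\!\nabla\theta_2^e=0,\quad p_2^e=\tfrac{\gamma p_0}{\rho_0\theta_0}(\rho_0\theta_2^e+\theta_0\rho_2^e)$$ with $\rho_0{\bf u}^e(0)=q_0$, $\theta_2^e(0)=\theta_2^0$ and, if $a_{11}=0$, also $\rho_2^e(0)=\rho_2^0$. **Theorem 4.2.** There is a constant $C$, independent of $\Delta t$ and of the stage values, such that the following holds for every $0<\Delta t\le T$. Let $U^1(\cdot\,;\varepsilon)$ be obtained from $U^0(\cdot\,;\varepsilon)$ by one step of the scheme for all small $\varepsilon>0$, and suppose that the densities of the implicit stages have expansions $\rho_I^{(i)}=\rho_0+\varepsilon^2(\rho_2^{(i)}+o(1))$ with fields $\rho_2^{(i)}$. With $p^1=p(U^1)$ and $\theta^1=\theta(U^1)$ one has, with all space derivatives and uniformly on $\Omega$,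 $$\lim_{\varepsilon\to0}\theta^1=\theta_0,\qquad \lim_{\varepsilon\to0}\nabla\cdot(\rho^1{\bf u}^1)=0,\qquad \lim_{\varepsilon\to0}(\nabla p^1+\rho^1\nabla\Phi)=0.$$ Moreover $V^1=(\rho^1,\rho^1{\bf u}^1,p^1,\theta_2^1)$ converges as $\varepsilon\to0$ to a field that satisfies $$\sup_{x\in\Omega}\Big|\lim_{\varepsilon\to0}V^1(x;\varepsilon)-\big(\rho_0,\rho_0{\bf u}^e,p_0,\theta_2^e\big)(x,\Delta t)\Big|\le C\,\Delta t^{k+1}.$$ That is, the scheme is asymptotically accurate. -/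

import Mathlib

open Set Filter Topology MeasureTheory
open scoped ContDiff

noncomputable section

namespace LowMach

/-! ## IMEX Runge-Kutta schemes for `U' = H (U, U)` -/

/-- A double Butcher tableau with `s + 1` stages. The first argument of `H` is treated by the
explicit matrix `Ae`, the second one by the diagonally implicit matrix `Ai`. The problems are
autonomous, so the abscissae (row sums) play no role; `b` is the weight vector of the update. -/
structure Tableau (s : ℕ) where
  Ae : Matrix (Fin (s + 1)) (Fin (s + 1)) ℝ
  Ai : Matrix (Fin (s + 1)) (Fin (s + 1)) ℝ
  b : Fin (s + 1) → ℝ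
  explicit : ∀ i j, i ≤ j → Ae i j = 0
  dirk : ∀ i j, i < j → Ai i j = 0

namespace Tableau

variable {s : ℕ} (tab : Tableau s) {V : Type*} [AddCommGroup V] [Module ℝ V]

/-- The implicit part is stiffly accurate: `b` is the last row of `Ai`. -/
def StifflyAccurate : Prop := ∀ j, tab.b j = tab.Ai (Fin.last s) j

/-- Right-hand side defining the explicit stage value `U_E^(i)`. -/
def explicitStage (dt : ℝ) (H : V → V → V) (U : V) (UE UI : Fin (s + 1) → V)
    (i : Fin (s + 1)) : V :=
  U + dt • ∑ j ∈ Finset.Iio i, tab.Ae i j • H (UE j) (UI j)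

/-- The intermediate value `U_⋆^(i)`, computed from the previous stages. -/
def starStage (dt : ℝ) (H : V → V → V) (U : V) (UE UI : Fin (s + 1) → V)
    (i : Fin (s + 1)) : V :=
  U + dt • ∑ j ∈ Finset.Iio i, tab.Ai i j • H (UE j) (UI j)

/-- Right-hand side of the (implicit) equation for the stage value `U_I^(i)`. -/
def implicitStage (dt : ℝ) (H : V → V → V) (U : V) (UE UI : Fin (s + 1) → V)
    (i : Fin (s + 1)) : V :=
  tab.starStage dt H U UE UI i + (dt * tab.Ai i i) • H (UE i) (UI i)

/-- The solution after one time step. -/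
def update (dt : ℝ) (H : V → V → V) (U : V) (UE UI : Fin (s + 1) → V) : V :=
  U + dt • ∑ i, tab.b i • H (UE i) (UI i)

/-- The scheme has order `k`: for every smooth `H` on `ℝ^m × ℝ^m` and every solution `y` of
`y' = H (y, y)`, the error after one step of size `h` is `O(h^(k+1))` as `h → 0`. As the stage
equations are implicit, only stage values that stay in a fixed ball are considered (for small
`h` these are unique). -/
def HasOrder (k : ℕ) : Prop :=
  ∀ (m : ℕ) (H : (Fin m → ℝ) → (Fin m → ℝ) → (Fin m → ℝ)),
    ContDiff ℝ ∞ (fun z : (Fin m → ℝ) × (Fin m → ℝ) => H z.1 z.2) →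
    ∀ (T : ℝ) (y : ℝ → Fin m → ℝ), 0 < T →
      (∀ t ∈ Icc 0 T, HasDerivWithinAt y (H (y t) (y t)) (Icc 0 T) t) →
      ∀ R : ℝ, ∃ C h₀ : ℝ, 0 < h₀ ∧ ∀ h, 0 < h → h ≤ h₀ → h ≤ T →
        ∀ UE UI : Fin (s + 1) → Fin m → ℝ,
          (∀ i, UE i = tab.explicitStage h H (y 0) UE UI i) →
          (∀ i, UI i = tab.implicitStage h H (y 0) UE UI i) →
          (∀ i, ‖UE i‖ ≤ R ∧ ‖UI i‖ ≤ R) →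
          ‖tab.update h H (y 0) UE UI - y h‖ ≤ C * h ^ (k + 1)

end Tableau

/-! ## Domains, fields and differential operators -/

/-- Physical space `ℝ^d`. -/
abbrev Space (d : ℕ) := EuclideanSpace ℝ (Fin d)

/-- A spatial domain: an open set of `ℝ^d` which is invariant under a discrete group of periods
and has a bounded period cell. With no periods this is a bounded open set, whose boundary is a
wall; with `carrier = univ` and a lattice of periods it is a torus; channels lie in between. -/
structure Domain (d : ℕ) where
  carrier : Set (Space d)
  isOpen : IsOpen carrier
  periods : AddSubgroup (Space d)
  discrete : DiscreteTopology periods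
  invariant : ∀ v ∈ periods, ∀ x ∈ carrier, x + v ∈ carrier
  cell : Set (Space d)
  measurable_cell : MeasurableSet cell
  bounded_cell : Bornology.IsBounded cell
  cell_subset : cell ⊆ carrier
  existsUnique_cell : ∀ x ∈ carrier, ∃! v : periods, x + (v : Space d) ∈ cell

/-- A (smooth) field on the domain: infinitely differentiable, all derivatives bounded, and
periodic with respect to the periods of the domain. -/
structure SmoothField {d : ℕ} (Ω : Domain d) {F : Type*} [NormedAddCommGroup F] [NormedSpace ℝ F]
    (f : Space d → F) : Prop where
  contDiffOn : ContDiffOn ℝ ∞ f Ω.carrier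
  bounded : ∀ n : ℕ, ∃ C : ℝ, ∀ x ∈ Ω.carrier, ‖iteratedFDeriv ℝ n f x‖ ≤ C
  periodic : ∀ v ∈ Ω.periods, ∀ x ∈ Ω.carrier, f (x + v) = f x

/-- A smooth time-dependent field on `[0, T]`, with all derivatives in `(t, x)` bounded. -/
structure SmoothTimeField {d : ℕ} (Ω : Domain d) (T : ℝ) {F : Type*} [NormedAddCommGroup F]
    [NormedSpace ℝ F] (f : ℝ → Space d → F) : Prop where
  contDiffOn : ContDiffOn ℝ ∞ (fun z : ℝ × Space d => f z.1 z.2) (Icc 0 T ×ˢ Ω.carrier)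
  bounded : ∀ n : ℕ, ∃ C : ℝ, ∀ z ∈ Icc 0 T ×ˢ Ω.carrier,
    ‖iteratedFDerivWithin ℝ n (fun z : ℝ × Space d => f z.1 z.2) (Icc 0 T ×ˢ Ω.carrier) z‖ ≤ C
  periodic : ∀ t ∈ Icc 0 T, ∀ v ∈ Ω.periods, ∀ x ∈ Ω.carrier, f t (x + v) = f t x

/-- Divergence of a vector field. -/
def div {d : ℕ} (v : Space d → Space d) (x : Space d) : ℝ :=
  ∑ j, fderiv ℝ (fun y => v y j) x (EuclideanSpace.single j 1)

/-- Row-wise divergence `∇·(v ⊗ w)`: the `i`-th component is `∑ j, ∂_j (v_i w_j)`. -/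
def divTensor {d : ℕ} (v w : Space d → Space d) (x : Space d) : Space d :=
  WithLp.toLp 2 fun i => div (fun y => v y i • w y) x

/-- The field `v` has no flux through the walls (`v · n = 0`), in weak form: the divergence
theorem for `φ v` holds on a period cell without boundary term, for all fields `φ`. -/
def NoFlux {d : ℕ} (Ω : Domain d) (v : Space d → Space d) : Prop :=
  ∀ φ : Space d → ℝ, SmoothField Ω φ →
    ∫ x in Ω.cell, (inner ℝ (v x) (gradient φ x) + φ x * div v x) = 0

/-- `f ε → f₀` as `ε → 0+`, uniformly on the domain together with all space derivatives. -/
def SmoothLimit {d : ℕ} (Ω : Domain d) {F : Type*} [NormedAddCommGroup F] [NormedSpace ℝ F]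
    (f : ℝ → Space d → F) (f₀ : Space d → F) : Prop :=
  ∀ n : ℕ, TendstoUniformlyOn (fun ε => iteratedFDeriv ℝ n (f ε)) (iteratedFDeriv ℝ n f₀)
    (𝓝[>] 0) Ω.carrier

/-- The expansion `f ε = f₀ + ε^m g + o(ε^m)`, with smooth fields `f₀` and `g`. -/
def HasExpansion {d : ℕ} (Ω : Domain d) {F : Type*} [NormedAddCommGroup F] [NormedSpace ℝ F]
    (m : ℕ) (f : ℝ → Space d → F) (f₀ g : Space d → F) : Prop :=
  SmoothField Ω f₀ ∧ SmoothField Ω g ∧ SmoothLimit Ω (fun ε x => (ε ^ m)⁻¹ • (f ε x - f₀ x)) g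

/-! ## The split Euler equations with gravity -/

/-- Values of `(ρ, ρu, E, θ₂)`, or of `(ρ, ρu, p, θ₂)`. -/
abbrev Val (d : ℕ) := ℝ × Space d × ℝ × ℝ

/-- A state `U = (ρ, ρu, E, θ₂)`. -/
abbrev State (d : ℕ) := Space d → Val d

namespace State

variable {d : ℕ} (U : State d)

/-- Density `ρ`. -/
def rho (x : Space d) : ℝ := (U x).1
/-- Momentum `ρu`. -/
def mom (x : Space d) : Space d := (U x).2.1
/-- Total energy `E`. -/
def energy (x : Space d) : ℝ := (U x).2.2.1
/-- Perturbation `θ₂` of the potential temperature. -/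
def theta2 (x : Space d) : ℝ := (U x).2.2.2
/-- Velocity `u`. -/
def vel (x : Space d) : Space d := (U.rho x)⁻¹ • U.mom x

/-- Pressure from the equation of state `E = ε² ρ |u|² / 2 + p / (γ - 1)`. -/
def pressure (γ ε : ℝ) (x : Space d) : ℝ :=
  (γ - 1) * (U.energy x - ε ^ 2 * U.rho x * ‖U.vel x‖ ^ 2 / 2)

end State

/-- The data of the problem: adiabatic index, gravitational potential, and the background
density, pressure and potential temperature. -/
structure Background (d : ℕ) where
  γ : ℝ
  Φ : Space d → ℝ
  ρ₀ : Space d → ℝ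
  p₀ : Space d → ℝ
  θ₀ : Space d → ℝ

/-- Hydrostatic background with constant potential temperature. -/
structure Background.IsHydrostatic {d : ℕ} (B : Background d) (Ω : Domain d) : Prop where
  one_lt_γ : 1 < B.γ
  field_Φ : SmoothField Ω B.Φ
  field_ρ₀ : SmoothField Ω B.ρ₀
  field_p₀ : SmoothField Ω B.p₀
  density_pos : ∃ c > 0, ∀ x ∈ Ω.carrier, c ≤ B.ρ₀ x
  theta_const : ∃ c > 0, ∀ x ∈ Ω.carrier, B.θ₀ x = c
  eos : ∀ x ∈ Ω.carrier, B.p₀ x = (B.ρ₀ x * B.θ₀ x) ^ B.γ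
  balance : ∀ x ∈ Ω.carrier, gradient B.p₀ x = -(B.ρ₀ x • gradient B.Φ x)

section Splitting

variable {d : ℕ} (B : Background d) (ε : ℝ) (UE UI : State d)

/-- Potential temperature `θ = θ₀ + ε² θ₂` of a state. -/
def potTemp (U : State d) (x : Space d) : ℝ := B.θ₀ x + ε ^ 2 * U.theta2 x

/-- `ρ₂` of the implicit state, from `ρ = ρ₀ + ε² ρ₂`. -/
def rho2I (x : Space d) : ℝ := (UI.rho x - B.ρ₀ x) / ε ^ 2

/-- `p₂` of the implicit part, from the linearised relation
`p₂ = γ p₀ / (ρ₀ θ₀) (ρ₀ θ₂ + θ ρ₂)`; `θ₂` and `θ` are known explicitly. -/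
def p2I (x : Space d) : ℝ :=
  B.γ * B.p₀ x / (B.ρ₀ x * B.θ₀ x) *
    (B.ρ₀ x * UE.theta2 x + potTemp B ε UE x * rho2I B ε UI x)

/-- Pressure of the implicit part, `p = p₀ + ε² p₂`. -/
def pI (x : Space d) : ℝ := B.p₀ x + ε ^ 2 * p2I B ε UE UI x

/-- Enthalpy `(E + p) / ρ` of the implicit part. -/
def enthalpyI (x : Space d) : ℝ :=
  B.γ / (B.γ - 1) * (pI B ε UE UI x / UI.rho x)
    + ε ^ 2 * ‖UI.mom x‖ ^ 2 / (UI.rho x) ^ 2 / 2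

/-- The split right-hand side `H (U_E, U_I)` with splitting parameter `ε²` (for `ε ≤ 1`). -/
def rhs : State d := fun x =>
  ( -(ε ^ 2 * div UE.mom x + (1 - ε ^ 2) * div UI.mom x),
    -(divTensor UE.mom UE.vel x + gradient (UE.pressure B.γ ε) x + UE.rho x • gradient B.Φ x
        + ((1 - ε ^ 2) / ε ^ 2) • (gradient (pI B ε UE UI) x + UI.rho x • gradient B.Φ x)),
    -(ε ^ 2 * (div (fun y => (UE.energy y + UE.pressure B.γ ε y) • UE.vel y) x
          + inner ℝ (UE.mom x) (gradient B.Φ x))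
        + (1 - ε ^ 2) * (div (fun y => enthalpyI B ε UE UI y • UI.mom y) x
          + inner ℝ (UI.mom x) (gradient B.Φ x))),
    -(inner ℝ (UE.vel x) (gradient UE.theta2 x)
        + 1 / ε ^ 2 * inner ℝ (UE.vel x) (gradient B.θ₀ x)) )

end Splitting

/-- Well-prepared initial data: `ρ = ρ₀ + ε² ρ₂`, `ρu = q₀ + ε q₁`, `p = p₀ + ε² p₂`,
`θ = θ₀ + ε² θ₂` up to higher order, around the hydrostatic background and with `∇·q₀ = 0`. -/
structure WellPrepared {d : ℕ} (Ω : Domain d) (B : Background d) (U : ℝ → State d)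
    (q₀ q₁ : Space d → Space d) (ρ₂ p₂ θ₂ : Space d → ℝ) : Prop where
  field : ∀ᶠ ε in 𝓝[>] (0 : ℝ), SmoothField Ω (U ε)
  rho : HasExpansion Ω 2 (fun ε => (U ε).rho) B.ρ₀ ρ₂
  mom : HasExpansion Ω 1 (fun ε => (U ε).mom) q₀ q₁
  pressure : HasExpansion Ω 2 (fun ε => (U ε).pressure B.γ ε) B.p₀ p₂
  theta : HasExpansion Ω 2 (fun ε => potTemp B ε (U ε)) B.θ₀ θ₂
  div_zero : ∀ x ∈ Ω.carrier, div q₀ x = 0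

/-- One step of size `dt` of the semi-implicit IMEX-RK scheme at Mach number `ε`, continuous in
space, from `U0` to `U1` with stage values `UE i`, `UI i`; the implicit momentum satisfies the
wall condition. -/
structure IsSchemeStep {d s : ℕ} (Ω : Domain d) (B : Background d) (tab : Tableau s)
    (dt ε : ℝ) (U0 : State d) (UE UI : Fin (s + 1) → State d) (U1 : State d) : Prop where
  field : ∀ i, SmoothField Ω (UE i) ∧ SmoothField Ω (UI i)
  explicit : ∀ i, EqOn (UE i) (tab.explicitStage dt (rhs B ε) U0 UE UI i) Ω.carrier
  implicit : ∀ i, EqOn (UI i) (tab.implicitStage dt (rhs B ε) U0 UE UI i) Ω.carrier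
  noFlux : ∀ i, NoFlux Ω (UI i).mom
  update : EqOn U1 (tab.update dt (rhs B ε) U0 UE UI) Ω.carrier

/-- `(u₀, ρ₂, p₂, θ₂)` is a smooth solution on `[0, T]` of the incompressible limit system
`∇·(ρ₀u₀) = 0`, `(ρ₀u₀)_t + ∇·(ρ₀u₀ ⊗ u₀) + ∇p₂ = -ρ₂∇Φ`, `(θ₂)_t + u₀·∇θ₂ = 0`, closed by
`p₂ = γ p₀ / (ρ₀ θ₀) (ρ₀ θ₂ + θ₀ ρ₂)`, with no flux through the walls. -/
structure IsLimitSolution {d : ℕ} (Ω : Domain d) (B : Background d) (T : ℝ)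
    (u₀ : ℝ → Space d → Space d) (ρ₂ p₂ θ₂ : ℝ → Space d → ℝ) : Prop where
  field_u₀ : SmoothTimeField Ω T u₀
  field_ρ₂ : SmoothTimeField Ω T ρ₂
  field_p₂ : SmoothTimeField Ω T p₂
  field_θ₂ : SmoothTimeField Ω T θ₂
  div_zero : ∀ t ∈ Icc 0 T, ∀ x ∈ Ω.carrier, div (fun y => B.ρ₀ y • u₀ t y) x = 0
  momentum : ∀ t ∈ Icc 0 T, ∀ x ∈ Ω.carrier,
    derivWithin (fun τ => B.ρ₀ x • u₀ τ x) (Icc 0 T) t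
        + divTensor (fun y => B.ρ₀ y • u₀ t y) (u₀ t) x + gradient (p₂ t) x
      = -(ρ₂ t x • gradient B.Φ x)
  transport : ∀ t ∈ Icc 0 T, ∀ x ∈ Ω.carrier,
    derivWithin (fun τ => θ₂ τ x) (Icc 0 T) t + inner ℝ (u₀ t x) (gradient (θ₂ t) x) = 0
  closure : ∀ t ∈ Icc 0 T, ∀ x ∈ Ω.carrier,
    p₂ t x = B.γ * B.p₀ x / (B.ρ₀ x * B.θ₀ x) * (B.ρ₀ x * θ₂ t x + B.θ₀ x * ρ₂ t x)
  noFlux : ∀ t ∈ Icc 0 T, NoFlux Ω (fun y => B.ρ₀ y • u₀ t y)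

/-- `V = (ρ, ρu, p, θ₂)` of a numerical state at Mach number `ε`. -/
def numVec {d : ℕ} (B : Background d) (ε : ℝ) (U : State d) (x : Space d) : Val d :=
  (U.rho x, U.mom x, U.pressure B.γ ε x, U.theta2 x)

/-- `V^e = (ρ, ρu, p, θ₂)` of a solution of the limit system, in which density and (hydrostatic)
pressure are those of the background. -/
def exactVec {d : ℕ} (B : Background d) (u₀ : ℝ → Space d → Space d) (θ₂ : ℝ → Space d → ℝ)
    (t : ℝ) (x : Space d) : Val d :=
  (B.ρ₀ x, B.ρ₀ x • u₀ t x, B.p₀ x, θ₂ t x)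

end LowMach

end

open LowMach

noncomputable section

namespace LowMach

/-! ### Calculus of families of fields with uniform control of all derivatives. -/

section

variable {d : ℕ} {Ω : Domain d}
  {F G H : Type*} [NormedAddCommGroup F] [NormedSpace ℝ F] [NormedAddCommGroup G] [NormedSpace ℝ G]
  [NormedAddCommGroup H] [NormedSpace ℝ H]

/-! ### Iterated derivatives on the domain -/

/-! At fixed step size the limit of vanishing Mach number turns the scheme into an explicit
Runge-Kutta method for the projected limit system, and the order of the tableau for ordinary
differential equations carries over to that system because it is quadratic.

The limit. Every stage converges with all derivatives, by induction on the stage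
(`exists_stageLimit`). The terms with negative powers of `ε` are harmless: hydrostatic balance
leaves a remainder of size `ε²` in `∇p_I + ρ_I ∇Φ` (`famConv_rhs_mom`), and `∇θ₀ = 0`. Since the
implicit density tends to `ρ₀`, a nonzero diagonal entry forces the limit of the implicit momentum
to be divergence-free; the energy slope then vanishes too, because the background enthalpy has
gradient `-∇Φ` (`famConv_rhs_energy`). Hence density and energy stay at their background values, and
only momentum and potential temperature evolve.

Elimination of the density perturbation. For constant `θ₀` the pressure and gravity forces of order
one combine to `∇(a θ₂) + ρ₀ ∇(g ρ₂)` (`gradient_add_gravity`), so `ρ₂` enters only through a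
weighted gradient. The momentum slopes are divergence-free without wall flux
(`isLimitStage_of_stageLimit`), and such fields meet the weighted gradients only in zero
(`Solenoidal.eqOn_zero`). So `ρ₂` is a Lagrange multiplier: the slope is the projection of the terms
in `q` and `θ₂` alone, and these are taken at the explicit stages. Existence of a Helmholtz
decomposition is never needed. Uniqueness makes the projection a partially defined linear map, and
any linear extension `P` serves (`exists_projection`).

Order. What remains is `y' = B (y, y) + L y` on the vector space of fields. It loses derivatives, so
no Lipschitz argument is available, but one step of an explicit method is a polynomial in the step
size whose coefficients are determined by the initial value, and the Taylor coefficients of the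
exact solution obey the corresponding recursion. Agreement up to degree `k` concerns finitely many
vectors; it is read off from a truncated graded system on their span, an ordinary differential
equation to which the order hypothesis applies (`Tableau.HasOrder.update_coeff`). The error is then
a Taylor remainder plus `Δt^(k+1)` times a polynomial with field coefficients, both bounded
independently of the stages (`IsLimitSolution.exists_accuracy`). -/

theorem iteratedFDeriv_eq_within (Ω : Domain d) (n : ℕ) (f : Space d → F) {x : Space d}
    (hx : x ∈ Ω.carrier) : iteratedFDeriv ℝ n f x = iteratedFDerivWithin ℝ n f Ω.carrier x :=
  (iteratedFDerivWithin_of_isOpen n Ω.isOpen hx).symm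

theorem iteratedFDeriv_congr_on {f g : Space d → F} (h : EqOn f g Ω.carrier) (n : ℕ)
    {x : Space d} (hx : x ∈ Ω.carrier) : iteratedFDeriv ℝ n f x = iteratedFDeriv ℝ n g x := by
  rw [iteratedFDeriv_eq_within Ω n f hx, iteratedFDeriv_eq_within Ω n g hx,
    iteratedFDerivWithin_congr h hx]

theorem fderiv_congr_on {f g : Space d → F} (h : EqOn f g Ω.carrier)
    {x : Space d} (hx : x ∈ Ω.carrier) : fderiv ℝ f x = fderiv ℝ g x :=
  (h.eventuallyEq_of_mem (Ω.isOpen.mem_nhds hx)).fderiv_eq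

theorem iteratedFDeriv_sub_on {f g : Space d → F} (hf : ContDiffOn ℝ ∞ f Ω.carrier)
    (hg : ContDiffOn ℝ ∞ g Ω.carrier) (n : ℕ) {x : Space d} (hx : x ∈ Ω.carrier) :
    iteratedFDeriv ℝ n (fun y => f y - g y) x = iteratedFDeriv ℝ n f x - iteratedFDeriv ℝ n g x := by
  rw [iteratedFDeriv_eq_within Ω n _ hx, iteratedFDeriv_eq_within Ω n _ hx,
    iteratedFDeriv_eq_within Ω n _ hx]
  exact fun_iteratedFDerivWithin_sub_apply ((hf x hx).of_le (by exact_mod_cast le_top))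
    ((hg x hx).of_le (by exact_mod_cast le_top)) Ω.isOpen.uniqueDiffOn hx

theorem norm_iteratedFDeriv_add_on_le {f g : Space d → F} (hf : ContDiffOn ℝ ∞ f Ω.carrier)
    (hg : ContDiffOn ℝ ∞ g Ω.carrier) (n : ℕ) {x : Space d} (hx : x ∈ Ω.carrier) :
    ‖iteratedFDeriv ℝ n (fun y => f y + g y) x‖
      ≤ ‖iteratedFDeriv ℝ n f x‖ + ‖iteratedFDeriv ℝ n g x‖ := by
  rw [iteratedFDeriv_eq_within Ω n _ hx, iteratedFDeriv_eq_within Ω n _ hx,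
    iteratedFDeriv_eq_within Ω n _ hx]
  rw [fun_iteratedFDerivWithin_add_apply ((hf x hx).of_le (by exact_mod_cast le_top))
    ((hg x hx).of_le (by exact_mod_cast le_top)) Ω.isOpen.uniqueDiffOn hx]
  exact norm_add_le _ _

/-- Leibniz rule, with the binomial coefficients summing to `2 ^ n`. Only bounds at the single point
`x` and up to order `n` enter, which suits the induction for reciprocals. -/
theorem norm_iteratedFDeriv_bilin_le (L : F →L[ℝ] G →L[ℝ] H) {f : Space d → F} {g : Space d → G}
    (hf : ContDiffOn ℝ ∞ f Ω.carrier) (hg : ContDiffOn ℝ ∞ g Ω.carrier) {n : ℕ} {x : Space d}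
    (hx : x ∈ Ω.carrier) {a b : ℝ} (ha : ∀ i ≤ n, ‖iteratedFDeriv ℝ i f x‖ ≤ a)
    (hb : ∀ i ≤ n, ‖iteratedFDeriv ℝ i g x‖ ≤ b) :
    ‖iteratedFDeriv ℝ n (fun y => L (f y) (g y)) x‖ ≤ ‖L‖ * 2 ^ n * b * a := by
  have h := L.norm_iteratedFDerivWithin_le_of_bilinear hf hg Ω.isOpen.uniqueDiffOn hx (n := n)
    (by exact_mod_cast le_top)
  rw [iteratedFDeriv_eq_within Ω n _ hx]
  refine h.trans ?_
  have ha0 : 0 ≤ a := (norm_nonneg _).trans (ha 0 (Nat.zero_le _))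
  have hs : ∑ i ∈ Finset.range (n + 1), (n.choose i : ℝ) * ‖iteratedFDerivWithin ℝ i f Ω.carrier x‖ *
        ‖iteratedFDerivWithin ℝ (n - i) g Ω.carrier x‖
      ≤ ∑ i ∈ Finset.range (n + 1), (n.choose i : ℝ) * (b * a) := by
    refine Finset.sum_le_sum fun i hi => ?_
    rw [← iteratedFDeriv_eq_within Ω i _ hx, ← iteratedFDeriv_eq_within Ω (n - i) _ hx, mul_assoc,
      mul_comm b a]
    have hi' : i ≤ n := Nat.lt_succ_iff.mp (Finset.mem_range.mp hi)
    exact mul_le_mul_of_nonneg_left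
      (mul_le_mul (ha i hi') (hb _ (Nat.sub_le _ _)) (norm_nonneg _) ha0) (Nat.cast_nonneg _)
  rw [← Finset.sum_mul] at hs
  have h2 : (∑ i ∈ Finset.range (n + 1), (n.choose i : ℝ)) = 2 ^ n := by
    exact_mod_cast Nat.sum_range_choose n
  rw [h2] at hs
  calc _ ≤ ‖L‖ * (2 ^ n * (b * a)) := mul_le_mul_of_nonneg_left hs (by positivity)
    _ = _ := by ring

theorem norm_iteratedFDeriv_clm_le (L : F →L[ℝ] G) {f : Space d → F}
    (hf : ContDiffOn ℝ ∞ f Ω.carrier) (n : ℕ) {x : Space d} (hx : x ∈ Ω.carrier) :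
    ‖iteratedFDeriv ℝ n (fun y => L (f y)) x‖ ≤ ‖L‖ * ‖iteratedFDeriv ℝ n f x‖ := by
  rw [iteratedFDeriv_eq_within Ω n _ hx, iteratedFDeriv_eq_within Ω n _ hx]
  exact L.norm_iteratedFDerivWithin_comp_left (hf x hx) Ω.isOpen.uniqueDiffOn hx
    (by exact_mod_cast le_top)

theorem contDiffOn_fderiv {f : Space d → F} (hf : ContDiffOn ℝ ∞ f Ω.carrier) :
    ContDiffOn ℝ ∞ (fderiv ℝ f) Ω.carrier :=
  hf.fderiv_of_isOpen Ω.isOpen (by simp)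

theorem differentiableAt_on {f : Space d → F} (hf : ContDiffOn ℝ ∞ f Ω.carrier) {x : Space d}
    (hx : x ∈ Ω.carrier) : DifferentiableAt ℝ f x :=
  (hf.differentiableOn (by simp)).differentiableAt (Ω.isOpen.mem_nhds hx)

theorem fderiv_periodic {f : Space d → F} {v : Space d}
    (h : ∀ x ∈ Ω.carrier, f (x + v) = f x) {x : Space d} (hx : x ∈ Ω.carrier) :
    fderiv ℝ f (x + v) = fderiv ℝ f x := by
  rw [← fderiv_comp_add_right]
  exact fderiv_congr_on h hx

/-! ### Bounded, null and convergent families of fields -/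

/-- A family of fields, as `ε → 0+`, all of whose derivatives are uniformly bounded. -/
structure BddFam (Ω : Domain d) (f : ℝ → Space d → F) : Prop where
  smooth : ∀ᶠ ε in 𝓝[>] (0 : ℝ), ContDiffOn ℝ ∞ (f ε) Ω.carrier
  periodic : ∀ᶠ ε in 𝓝[>] (0 : ℝ), ∀ v ∈ Ω.periods, ∀ x ∈ Ω.carrier, f ε (x + v) = f ε x
  bounded : ∀ n : ℕ, ∃ C : ℝ, ∀ᶠ ε in 𝓝[>] (0 : ℝ), ∀ x ∈ Ω.carrier,
    ‖iteratedFDeriv ℝ n (f ε) x‖ ≤ C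

/-- A bounded family of fields which tends to zero with all derivatives. -/
structure NullFam (Ω : Domain d) (f : ℝ → Space d → F) : Prop extends BddFam Ω f where
  small : ∀ n : ℕ, ∀ δ > 0, ∀ᶠ ε in 𝓝[>] (0 : ℝ), ∀ x ∈ Ω.carrier,
    ‖iteratedFDeriv ℝ n (f ε) x‖ ≤ δ

/-- A family of fields which converges, with all derivatives, to a field. -/
structure FamConv (Ω : Domain d) (f : ℝ → Space d → F) (f₀ : Space d → F) : Prop where
  field : SmoothField Ω f₀
  bdd : BddFam Ω f
  null : NullFam Ω (fun ε x => f ε x - f₀ x)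

theorem eventually_forall_le {p : ℕ → ℝ → Prop} {l : Filter ℝ} (h : ∀ n, ∀ᶠ ε in l, p n ε) (n : ℕ) :
    ∀ᶠ ε in l, ∀ i ≤ n, p i ε := by
  have := (Finset.range (n + 1)).eventually_all (l := l) (p := fun i ε => p i ε)
  have h' := this.mpr fun i _ => h i
  filter_upwards [h'] with ε hε i hi using hε i (Finset.mem_range.mpr (Nat.lt_succ_of_le hi))

namespace BddFam

variable {f f' : ℝ → Space d → F} {g : ℝ → Space d → G}

theorem congr (hf : BddFam Ω f) (h : ∀ᶠ ε in 𝓝[>] (0 : ℝ), EqOn (f' ε) (f ε) Ω.carrier) :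
    BddFam Ω f' where
  smooth := by filter_upwards [hf.smooth, h] with ε h1 h2 using h1.congr h2
  periodic := by
    filter_upwards [hf.periodic, h] with ε h1 h2 v hv x hx
    rw [h2 hx, h2 (Ω.invariant v hv x hx), h1 v hv x hx]
  bounded n := by
    obtain ⟨C, hC⟩ := hf.bounded n
    refine ⟨C, ?_⟩
    filter_upwards [hC, h] with ε h1 h2 x hx
    rw [iteratedFDeriv_congr_on h2 n hx]
    exact h1 x hx

theorem bounded_le (hf : BddFam Ω f) (n : ℕ) : ∃ C : ℝ, 0 ≤ C ∧ ∀ᶠ ε in 𝓝[>] (0 : ℝ),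
    ∀ i ≤ n, ∀ x ∈ Ω.carrier, ‖iteratedFDeriv ℝ i (f ε) x‖ ≤ C := by
  choose C hC using hf.bounded
  refine ⟨∑ i ∈ Finset.range (n + 1), |C i|, Finset.sum_nonneg fun _ _ => abs_nonneg _, ?_⟩
  filter_upwards [eventually_forall_le hC n] with ε hε i hi x hx
  exact (hε i hi x hx).trans ((le_abs_self _).trans
    (Finset.single_le_sum (f := fun i => |C i|) (fun _ _ => abs_nonneg _)
      (Finset.mem_range.mpr (Nat.lt_succ_of_le hi))))

theorem of_smoothField {f : Space d → F} (hf : SmoothField Ω f) : BddFam Ω (fun _ => f) where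
  smooth := Eventually.of_forall fun _ => hf.contDiffOn
  periodic := Eventually.of_forall fun _ => hf.periodic
  bounded n := (hf.bounded n).imp fun _ hC => Eventually.of_forall fun _ => hC

theorem smoothField {f : Space d → F} (hf : BddFam Ω (fun _ => f)) : SmoothField Ω f where
  contDiffOn := hf.smooth.exists.choose_spec
  periodic := hf.periodic.exists.choose_spec
  bounded n := (hf.bounded n).imp fun _ hC => hC.exists.choose_spec

theorem add {g : ℝ → Space d → F} (hf : BddFam Ω f) (hg : BddFam Ω g) :
    BddFam Ω (fun ε x => f ε x + g ε x) where
  smooth := by filter_upwards [hf.smooth, hg.smooth] with ε h1 h2 using h1.add h2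
  periodic := by
    filter_upwards [hf.periodic, hg.periodic] with ε h1 h2 v hv x hx
    rw [h1 v hv x hx, h2 v hv x hx]
  bounded n := by
    obtain ⟨C, hC⟩ := hf.bounded n
    obtain ⟨D, hD⟩ := hg.bounded n
    refine ⟨C + D, ?_⟩
    filter_upwards [hC, hD, hf.smooth, hg.smooth] with ε h1 h2 h3 h4 x hx
    exact (norm_iteratedFDeriv_add_on_le h3 h4 n hx).trans (add_le_add (h1 x hx) (h2 x hx))

theorem clm (L : F →L[ℝ] G) (hf : BddFam Ω f) : BddFam Ω (fun ε x => L (f ε x)) where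
  smooth := by filter_upwards [hf.smooth] with ε h1 using L.contDiff.comp_contDiffOn h1
  periodic := by
    filter_upwards [hf.periodic] with ε h1 v hv x hx
    rw [h1 v hv x hx]
  bounded n := by
    obtain ⟨C, hC⟩ := hf.bounded n
    refine ⟨‖L‖ * C, ?_⟩
    filter_upwards [hC, hf.smooth] with ε h1 h3 x hx
    exact (norm_iteratedFDeriv_clm_le L h3 n hx).trans
      (mul_le_mul_of_nonneg_left (h1 x hx) (norm_nonneg _))

theorem bilin (L : F →L[ℝ] G →L[ℝ] H) (hf : BddFam Ω f) (hg : BddFam Ω g) :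
    BddFam Ω (fun ε x => L (f ε x) (g ε x)) where
  smooth := by
    filter_upwards [hf.smooth, hg.smooth] with ε h1 h2
    exact L.isBoundedBilinearMap.contDiff.comp₂_contDiffOn h1 h2
  periodic := by
    filter_upwards [hf.periodic, hg.periodic] with ε h1 h2 v hv x hx
    rw [h1 v hv x hx, h2 v hv x hx]
  bounded n := by
    obtain ⟨C, -, hC⟩ := hf.bounded_le n
    obtain ⟨D, -, hD⟩ := hg.bounded_le n
    refine ⟨‖L‖ * 2 ^ n * D * C, ?_⟩
    filter_upwards [hC, hD, hf.smooth, hg.smooth] with ε h1 h2 h3 h4 x hx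
    exact norm_iteratedFDeriv_bilin_le L h3 h4 hx (fun i hi => h1 i hi x hx)
      (fun i hi => h2 i hi x hx)

theorem fderiv (hf : BddFam Ω f) : BddFam Ω (fun ε => fderiv ℝ (f ε)) where
  smooth := by filter_upwards [hf.smooth] with ε h1 using contDiffOn_fderiv h1
  periodic := by
    filter_upwards [hf.periodic] with ε h1 v hv x hx
    exact fderiv_periodic (h1 v hv) hx
  bounded n := by
    obtain ⟨C, hC⟩ := hf.bounded (n + 1)
    refine ⟨C, ?_⟩
    filter_upwards [hC] with ε h1 x hx
    rw [norm_iteratedFDeriv_fderiv]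
    exact h1 x hx

/-- Induction on the order of differentiation, carrying all lower orders along: one derivative of `1
/ f` gives a product of `1 / f`, `1 / f` and `f'`, so order `n + 1` of the reciprocal is controlled
by its orders up to `n`. -/
theorem inv {f : ℝ → Space d → ℝ} (hf : BddFam Ω f) {c : ℝ} (hc : 0 < c)
    (h : ∀ᶠ ε in 𝓝[>] (0 : ℝ), ∀ x ∈ Ω.carrier, c ≤ f ε x) : BddFam Ω (fun ε x => (f ε x)⁻¹) := by
  have hsm : ∀ᶠ ε in 𝓝[>] (0 : ℝ), ContDiffOn ℝ ∞ (fun x => (f ε x)⁻¹) Ω.carrier := by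
    filter_upwards [hf.smooth, h] with ε h1 h2
    exact h1.inv fun x hx => (hc.trans_le (h2 x hx)).ne'
  refine ⟨hsm, ?_, ?_⟩
  · filter_upwards [hf.periodic] with ε h1 v hv x hx
    rw [h1 v hv x hx]
  · suffices hle : ∀ n : ℕ, ∃ C : ℝ, ∀ᶠ ε in 𝓝[>] (0 : ℝ), ∀ i ≤ n, ∀ x ∈ Ω.carrier,
        ‖iteratedFDeriv ℝ i (fun x => (f ε x)⁻¹) x‖ ≤ C by
      intro n
      obtain ⟨C, hC⟩ := hle n
      exact ⟨C, hC.mono fun ε hε => hε n le_rfl⟩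
    intro n
    induction n with
    | zero =>
      refine ⟨c⁻¹, ?_⟩
      filter_upwards [h] with ε h1 i hi x hx
      obtain rfl : i = 0 := Nat.le_zero.mp hi
      rw [norm_iteratedFDeriv_zero, norm_inv]
      exact inv_anti₀ hc ((h1 x hx).trans (le_abs_self _))
    | succ n ih =>
      obtain ⟨C, hC⟩ := ih
      obtain ⟨D, -, hD⟩ := hf.bounded_le (n + 1)
      set M := ContinuousLinearMap.mul ℝ ℝ with hM
      set S := ContinuousLinearMap.lsmul ℝ ℝ (E := Space d →L[ℝ] ℝ) with hS
      -- the derivative of `1 / f` is `- (1 / f)² f'`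
      refine ⟨max C (max (‖S‖ * 2 ^ n * D * ∑ i ∈ Finset.range (n + 1), |‖M‖ * 2 ^ i * C * C|) 0), ?_⟩
      filter_upwards [hC, hD, h, hf.smooth, hsm] with ε h1 h2 h3 h4 h5 i hi x hx
      rcases Nat.lt_or_ge i (n + 1) with hi' | hi'
      · exact (h1 i (Nat.lt_succ_iff.mp hi') x hx).trans (le_max_left _ _)
      obtain rfl : i = n + 1 := le_antisymm hi hi'
      refine le_trans ?_ (le_max_right _ _)
      refine le_trans ?_ (le_max_left _ _)
      rw [← norm_iteratedFDeriv_fderiv]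
      have heq : EqOn (_root_.fderiv ℝ (fun x => (f ε x)⁻¹))
          (fun y => S (M (f ε y)⁻¹ (f ε y)⁻¹) (-(_root_.fderiv ℝ (f ε) y))) Ω.carrier := by
        intro y hy
        have hne : f ε y ≠ 0 := (hc.trans_le (h3 y hy)).ne'
        refine ((hasDerivAt_inv hne).comp_hasFDerivAt y
          (differentiableAt_on h4 hy).hasFDerivAt).fderiv.trans ?_
        simp [hS, hM, sq]
      rw [iteratedFDeriv_congr_on heq n hx]
      have h6 : ContDiffOn ℝ ∞ (fun y => M (f ε y)⁻¹ (f ε y)⁻¹) Ω.carrier := h5.mul h5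
      have h7 : ContDiffOn ℝ ∞ (fun y => -(_root_.fderiv ℝ (f ε) y)) Ω.carrier :=
        (contDiffOn_fderiv h4).neg
      refine norm_iteratedFDeriv_bilin_le S h6 h7 hx ?_ ?_
      · intro i hi
        refine (norm_iteratedFDeriv_bilin_le M h5 h5 hx
          (fun j hj => h1 j (hj.trans hi) x hx) (fun j hj => h1 j (hj.trans hi) x hx)).trans
          ((le_abs_self _).trans (Finset.single_le_sum (f := fun i => |‖M‖ * 2 ^ i * C * C|)
          (fun _ _ => abs_nonneg _) (Finset.mem_range.mpr (Nat.lt_succ_of_le hi))))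
      · intro i hi
        have : (fun y => -(_root_.fderiv ℝ (f ε) y)) = -(_root_.fderiv ℝ (f ε)) := rfl
        rw [this, iteratedFDeriv_neg_apply, norm_neg, norm_iteratedFDeriv_fderiv]
        exact h2 (i + 1) (by omega) x hx

end BddFam

namespace NullFam

variable {f f' : ℝ → Space d → F} {g : ℝ → Space d → G}

theorem congr (hf : NullFam Ω f) (h : ∀ᶠ ε in 𝓝[>] (0 : ℝ), EqOn (f' ε) (f ε) Ω.carrier) :
    NullFam Ω f' where
  toBddFam := hf.toBddFam.congr h
  small n δ hδ := by
    filter_upwards [hf.small n δ hδ, h] with ε h1 h2 x hx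
    rw [iteratedFDeriv_congr_on h2 n hx]
    exact h1 x hx

theorem add {g : ℝ → Space d → F} (hf : NullFam Ω f) (hg : NullFam Ω g) :
    NullFam Ω (fun ε x => f ε x + g ε x) where
  toBddFam := hf.toBddFam.add hg.toBddFam
  small n δ hδ := by
    filter_upwards [hf.small n (δ / 2) (half_pos hδ), hg.small n (δ / 2) (half_pos hδ),
      hf.smooth, hg.smooth] with ε h1 h2 h3 h4 x hx
    exact (norm_iteratedFDeriv_add_on_le h3 h4 n hx).trans
      ((add_le_add (h1 x hx) (h2 x hx)).trans_eq (add_halves δ))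

theorem clm (L : F →L[ℝ] G) (hf : NullFam Ω f) : NullFam Ω (fun ε x => L (f ε x)) where
  toBddFam := hf.toBddFam.clm L
  small n δ hδ := by
    have hL : 0 < ‖L‖ + 1 := by positivity
    filter_upwards [hf.small n (δ / (‖L‖ + 1)) (by positivity), hf.smooth] with ε h1 h3 x hx
    refine (norm_iteratedFDeriv_clm_le L h3 n hx).trans ?_
    calc ‖L‖ * ‖iteratedFDeriv ℝ n (f ε) x‖ ≤ (‖L‖ + 1) * (δ / (‖L‖ + 1)) :=
          mul_le_mul (by linarith) (h1 x hx) (norm_nonneg _) hL.le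
      _ = δ := by field_simp

theorem bilin (L : F →L[ℝ] G →L[ℝ] H) (hf : NullFam Ω f) (hg : BddFam Ω g) :
    NullFam Ω (fun ε x => L (f ε x) (g ε x)) where
  toBddFam := hf.toBddFam.bilin L hg
  small n δ hδ := by
    obtain ⟨D, hD0, hD⟩ := hg.bounded_le n
    -- The added `1` keeps the divisor positive when `L` or `D` vanishes.
    set K := ‖L‖ * 2 ^ n * D + 1 with hK
    have hKpos : 0 < K := by positivity
    filter_upwards [eventually_forall_le (fun n => hf.small n (δ / K) (by positivity)) n, hD,
      hf.smooth, hg.smooth] with ε h1 h2 h3 h4 x hx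
    refine (norm_iteratedFDeriv_bilin_le L h3 h4 hx (fun i hi => h1 i hi x hx)
      (fun i hi => h2 i hi x hx)).trans ?_
    calc ‖L‖ * 2 ^ n * D * (δ / K) ≤ K * (δ / K) :=
          mul_le_mul_of_nonneg_right (by linarith) (by positivity)
      _ = δ := by field_simp

theorem bilin' (L : F →L[ℝ] G →L[ℝ] H) (hf : BddFam Ω f) (hg : NullFam Ω g) :
    NullFam Ω (fun ε x => L (f ε x) (g ε x)) :=
  hg.bilin L.flip hf

theorem fderiv (hf : NullFam Ω f) : NullFam Ω (fun ε => fderiv ℝ (f ε)) where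
  toBddFam := hf.toBddFam.fderiv
  small n δ hδ := by
    filter_upwards [hf.small (n + 1) δ hδ] with ε h1 x hx
    rw [norm_iteratedFDeriv_fderiv]
    exact h1 x hx

end NullFam

theorem NullFam.const_zero : NullFam Ω (fun _ _ => (0 : F)) where
  smooth := Eventually.of_forall fun _ => contDiffOn_const
  periodic := Eventually.of_forall fun _ _ _ _ _ => rfl
  bounded n := ⟨0, Eventually.of_forall fun _ x _ => by
    simp⟩
  small n δ hδ := Eventually.of_forall fun _ x _ => by
    simp [hδ.le]

/-- Multiplication by a scalar which depends on `ε` only. -/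
theorem BddFam.real_const (c : ℝ) : BddFam Ω (fun _ _ => c) where
  smooth := Eventually.of_forall fun _ => contDiffOn_const
  periodic := Eventually.of_forall fun _ _ _ _ _ => rfl
  bounded n := by
    rcases Nat.eq_zero_or_pos n with rfl | hn
    · exact ⟨|c|, Eventually.of_forall fun _ x _ => by simp⟩
    · exact ⟨0, Eventually.of_forall fun _ x _ => by
        simp [iteratedFDeriv_const_of_ne hn.ne']⟩

theorem NullFam.of_tendsto {c : ℝ → ℝ} (hc : Tendsto c (𝓝[>] 0) (𝓝 0)) :
    NullFam Ω (fun ε (_ : Space d) => c ε) := by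
  have hs : ∀ n : ℕ, ∀ δ > 0, ∀ᶠ ε in 𝓝[>] (0 : ℝ), ∀ x ∈ Ω.carrier,
      ‖iteratedFDeriv ℝ n (fun _ : Space d => c ε) x‖ ≤ δ := by
    intro n δ hδ
    rcases Nat.eq_zero_or_pos n with rfl | hn
    · filter_upwards [(Metric.tendsto_nhds.mp hc) δ hδ] with ε hε x _
      simpa using hε.le
    · exact Eventually.of_forall fun _ x _ => by
        simp [iteratedFDeriv_const_of_ne hn.ne', hδ.le]
  exact ⟨⟨Eventually.of_forall fun _ => contDiffOn_const,
    Eventually.of_forall fun _ _ _ _ _ => rfl, fun n => ⟨1, hs n 1 one_pos⟩⟩, hs⟩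

namespace FamConv

variable {f f' : ℝ → Space d → F} {f₀ f₀' : Space d → F} {g : ℝ → Space d → G} {g₀ : Space d → G}

theorem congr (hf : FamConv Ω f f₀) (h : ∀ᶠ ε in 𝓝[>] (0 : ℝ), EqOn (f' ε) (f ε) Ω.carrier)
    (h₀ : EqOn f₀' f₀ Ω.carrier) : FamConv Ω f' f₀' where
  field := (BddFam.of_smoothField hf.field).congr (Eventually.of_forall fun _ => h₀) |>.smoothField
  bdd := hf.bdd.congr h
  null := hf.null.congr <| by
    filter_upwards [h] with ε hε x hx
    simp only [hε hx, h₀ hx]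

theorem const {f : Space d → F} (hf : SmoothField Ω f) : FamConv Ω (fun _ => f) f where
  field := hf
  bdd := .of_smoothField hf
  null := by simpa using NullFam.const_zero

theorem of_tendsto {c : ℝ → ℝ} {c₀ : ℝ} (hc : Tendsto c (𝓝[>] 0) (𝓝 c₀)) :
    FamConv Ω (fun ε (_ : Space d) => c ε) (fun _ => c₀) where
  field := (BddFam.real_const c₀).smoothField
  bdd := by
    have h := (NullFam.of_tendsto (Ω := Ω) (c := fun ε => c ε - c₀)
      (by simpa using hc.sub_const c₀)).toBddFam.add (BddFam.real_const c₀)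
    simpa using h
  null := NullFam.of_tendsto (by simpa using hc.sub_const c₀)

theorem add {g : ℝ → Space d → F} {g₀ : Space d → F} (hf : FamConv Ω f f₀) (hg : FamConv Ω g g₀) :
    FamConv Ω (fun ε x => f ε x + g ε x) (fun x => f₀ x + g₀ x) where
  field := ((BddFam.of_smoothField hf.field).add (.of_smoothField hg.field)).smoothField
  bdd := hf.bdd.add hg.bdd
  null := (hf.null.add hg.null).congr <| Eventually.of_forall fun ε x _ => by
    simp only; abel

theorem clm (L : F →L[ℝ] G) (hf : FamConv Ω f f₀) :
    FamConv Ω (fun ε x => L (f ε x)) (fun x => L (f₀ x)) where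
  field := ((BddFam.of_smoothField hf.field).clm L).smoothField
  bdd := hf.bdd.clm L
  null := by simpa using hf.null.clm L

theorem bilin (L : F →L[ℝ] G →L[ℝ] H) (hf : FamConv Ω f f₀) (hg : FamConv Ω g g₀) :
    FamConv Ω (fun ε x => L (f ε x) (g ε x)) (fun x => L (f₀ x) (g₀ x)) where
  field := ((BddFam.of_smoothField hf.field).bilin L (.of_smoothField hg.field)).smoothField
  bdd := hf.bdd.bilin L hg.bdd
  -- `L f g - L f₀ g₀ = L (f - f₀) g + L f₀ (g - g₀)`, null times bounded in each term.
  null := ((hf.null.bilin L hg.bdd).add (.bilin' L (.of_smoothField hf.field) hg.null)).congr <|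
    Eventually.of_forall fun ε x _ => by simp

theorem fderiv (hf : FamConv Ω f f₀) :
    FamConv Ω (fun ε => fderiv ℝ (f ε)) (fderiv ℝ f₀) where
  field := (BddFam.of_smoothField hf.field).fderiv.smoothField
  bdd := hf.bdd.fderiv
  null := hf.null.fderiv.congr <| by
    filter_upwards [hf.bdd.smooth] with ε h x hx
    exact (fderiv_fun_sub (differentiableAt_on h hx)
      (differentiableAt_on hf.field.contDiffOn hx)).symm

theorem eventually_lower_bound {f : ℝ → Space d → ℝ} {f₀ : Space d → ℝ} (hf : FamConv Ω f f₀)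
    {c : ℝ} (hc : 0 < c) (h : ∀ x ∈ Ω.carrier, c ≤ f₀ x) :
    ∀ᶠ ε in 𝓝[>] (0 : ℝ), ∀ x ∈ Ω.carrier, c / 2 ≤ f ε x := by
  filter_upwards [hf.null.small 0 (c / 2) (half_pos hc)] with ε hε x hx
  have h1 := hε x hx
  rw [norm_iteratedFDeriv_zero, Real.norm_eq_abs, abs_le] at h1
  linarith [h x hx, h1.1]

theorem inv {f : ℝ → Space d → ℝ} {f₀ : Space d → ℝ} (hf : FamConv Ω f f₀)
    {c : ℝ} (hc : 0 < c) (h : ∀ x ∈ Ω.carrier, c ≤ f₀ x) :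
    FamConv Ω (fun ε x => (f ε x)⁻¹) (fun x => (f₀ x)⁻¹) := by
  have hlow := hf.eventually_lower_bound hc h
  have hb := hf.bdd.inv (half_pos hc) hlow
  have hb₀ := (BddFam.of_smoothField hf.field).inv hc (Eventually.of_forall fun _ => h)
  refine ⟨hb₀.smoothField, hb, ?_⟩
  -- `1 / f - 1 / f₀ = -(f - f₀) · (1 / f) · (1 / f₀)`.
  have hn := ((hf.null.bilin (ContinuousLinearMap.mul ℝ ℝ) hb).bilin
    (ContinuousLinearMap.mul ℝ ℝ) hb₀).clm (-1 : ℝ →L[ℝ] ℝ)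
  refine hn.congr ?_
  filter_upwards [hlow] with ε hε x hx
  have h1 : f ε x ≠ 0 := ((half_pos hc).trans_le (hε x hx)).ne'
  have h2 : f₀ x ≠ 0 := (hc.trans_le (h x hx)).ne'
  simp
  field_simp

theorem smoothLimit (hf : FamConv Ω f f₀) : SmoothLimit Ω f f₀ := by
  intro n
  rw [Metric.tendstoUniformlyOn_iff]
  intro δ hδ
  filter_upwards [hf.null.small n (δ / 2) (half_pos hδ), hf.bdd.smooth] with ε h1 h2 x hx
  have := h1 x hx
  rw [iteratedFDeriv_sub_on h2 hf.field.contDiffOn n hx] at this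
  rw [dist_comm, dist_eq_norm]
  linarith

/-- Uniform bounds on the family need not be assumed: closeness to `f₀` within `1` at each order
bounds the difference, and `f₀` is itself a field. -/
theorem of_smoothLimit (h : ∀ᶠ ε in 𝓝[>] (0 : ℝ), SmoothField Ω (f ε)) (h₀ : SmoothField Ω f₀)
    (hl : SmoothLimit Ω f f₀) : FamConv Ω f f₀ := by
  have hs : ∀ n : ℕ, ∀ δ > 0, ∀ᶠ ε in 𝓝[>] (0 : ℝ), ∀ x ∈ Ω.carrier,
      ‖iteratedFDeriv ℝ n (fun x => f ε x - f₀ x) x‖ ≤ δ := by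
    intro n δ hδ
    filter_upwards [h, Metric.tendstoUniformlyOn_iff.mp (hl n) δ hδ] with ε h1 h2 x hx
    rw [iteratedFDeriv_sub_on h1.contDiffOn h₀.contDiffOn n hx, ← dist_eq_norm, dist_comm]
    exact (h2 x hx).le
  have hnull : NullFam Ω (fun ε x => f ε x - f₀ x) := by
    refine ⟨⟨?_, ?_, fun n => ⟨1, hs n 1 one_pos⟩⟩, hs⟩
    · filter_upwards [h] with ε h1 using h1.contDiffOn.sub h₀.contDiffOn
    · filter_upwards [h] with ε h1 v hv x hx
      rw [h1.periodic v hv x hx, h₀.periodic v hv x hx]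
  refine ⟨h₀, ?_, hnull⟩
  simpa using hnull.toBddFam.add (.of_smoothField h₀)

theorem smul {f : ℝ → Space d → ℝ} {f₀ : Space d → ℝ} (hf : FamConv Ω f f₀) (hg : FamConv Ω g g₀) :
    FamConv Ω (fun ε x => f ε x • g ε x) (fun x => f₀ x • g₀ x) :=
  hf.bilin (ContinuousLinearMap.lsmul ℝ ℝ) hg

theorem mul {f g : ℝ → Space d → ℝ} {f₀ g₀ : Space d → ℝ} (hf : FamConv Ω f f₀)
    (hg : FamConv Ω g g₀) : FamConv Ω (fun ε x => f ε x * g ε x) (fun x => f₀ x * g₀ x) :=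
  hf.smul hg

theorem tendsto_smul {c : ℝ → ℝ} {c₀ : ℝ} (hc : Tendsto c (𝓝[>] 0) (𝓝 c₀)) (hg : FamConv Ω g g₀) :
    FamConv Ω (fun ε x => c ε • g ε x) (fun x => c₀ • g₀ x) :=
  (of_tendsto hc).smul hg

theorem const_smul (c : ℝ) (hg : FamConv Ω g g₀) :
    FamConv Ω (fun ε x => c • g ε x) (fun x => c • g₀ x) :=
  hg.tendsto_smul tendsto_const_nhds

theorem neg (hf : FamConv Ω f f₀) : FamConv Ω (fun ε x => -f ε x) (fun x => -f₀ x) := by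
  simpa using hf.const_smul (-1)

theorem sub {g : ℝ → Space d → F} {g₀ : Space d → F} (hf : FamConv Ω f f₀) (hg : FamConv Ω g g₀) :
    FamConv Ω (fun ε x => f ε x - g ε x) (fun x => f₀ x - g₀ x) := by
  simpa [sub_eq_add_neg] using hf.add hg.neg

theorem zero : FamConv Ω (fun _ _ => (0 : F)) (fun _ => 0) where
  field := NullFam.const_zero.toBddFam.smoothField
  bdd := NullFam.const_zero.toBddFam
  null := by simpa using NullFam.const_zero

theorem sum {ι : Type*} (s : Finset ι) {f : ι → ℝ → Space d → F} {f₀ : ι → Space d → F}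
    (h : ∀ i ∈ s, FamConv Ω (f i) (f₀ i)) :
    FamConv Ω (fun ε x => ∑ i ∈ s, f i ε x) (fun x => ∑ i ∈ s, f₀ i x) := by
  classical
  induction s using Finset.induction_on with
  | empty => simpa using zero
  | insert i s hi ih =>
    simp only [Finset.sum_insert hi]
    exact (h i (Finset.mem_insert_self _ _)).add
      (ih fun j hj => h j (Finset.mem_insert_of_mem hj))

theorem prodMk (hf : FamConv Ω f f₀) (hg : FamConv Ω g g₀) :
    FamConv Ω (fun ε x => (f ε x, g ε x)) (fun x => (f₀ x, g₀ x)) := by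
  simpa using (hf.clm (ContinuousLinearMap.inl ℝ F G)).add (hg.clm (ContinuousLinearMap.inr ℝ F G))

theorem fst {f : ℝ → Space d → F × G} {f₀ : Space d → F × G} (hf : FamConv Ω f f₀) :
    FamConv Ω (fun ε x => (f ε x).1) (fun x => (f₀ x).1) :=
  hf.clm (ContinuousLinearMap.fst ℝ F G)

theorem snd {f : ℝ → Space d → F × G} {f₀ : Space d → F × G} (hf : FamConv Ω f f₀) :
    FamConv Ω (fun ε x => (f ε x).2) (fun x => (f₀ x).2) :=
  hf.clm (ContinuousLinearMap.snd ℝ F G)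

theorem unique (hf : FamConv Ω f f₀) (hf' : FamConv Ω f f₀') : EqOn f₀ f₀' Ω.carrier := by
  intro x hx
  have h1 := (hf.smoothLimit 0).tendsto_at hx
  have h2 := (hf'.smoothLimit 0).tendsto_at hx
  have h := congrArg (fun m => m 0) (tendsto_nhds_unique h1 h2)
  simpa [iteratedFDeriv_zero_apply] using h

theorem tendsto_at (hf : FamConv Ω f f₀) {x : Space d} (hx : x ∈ Ω.carrier) :
    Tendsto (fun ε => f ε x) (𝓝[>] 0) (𝓝 (f₀ x)) := by
  have h1 := (hf.smoothLimit 0).tendsto_at hx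
  have h2 := ((continuous_eval_const (0 : Fin 0 → Space d)).tendsto _).comp h1
  simpa [Function.comp_def, iteratedFDeriv_zero_apply] using h2

end FamConv

end

section

/-! ### Order conditions for quadratic equations in arbitrary vector spaces -/

section Quadratic

variable {V : Type*} [AddCommGroup V] [Module ℝ V]

/-- The coefficients of `B (y, y) + L y` for a power series `y`. -/
def quadCoeff (B : V →ₗ[ℝ] V →ₗ[ℝ] V) (L : V →ₗ[ℝ] V) (c : ℕ → V) (m : ℕ) : V :=
  ∑ p ∈ Finset.HasAntidiagonal.antidiagonal m, B (c p.1) (c p.2) + L (c m)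

/-- Causality: higher coefficients never feed back into lower ones, so the equation can be truncated
at any degree. -/
theorem quadCoeff_congr (B : V →ₗ[ℝ] V →ₗ[ℝ] V) (L : V →ₗ[ℝ] V) {c c' : ℕ → V} {m : ℕ}
    (h : ∀ i ≤ m, c i = c' i) : quadCoeff B L c m = quadCoeff B L c' m := by
  unfold quadCoeff
  rw [h m le_rfl]
  congr 1
  refine Finset.sum_congr rfl fun p hp => ?_
  have := Finset.HasAntidiagonal.mem_antidiagonal.mp hp
  rw [h p.1 (by omega), h p.2 (by omega)]

/-- Homogeneity in the degree. It lets powers of time be stored as components of a graded vector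
without changing the equation. -/
theorem quadCoeff_pow_smul (B : V →ₗ[ℝ] V →ₗ[ℝ] V) (L : V →ₗ[ℝ] V) (c : ℕ → V) (t : ℝ) (m : ℕ) :
    quadCoeff B L (fun i => t ^ i • c i) m = t ^ m • quadCoeff B L c m := by
  unfold quadCoeff
  simp only [map_smul, LinearMap.smul_apply, smul_add, Finset.smul_sum]
  congr 1
  refine Finset.sum_congr rfl fun p hp => ?_
  rw [smul_smul, ← pow_add, add_comm p.2, Finset.HasAntidiagonal.mem_antidiagonal.mp hp]

/-- Coefficients, as power series in the step size, of the stages of an explicit scheme. -/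
def stageCoeff {s : ℕ} (A : Matrix (Fin (s + 1)) (Fin (s + 1)) ℝ) (B : V →ₗ[ℝ] V →ₗ[ℝ] V)
    (L : V →ₗ[ℝ] V) (y₀ : V) (i : Fin (s + 1)) : ℕ → V
  | 0 => y₀
  | m + 1 => ∑ j : Finset.Iio i, A i j • quadCoeff B L (stageCoeff A B L y₀ j) m
termination_by i
decreasing_by exact Fin.lt_def.mp (Finset.mem_Iio.mp j.2)

variable {s : ℕ} (A : Matrix (Fin (s + 1)) (Fin (s + 1)) ℝ) (B : V →ₗ[ℝ] V →ₗ[ℝ] V)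
    (L : V →ₗ[ℝ] V) (y₀ : V)

theorem stageCoeff_zero (i : Fin (s + 1)) : stageCoeff A B L y₀ i 0 = y₀ := by
  rw [stageCoeff]

theorem stageCoeff_succ (i : Fin (s + 1)) (m : ℕ) : stageCoeff A B L y₀ i (m + 1)
    = ∑ j ∈ Finset.Iio i, A i j • quadCoeff B L (stageCoeff A B L y₀ j) m := by
  rw [stageCoeff]
  exact Finset.sum_coe_sort (Finset.Iio i) fun j => A i j • quadCoeff B L (stageCoeff A B L y₀ j) m

theorem quadCoeff_eq_zero {c : ℕ → V} {N : ℕ} (hc : ∀ m, N ≤ m → c m = 0) {m : ℕ}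
    (hm : 2 * N ≤ m) : quadCoeff B L c m = 0 := by
  unfold quadCoeff
  rw [hc m (by omega), map_zero, add_zero]
  refine Finset.sum_eq_zero fun p hp => ?_
  have := Finset.HasAntidiagonal.mem_antidiagonal.mp hp
  rcases Nat.lt_or_ge p.1 N with h | h
  · rw [hc p.2 (by omega), map_zero]
  · rw [hc p.1 h, map_zero, LinearMap.zero_apply]

theorem sum_range_extend {c : ℕ → V} {N M : ℕ} (hc : ∀ m, N ≤ m → c m = 0) (hNM : N ≤ M) (h : ℝ) :
    ∑ m ∈ Finset.range N, h ^ m • c m = ∑ m ∈ Finset.range M, h ^ m • c m := by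
  refine Finset.sum_subset (Finset.range_mono hNM) fun m _ hm => ?_
  rw [hc m (by simpa using hm), smul_zero]

/-- Cauchy product of polynomials; `2 * N` is a convenient bound for the degrees that occur. -/
theorem quad_eval {c : ℕ → V} {N : ℕ} (hc : ∀ m, N ≤ m → c m = 0) (h : ℝ) :
    B (∑ m ∈ Finset.range N, h ^ m • c m) (∑ m ∈ Finset.range N, h ^ m • c m)
        + L (∑ m ∈ Finset.range N, h ^ m • c m)
      = ∑ m ∈ Finset.range (2 * N), h ^ m • quadCoeff B L c m := by
  have hL : L (∑ m ∈ Finset.range N, h ^ m • c m)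
      = ∑ m ∈ Finset.range (2 * N), h ^ m • L (c m) := by
    rw [sum_range_extend hc (by omega : N ≤ 2 * N)]
    simp
  rw [hL]
  unfold quadCoeff
  simp only [smul_add, Finset.sum_add_distrib]
  congr 1
  have h1 : ∀ m, h ^ m • ∑ p ∈ Finset.HasAntidiagonal.antidiagonal m, B (c p.1) (c p.2)
      = ∑ p ∈ Finset.HasAntidiagonal.antidiagonal m, B (h ^ p.1 • c p.1) (h ^ p.2 • c p.2) := by
    intro m
    rw [Finset.smul_sum]
    refine Finset.sum_congr rfl fun p hp => ?_
    rw [← Finset.HasAntidiagonal.mem_antidiagonal.mp hp, pow_add]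
    simp [smul_smul, mul_comm]
  simp only [h1, map_sum, LinearMap.sum_apply]
  -- Regroup the square of index pairs below `N` by total degree. Antidiagonal pairs outside the
  -- square contribute nothing, since one of their coefficients vanishes.
  rw [Finset.sum_comm, ← Finset.sum_product',
    ← Finset.sum_fiberwise_of_maps_to (s := Finset.range N ×ˢ Finset.range N)
      (t := Finset.range (2 * N)) (g := fun p => p.1 + p.2)]
  · refine Finset.sum_congr rfl fun m _ => Finset.sum_subset ?_ ?_
    · intro p hp
      exact Finset.HasAntidiagonal.mem_antidiagonal.mpr (Finset.mem_filter.mp hp).2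
    · intro p hp hp'
      have hp := Finset.HasAntidiagonal.mem_antidiagonal.mp hp
      simp only [Finset.mem_filter, Finset.mem_product, Finset.mem_range, not_and] at hp'
      rcases Nat.lt_or_ge p.1 N with h1 | h1
      · rcases Nat.lt_or_ge p.2 N with h2 | h2
        · exact absurd hp (hp' ⟨h1, h2⟩)
        · simp [hc p.2 h2]
      · simp [hc p.1 h1]
  · intro p hp
    simp only [Finset.mem_product, Finset.mem_range] at hp ⊢
    omega

/-- Letting `t → 0` kills the constant term; dividing by `t` lowers the degree and the power in the
bound together. -/
theorem coeff_eq_zero_of_norm_sum_le {E : Type*} [NormedAddCommGroup E] [NormedSpace ℝ E] {C r : ℝ}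
    (hr : 0 < r) (n : ℕ) (v : ℕ → E)
    (hv : ∀ t, 0 < t → t ≤ r → ‖∑ m ∈ Finset.range n, t ^ m • v m‖ ≤ C * t ^ n) :
    ∀ m < n, v m = 0 := by
  induction n generalizing v with
  | zero => simp
  | succ n ih =>
    have h0 : v 0 = 0 := by
      have hc : ContinuousWithinAt
          (fun t : ℝ => C * t ^ (n + 1) - ‖∑ m ∈ Finset.range (n + 1), t ^ m • v m‖) (Ioi 0) 0 := by
        fun_prop
      have hge : ∀ᶠ t in 𝓝[>] (0 : ℝ),
          0 ≤ C * t ^ (n + 1) - ‖∑ m ∈ Finset.range (n + 1), t ^ m • v m‖ := by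
        filter_upwards [Ioc_mem_nhdsGT hr] with t ht
        linarith [hv t ht.1 ht.2]
      have := ge_of_tendsto hc.tendsto hge
      rw [Finset.sum_range_succ'] at this
      simpa using this
    have hs : ∀ m < n, v (m + 1) = 0 := by
      refine ih (fun m => v (m + 1)) fun t ht htr => ?_
      have h := hv t ht htr
      rw [Finset.sum_range_succ', h0, smul_zero, add_zero] at h
      have h2 : ∑ m ∈ Finset.range n, t ^ (m + 1) • v (m + 1)
          = t • ∑ m ∈ Finset.range n, t ^ m • v (m + 1) := by
        rw [Finset.smul_sum]
        exact Finset.sum_congr rfl fun m _ => by rw [smul_smul, pow_succ']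
      rw [h2, norm_smul, Real.norm_of_nonneg ht.le, pow_succ'] at h
      have h3 : t * ‖∑ m ∈ Finset.range n, t ^ m • v (m + 1)‖ ≤ t * (C * t ^ n) := by linarith
      exact le_of_mul_le_mul_left h3 ht
    intro m hm
    cases m with
    | zero => exact h0
    | succ m => exact hs m (by omega)

/-- A scheme of order `k` for ordinary differential equations reproduces the first `k` Taylor
coefficients of the solution of a quadratic equation in any vector space. -/
theorem Tableau.HasOrder.update_coeff {k : ℕ} {tab : Tableau s} (hk : tab.HasOrder k) {y : ℕ → V}
    (hy : ∀ m : ℕ, ((m : ℝ) + 1) • y (m + 1) = quadCoeff B L y m) {m : ℕ} (hm : m < k) :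
    ∑ i, tab.b i • quadCoeff B L (stageCoeff tab.Ae B L (y 0) i) m = y (m + 1) := by
  classical
  set c := stageCoeff tab.Ae B L (y 0) with hc
  -- a finite-dimensional space which contains all the vectors involved
  set T : Set V := (⋃ m ∈ Finset.range (k + 1), {y m})
    ∪ (⋃ i, ⋃ m ∈ Finset.range (k + 1), {c i m})
    ∪ (⋃ i, ⋃ m ∈ Finset.range (k + 1), {quadCoeff B L (c i) m}) with hT
  have hTfin : T.Finite := by
    refine ((Finset.finite_toSet _).biUnion fun _ _ => finite_singleton _).union
      (finite_iUnion fun i => (Finset.finite_toSet _).biUnion fun _ _ => finite_singleton _) |>.union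
      (finite_iUnion fun i => (Finset.finite_toSet _).biUnion fun _ _ => finite_singleton _)
  set S := Submodule.span ℝ T with hS
  have hyS : ∀ m ≤ k, y m ∈ S := fun m hm => Submodule.subset_span <| Or.inl <| Or.inl <| by
    simp only [mem_iUnion, Finset.mem_range]
    exact ⟨m, by omega, rfl⟩
  have hcS : ∀ i, ∀ m ≤ k, c i m ∈ S := fun i m hm => Submodule.subset_span <| Or.inl <| Or.inr <| by
    simp only [mem_iUnion, Finset.mem_range]
    exact ⟨i, m, by omega, rfl⟩
  have hqS : ∀ i, ∀ m ≤ k, quadCoeff B L (c i) m ∈ S := fun i m hm =>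
    Submodule.subset_span <| Or.inr <| by
      simp only [mem_iUnion, Finset.mem_range]
      exact ⟨i, m, by omega, rfl⟩
  have : FiniteDimensional ℝ S := FiniteDimensional.span_of_finite ℝ hTfin
  obtain ⟨π, hπ⟩ := S.subtype.exists_leftInverse_of_injective S.ker_subtype
  have hπS : ∀ v ∈ S, ((π v : S) : V) = v := fun v hv =>
    congrArg Subtype.val (LinearMap.congr_fun hπ ⟨v, hv⟩)
  -- the equation, graded by the powers of time and truncated
  let ext : (Fin (k + 1) → S) →ₗ[ℝ] (ℕ → V) := LinearMap.pi fun n =>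
    if h : n < k + 1 then S.subtype ∘ₗ LinearMap.proj ⟨n, h⟩ else 0
  have hext : ∀ (w : (Fin (k + 1) → S)) (n : ℕ) (h : n < k + 1), ext w n = w ⟨n, h⟩ := by
    intro w n h
    simp only [ext, LinearMap.pi_apply, dif_pos h]
    rfl
  -- Component `n` is driven by the coefficient of degree `n - 1`, and component `0` is constant.
  -- Then `(t ^ n • y n)` solves the truncated system exactly, by the recursion for `y`. The map `π`
  -- only brings values back into `S`; it is the identity on all the vectors that matter.
  let Q : (Fin (k + 1) → S) →ₗ[ℝ] (Fin (k + 1) → S) →ₗ[ℝ] (Fin (k + 1) → S) := LinearMap.mk₂ ℝ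
    (fun w w' n => if (n : ℕ) = 0 then 0 else
      π (∑ p ∈ Finset.HasAntidiagonal.antidiagonal ((n : ℕ) - 1), B (ext w p.1) (ext w' p.2)))
    (fun w₁ w₂ w' => by
      funext n; by_cases h : (n : ℕ) = 0 <;> simp [h, -Fin.val_eq_zero_iff, Finset.sum_add_distrib])
    (fun a w w' => by
      funext n; by_cases h : (n : ℕ) = 0 <;> simp [h, -Fin.val_eq_zero_iff, Finset.smul_sum])
    (fun w w₁ w₂ => by
      funext n; by_cases h : (n : ℕ) = 0 <;> simp [h, -Fin.val_eq_zero_iff, Finset.sum_add_distrib])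
    (fun a w w' => by
      funext n; by_cases h : (n : ℕ) = 0 <;> simp [h, -Fin.val_eq_zero_iff, Finset.smul_sum])
  let Λ : (Fin (k + 1) → S) →ₗ[ℝ] (Fin (k + 1) → S) := LinearMap.pi fun n =>
    if (n : ℕ) = 0 then 0 else π ∘ₗ L ∘ₗ LinearMap.proj ((n : ℕ) - 1) ∘ₗ ext
  have hf : ∀ (w : (Fin (k + 1) → S)) (n : Fin (k + 1)), (Q w w + Λ w) n
      = if (n : ℕ) = 0 then 0 else π (quadCoeff B L (ext w) ((n : ℕ) - 1)) := by
    intro w n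
    by_cases h : (n : ℕ) = 0 <;> simp [Q, Λ, h, quadCoeff, -Fin.val_eq_zero_iff]
  let ofc : (ℕ → V) → ℝ → (Fin (k + 1) → S) := fun c h n => h ^ (n : ℕ) • π (c n)
  have hofc : ∀ (c : ℕ → V) (h : ℝ), (∀ m ≤ k, c m ∈ S) → ∀ n : Fin (k + 1),
      (Q (ofc c h) (ofc c h) + Λ (ofc c h)) n
        = if (n : ℕ) = 0 then 0 else h ^ ((n : ℕ) - 1) • π (quadCoeff B L c ((n : ℕ) - 1)) := by
    intro c h hcS n
    rw [hf]
    split_ifs with hn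
    · rfl
    rw [← map_smul, ← quadCoeff_pow_smul]
    congr 1
    refine quadCoeff_congr B L fun i hi => ?_
    have hi' : i < k + 1 := by omega
    rw [hext _ i hi']
    simp [ofc, hπS _ (hcS i (by omega))]
  -- coordinates
  let e : (Fin (k + 1) → S) ≃ₗ[ℝ] (Fin (Module.finrank ℝ (Fin (k + 1) → S)) → ℝ) := (Module.finBasis ℝ (Fin (k + 1) → S)).equivFun
  -- The second argument is ignored, so the implicit stages do not feed back and the order condition
  -- bears on `Ae` and `b` alone.
  let H : (Fin (Module.finrank ℝ (Fin (k + 1) → S)) → ℝ) → (Fin (Module.finrank ℝ (Fin (k + 1) → S)) → ℝ)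
      → (Fin (Module.finrank ℝ (Fin (k + 1) → S)) → ℝ) :=
    fun z _ => e (Q (e.symm z) (e.symm z) + Λ (e.symm z))
  have hH : ∀ w z, H (e w) z = e (Q w w + Λ w) := by simp [H]
  have hHsmooth : ContDiff ℝ ∞ (fun z : (Fin (Module.finrank ℝ (Fin (k + 1) → S)) → ℝ) ×
      (Fin (Module.finrank ℝ (Fin (k + 1) → S)) → ℝ) => H z.1 z.2) := by
    let Q' := ((Q.compl₁₂ e.symm.toLinearMap e.symm.toLinearMap).compr₂
      e.toLinearMap).toContinuousBilinearMap
    let Λ' := (e.toLinearMap ∘ₗ Λ ∘ₗ e.symm.toLinearMap).toContinuousLinearMap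
    have : (fun z : (Fin (Module.finrank ℝ (Fin (k + 1) → S)) → ℝ) × (Fin (Module.finrank ℝ (Fin (k + 1) → S)) → ℝ) => H z.1 z.2)
        = fun z => Q' z.1 z.1 + Λ' z.1 := by
      funext z
      simp [H, Q', Λ']
    rw [this]
    exact (Q'.isBoundedBilinearMap.contDiff.comp (contDiff_fst.prodMk contDiff_fst)).add
      (Λ'.contDiff.comp contDiff_fst)
  let E : Fin (k + 1) → S →ₗ[ℝ] (Fin (Module.finrank ℝ (Fin (k + 1) → S)) → ℝ) := fun n =>
    e.toLinearMap ∘ₗ LinearMap.single ℝ (fun _ => S) n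
  have heE : ∀ w : (Fin (k + 1) → S), e w = ∑ n, E n (w n) := by
    intro w
    conv_lhs => rw [← Finset.univ_sum_single w]
    rw [map_sum]
    rfl
  -- the exact solution
  have hsol : ∀ t ∈ Icc (0 : ℝ) 1, HasDerivWithinAt (fun t => e (ofc y t))
      (H (e (ofc y t)) (e (ofc y t))) (Icc 0 1) t := by
    intro t _
    rw [hH _ (e (ofc y t)), heE]
    simp only [heE, ofc, map_smul]
    refine (HasDerivAt.fun_sum fun n _ => ?_).hasDerivWithinAt
    rw [hofc y t hyS n]
    convert (hasDerivAt_pow (n : ℕ) t).smul_const (E n (π (y n))) using 1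
    split_ifs with hn
    · simp [hn]
    obtain ⟨j, hj⟩ := Nat.exists_eq_succ_of_ne_zero hn
    rw [hj, Nat.succ_eq_add_one, Nat.add_sub_cancel, ← hy j, map_smul, map_smul, map_smul,
      smul_smul, mul_comm]
    push_cast
    rfl
  -- the numerical solution
  let UE : ℝ → Fin (s + 1) → Fin (Module.finrank ℝ (Fin (k + 1) → S)) → ℝ := fun h i => e (ofc (c i) h)
  let UI : ℝ → Fin (s + 1) → Fin (Module.finrank ℝ (Fin (k + 1) → S)) → ℝ := fun h =>
    tab.implicitStage h H (e (ofc y 0)) (UE h) (fun _ => 0)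
  have hK : ∀ h i z, H (UE h i) z = ∑ n, E n ((fun n : Fin (k + 1) => if (n : ℕ) = 0 then 0 else
      h ^ ((n : ℕ) - 1) • π (quadCoeff B L (c i) ((n : ℕ) - 1))) n) := by
    intro h i z
    rw [hH _ z, heE]
    refine Finset.sum_congr rfl fun n _ => ?_
    rw [hofc _ _ (hcS i)]
  have hKc : ∀ i, Continuous fun h => H (UE h i) 0 := by
    intro i
    simp only [hK]
    refine continuous_finsetSum _ fun n _ => ?_
    by_cases hn : (n : ℕ) = 0
    · simp only [hn, if_true, map_zero]
      exact continuous_const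
    · simp only [hn, if_false, map_smul]
      fun_prop
  have hUEc : ∀ i, Continuous fun h => UE h i := by
    intro i
    simp only [UE, heE, ofc, map_smul]
    fun_prop
  have hUIc : ∀ i, Continuous fun h => UI h i := by
    intro i
    simp only [UI, Tableau.implicitStage, Tableau.starStage]
    have := hKc
    fun_prop
  -- The order hypothesis speaks only of stages in a fixed ball; continuity in `h` on a compact
  -- interval supplies one.
  obtain ⟨R, hR⟩ : ∃ R : ℝ, ∀ h ∈ Icc (0 : ℝ) 1, ∀ i, ‖UE h i‖ ≤ R ∧ ‖UI h i‖ ≤ R := by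
    have hcont : Continuous fun h => (fun i => (UE h i, UI h i)) :=
      continuous_pi fun i => (hUEc i).prodMk (hUIc i)
    obtain ⟨R, hR⟩ := isCompact_Icc.exists_bound_of_continuousOn (hcont.continuousOn (s := Icc 0 1))
    refine ⟨R, fun h hh i => ?_⟩
    have h1 := (norm_le_pi_norm (fun i => (UE h i, UI h i)) i).trans (hR h hh)
    exact ⟨(norm_fst_le _).trans h1, (norm_snd_le _).trans h1⟩
  obtain ⟨C, h₀, hh₀, hC⟩ := hk _ H hHsmooth 1 (fun t => e (ofc y t)) one_pos hsol R
  have herr : ∀ h, 0 < h → h ≤ min h₀ 1 →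
      ‖tab.update h H (e (ofc y 0)) (UE h) (UI h) - e (ofc y h)‖ ≤ C * h ^ (k + 1) := by
    intro h hpos hle
    refine hC h hpos (hle.trans (min_le_left _ _)) (hle.trans (min_le_right _ _)) _ _ ?_
      (fun i => rfl) fun i => hR h ⟨hpos.le, hle.trans (min_le_right _ _)⟩ i
    intro i
    simp only [Tableau.explicitStage, UE, hH]
    simp only [← map_smul, ← map_sum, ← map_add]
    congr 1
    funext n
    simp only [Pi.add_apply, Pi.smul_apply, Finset.sum_apply]
    have h1 := fun j => hofc (c j) h (hcS j) n
    simp only [Pi.add_apply] at h1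
    simp only [h1]
    rcases Nat.eq_zero_or_eq_succ_pred (n : ℕ) with hn | hn
    · simp [ofc, hn, hc, stageCoeff_zero]
    · rw [Nat.pred_eq_sub_one] at hn
      set j := (n : ℕ) - 1
      simp only [ofc, hn, Nat.succ_ne_zero, if_false, Nat.succ_eq_add_one, hc, stageCoeff_succ]
      rw [← hc]
      simp only [map_sum, map_smul, Finset.smul_sum, ne_eq, Nat.succ_ne_zero, not_false_eq_true,
        zero_pow, zero_smul, zero_add, smul_smul]
      refine Finset.sum_congr rfl fun l _ => ?_
      congr 1
      ring
  -- The defect in degree `n` between update and exact solution. It vanishes in degree `0` because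
  -- both start from `y 0`.
  let D : ℕ → S := fun n => if n = 0 then 0 else
    ∑ i, tab.b i • π (quadCoeff B L (c i) (n - 1)) - π (y n)
  let v : ℕ → Fin (Module.finrank ℝ (Fin (k + 1) → S)) → ℝ := fun n =>
    if h : n < k + 1 then E ⟨n, h⟩ (D n) else 0
  have hv : ∀ h, 0 < h → h ≤ min h₀ 1 →
      ‖∑ n ∈ Finset.range (k + 1), h ^ n • v n‖ ≤ C * h ^ (k + 1) := by
    intro h hpos hle
    convert herr h hpos hle using 2
    simp only [Tableau.update, UE, hH]
    simp only [← map_smul, ← map_sum, ← map_add, ← map_sub]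
    rw [heE, Finset.sum_range]
    refine Finset.sum_congr rfl fun n _ => ?_
    simp only [v, n.2, dif_pos, Fin.eta, ← map_smul]
    congr 1
    simp only [Pi.add_apply, Pi.sub_apply, Pi.smul_apply, Finset.sum_apply]
    have h1 := fun j => hofc (c j) h (hcS j) n
    simp only [Pi.add_apply] at h1
    simp only [h1]
    rcases Nat.eq_zero_or_eq_succ_pred (n : ℕ) with hn | hn
    · simp [ofc, hn, D]
    · rw [Nat.pred_eq_sub_one] at hn
      set j := (n : ℕ) - 1
      simp only [ofc, hn, Nat.succ_ne_zero, if_false, Nat.succ_eq_add_one, D]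
      simp only [smul_sub, Finset.smul_sum, ne_eq, Nat.succ_ne_zero, not_false_eq_true,
        zero_pow, zero_smul, zero_add, smul_smul, Nat.add_sub_cancel]
      congr 1
      refine Finset.sum_congr rfl fun l _ => ?_
      congr 1
      ring
  have hD := coeff_eq_zero_of_norm_sum_le (lt_min hh₀ one_pos) (k + 1) v hv (m + 1) (by omega)
  have hm1 : m + 1 < k + 1 := by omega
  simp only [v, hm1, dif_pos, E, LinearMap.comp_apply, LinearEquiv.coe_coe,
    LinearEquiv.map_eq_zero_iff, LinearMap.single_apply, Pi.single_eq_zero_iff] at hD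
  simp only [D, Nat.succ_ne_zero, if_false, Nat.add_sub_cancel] at hD
  have h2 := congrArg Subtype.val (sub_eq_zero.mp hD)
  rw [hπS _ (hyS _ (by omega))] at h2
  rw [← h2]
  simp only [Submodule.coe_sum, Submodule.coe_smul]
  exact Finset.sum_congr rfl fun i _ => by rw [hπS _ (hqS i m hm.le)]

/-- An explicit stage arises from earlier ones by finitely many quadratic operations, so it is a
polynomial in the step size. A product at most doubles the degree bound and the factor `h` adds one;
the sum over all stages merely dominates each earlier bound. -/
theorem stageCoeff_finite (i : Fin (s + 1)) :
    ∃ N, ∀ m, N ≤ m → stageCoeff A B L y₀ i m = 0 := by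
  induction i using WellFoundedLT.induction with
  | ind i ih =>
    choose! N hN using ih
    refine ⟨2 * (∑ j, N j) + 1, fun m hm => ?_⟩
    obtain ⟨m, rfl⟩ := Nat.exists_eq_succ_of_ne_zero (by omega : m ≠ 0)
    rw [Nat.succ_eq_add_one, stageCoeff_succ]
    refine Finset.sum_eq_zero fun j hj => ?_
    have hle : N j ≤ ∑ j, N j := Finset.single_le_sum (fun _ _ => Nat.zero_le _) (Finset.mem_univ j)
    rw [quadCoeff_eq_zero B L (hN j (Finset.mem_Iio.mp hj)) (by omega), smul_zero]

/-- The update of a scheme of order `k`, as a polynomial in the step size. -/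
theorem Tableau.HasOrder.exists_update_expansion {k : ℕ} {tab : Tableau s} (hk : tab.HasOrder k)
    {y : ℕ → V} (hy : ∀ m : ℕ, ((m : ℝ) + 1) • y (m + 1) = quadCoeff B L y m) :
    ∃ (N : ℕ) (w : ℕ → V), ∀ (h : ℝ) (Y : Fin (s + 1) → V),
      (∀ i, Y i = y 0 + h • ∑ j ∈ Finset.Iio i, tab.Ae i j • (B (Y j) (Y j) + L (Y j))) →
      y 0 + h • ∑ i, tab.b i • (B (Y i) (Y i) + L (Y i))
        = ∑ m ∈ Finset.range (k + 1), h ^ m • y m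
          + h ^ (k + 1) • ∑ m ∈ Finset.range N, h ^ m • w m := by
  set c := stageCoeff tab.Ae B L (y 0) with hc
  choose N₀ hN₀ using stageCoeff_finite tab.Ae B L (y 0)
  set N := ∑ j, N₀ j with hN
  have hcN : ∀ i m, N ≤ m → c i m = 0 := fun i m hm =>
    hN₀ i m ((Finset.single_le_sum (fun _ _ => Nat.zero_le _) (Finset.mem_univ i)).trans hm)
  have hsum : ∀ (h : ℝ) (t : Finset (Fin (s + 1))) (a : Fin (s + 1) → ℝ) (M : ℕ),
      h • ∑ j ∈ t, a j • ∑ m ∈ Finset.range M, h ^ m • quadCoeff B L (c j) m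
        = ∑ m ∈ Finset.range M, h ^ (m + 1) • ∑ j ∈ t, a j • quadCoeff B L (c j) m := by
    intro h t a M
    simp only [Finset.smul_sum, smul_smul]
    rw [Finset.sum_comm]
    refine Finset.sum_congr rfl fun m _ => Finset.sum_congr rfl fun j _ => ?_
    congr 1
    ring
  -- The coefficients of degree above `k` of the update. The prefactor `h` raises index `k + m` to
  -- degree `k + m + 1`. They are built from `y 0` and the tableau, hence independent of `h` and
  -- `Y`.
  refine ⟨2 * N, fun m => ∑ i, tab.b i • quadCoeff B L (c i) (k + m), fun h Y hY => ?_⟩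
  have hYc : ∀ i, Y i = ∑ m ∈ Finset.range N, h ^ m • c i m := by
    intro i
    induction i using WellFoundedLT.induction with
    | ind i ih =>
      rw [hY i, sum_range_extend (hcN i) (by omega : N ≤ 2 * N + 1), Finset.sum_range_succ',
        add_comm, pow_zero, one_smul, hc, stageCoeff_zero, ← hc]
      congr 1
      simp only [hc, stageCoeff_succ]
      rw [← hc, ← hsum]
      congr 1
      refine Finset.sum_congr rfl fun j hj => ?_
      rw [← quad_eval B L (hcN j), ← ih j (Finset.mem_Iio.mp hj)]
  have hq : ∀ i, B (Y i) (Y i) + L (Y i)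
      = ∑ m ∈ Finset.range (k + 2 * N), h ^ m • quadCoeff B L (c i) m := by
    intro i
    rw [hYc i, quad_eval B L (hcN i)]
    exact sum_range_extend (fun m hm => quadCoeff_eq_zero B L (hcN i) hm) (by omega) h
  simp only [hq]
  rw [hsum, Finset.sum_range_add, Finset.sum_range_succ', pow_zero, one_smul, add_comm (y 0),
    add_right_comm]
  congr 2
  · exact Finset.sum_congr rfl fun m hm => by
      rw [hk.update_coeff B L hy (Finset.mem_range.mp hm)]
  · rw [Finset.smul_sum]
    exact Finset.sum_congr rfl fun m _ => by rw [smul_smul]; congr 1; ring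

end Quadratic

end

/-! ### Vector calculus on the domain and the weighted Helmholtz splitting. -/

section

variable {d : ℕ} {Ω : Domain d}
  {F G H : Type*} [NormedAddCommGroup F] [NormedSpace ℝ F] [NormedAddCommGroup G] [NormedSpace ℝ G]
  [NormedAddCommGroup H] [NormedSpace ℝ H]

/-! ### Differential operators in terms of the derivative -/

/-- The trace, as a continuous linear form. -/
def traceCLM (d : ℕ) : (Space d →L[ℝ] Space d) →L[ℝ] ℝ :=
  ∑ j, (EuclideanSpace.proj j : Space d →L[ℝ] ℝ) ∘L
    (ContinuousLinearMap.apply ℝ (Space d) (EuclideanSpace.single j (1 : ℝ)))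

/-- The gradient vector of a linear form, as a continuous linear map. -/
def gradCLM (d : ℕ) : (Space d →L[ℝ] ℝ) →L[ℝ] Space d :=
  ∑ j, (ContinuousLinearMap.apply ℝ ℝ (EuclideanSpace.single j (1 : ℝ))).smulRight
    (EuclideanSpace.single j (1 : ℝ))

/-- The inner product, as a continuous bilinear map. -/
def innerCLM (d : ℕ) : Space d →L[ℝ] Space d →L[ℝ] ℝ :=
  (isBoundedBilinearMap_inner (𝕜 := ℝ) (E := Space d)).toContinuousLinearMap

theorem hasFDerivAt_coord {v : Space d → Space d} {x : Space d} (hv : DifferentiableAt ℝ v x)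
    (j : Fin d) : HasFDerivAt (fun y => v y j)
      ((EuclideanSpace.proj j : Space d →L[ℝ] ℝ) ∘L fderiv ℝ v x) x :=
  (EuclideanSpace.proj j : Space d →L[ℝ] ℝ).hasFDerivAt.comp x hv.hasFDerivAt

theorem div_eq_trace {v : Space d → Space d} {x : Space d} (hv : DifferentiableAt ℝ v x) :
    div v x = traceCLM d (fderiv ℝ v x) := by
  simp only [div, traceCLM, sum_apply]
  refine Finset.sum_congr rfl fun j _ => ?_
  rw [(hasFDerivAt_coord hv j).fderiv]
  rfl

theorem inner_gradCLM (L : Space d →L[ℝ] ℝ) (v : Space d) : inner ℝ (gradCLM d L) v = L v := by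
  have hv : v = ∑ j, v j • EuclideanSpace.single j (1 : ℝ) := by
    ext i
    simp [Finset.sum_apply, Pi.single_apply]
  conv_rhs => rw [hv]
  simp [gradCLM, sum_inner, inner_smul_left, EuclideanSpace.inner_single_left, mul_comm]

theorem gradient_eq (f : Space d → ℝ) (x : Space d) : gradient f x = gradCLM d (fderiv ℝ f x) := by
  refine ext_inner_right ℝ fun v => ?_
  rw [inner_gradCLM]
  simp [gradient, InnerProductSpace.toDual_symm_apply]

/-- Product rule `∇·(v ⊗ w) = (w·∇) v + (∇·w) v`. In this form bilinearity, convergence and time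
derivatives follow from those of the first derivatives. -/
theorem divTensor_eq {v w : Space d → Space d} {x : Space d} (hv : DifferentiableAt ℝ v x)
    (hw : DifferentiableAt ℝ w x) :
    divTensor v w x = fderiv ℝ v x (w x) + traceCLM d (fderiv ℝ w x) • v x := by
  ext i
  have hd : HasFDerivAt (fun y => v y i • w y) (v x i • fderiv ℝ w x +
      ((EuclideanSpace.proj i : Space d →L[ℝ] ℝ) ∘L fderiv ℝ v x).smulRight (w x)) x :=
    (hasFDerivAt_coord hv i).smul hw.hasFDerivAt
  have h1 : divTensor v w x i = div (fun y => v y i • w y) x := rfl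
  rw [h1, div_eq_trace hd.differentiableAt]
  have hw' : w x = ∑ j, (w x) j • EuclideanSpace.single j (1 : ℝ) := by
    ext i
    simp [Finset.sum_apply, Pi.single_apply]
  rw [hd.fderiv]
  conv_rhs => rw [hw']
  simp [traceCLM, Finset.sum_add_distrib, Finset.mul_sum, mul_comm, add_comm]

theorem div_congr_on {v w : Space d → Space d} (h : EqOn v w Ω.carrier) {x : Space d}
    (hx : x ∈ Ω.carrier) : div v x = div w x := by
  unfold div
  refine Finset.sum_congr rfl fun j _ => ?_
  rw [fderiv_congr_on (Ω := Ω) (f := fun y => v y j) (g := fun y => w y j)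
    (fun y hy => by simp only [h hy]) hx]

theorem gradient_congr_on {f g : Space d → ℝ} (h : EqOn f g Ω.carrier) {x : Space d}
    (hx : x ∈ Ω.carrier) : gradient f x = gradient g x := by
  rw [gradient_eq, gradient_eq, fderiv_congr_on h hx]

namespace FamConv

theorem div {v : ℝ → Space d → Space d} {v₀ : Space d → Space d} (hv : FamConv Ω v v₀) :
    FamConv Ω (fun ε => div (v ε)) (div v₀) := by
  refine (hv.fderiv.clm (traceCLM d)).congr ?_
    fun x hx => div_eq_trace (differentiableAt_on hv.field.contDiffOn hx)
  filter_upwards [hv.bdd.smooth] with ε h x hx using div_eq_trace (differentiableAt_on h hx)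

theorem gradient {f : ℝ → Space d → ℝ} {f₀ : Space d → ℝ} (hf : FamConv Ω f f₀) :
    FamConv Ω (fun ε => gradient (f ε)) (gradient f₀) :=
  (hf.fderiv.clm (gradCLM d)).congr (Eventually.of_forall fun ε x _ => gradient_eq (f ε) x)
    fun x _ => gradient_eq f₀ x

theorem divTensor {v w : ℝ → Space d → Space d} {v₀ w₀ : Space d → Space d} (hv : FamConv Ω v v₀)
    (hw : FamConv Ω w w₀) : FamConv Ω (fun ε => divTensor (v ε) (w ε)) (divTensor v₀ w₀) := by
  refine ((hv.fderiv.bilin (ContinuousLinearMap.id ℝ _) hw).add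
    ((hw.fderiv.clm (traceCLM d)).smul hv)).congr ?_ fun x hx => divTensor_eq
      (differentiableAt_on hv.field.contDiffOn hx) (differentiableAt_on hw.field.contDiffOn hx)
  filter_upwards [hv.bdd.smooth, hw.bdd.smooth] with ε h h' x hx using
    divTensor_eq (differentiableAt_on h hx) (differentiableAt_on h' hx)

theorem inner {v w : ℝ → Space d → Space d} {v₀ w₀ : Space d → Space d} (hv : FamConv Ω v v₀)
    (hw : FamConv Ω w w₀) :
    FamConv Ω (fun ε x => inner ℝ (v ε x) (w ε x)) (fun x => inner ℝ (v₀ x) (w₀ x)) :=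
  hv.bilin (innerCLM d) hw

end FamConv

namespace SmoothField

variable {f g : Space d → F}

theorem congr (hf : SmoothField Ω f) (h : EqOn g f Ω.carrier) : SmoothField Ω g :=
  ((FamConv.const hf).congr (Eventually.of_forall fun _ => eqOn_refl _ _) h).field

theorem add (hf : SmoothField Ω f) (hg : SmoothField Ω g) : SmoothField Ω (fun x => f x + g x) :=
  ((FamConv.const hf).add (.const hg)).field

theorem const_smul (c : ℝ) (hf : SmoothField Ω f) : SmoothField Ω (fun x => c • f x) :=
  ((FamConv.const hf).const_smul c).field

theorem zero : SmoothField Ω (fun _ => (0 : F)) := FamConv.zero.field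

theorem neg (hf : SmoothField Ω f) : SmoothField Ω (fun x => -f x) := (FamConv.const hf).neg.field

theorem sub (hf : SmoothField Ω f) (hg : SmoothField Ω g) : SmoothField Ω (fun x => f x - g x) :=
  ((FamConv.const hf).sub (.const hg)).field

theorem smul {f : Space d → ℝ} (hf : SmoothField Ω f) (hg : SmoothField Ω g) :
    SmoothField Ω (fun x => f x • g x) :=
  ((FamConv.const hf).smul (.const hg)).field

theorem mul {f g : Space d → ℝ} (hf : SmoothField Ω f) (hg : SmoothField Ω g) :
    SmoothField Ω (fun x => f x * g x) := hf.smul hg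

theorem inv {f : Space d → ℝ} (hf : SmoothField Ω f) {c : ℝ} (hc : 0 < c)
    (h : ∀ x ∈ Ω.carrier, c ≤ f x) : SmoothField Ω (fun x => (f x)⁻¹) :=
  ((FamConv.const hf).inv hc h).field

theorem gradient {f : Space d → ℝ} (hf : SmoothField Ω f) : SmoothField Ω (gradient f) :=
  (FamConv.const hf).gradient.field

theorem divTensor {v w : Space d → Space d} (hv : SmoothField Ω v) (hw : SmoothField Ω w) :
    SmoothField Ω (divTensor v w) := ((FamConv.const hv).divTensor (.const hw)).field

theorem inner {v w : Space d → Space d} (hv : SmoothField Ω v) (hw : SmoothField Ω w) :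
    SmoothField Ω (fun x => inner ℝ (v x) (w x)) := ((FamConv.const hv).inner (.const hw)).field

theorem const (c : ℝ) : SmoothField Ω (fun _ => c) := (BddFam.real_const c).smoothField

theorem differentiableAt (hf : SmoothField Ω f) {x : Space d} (hx : x ∈ Ω.carrier) :
    DifferentiableAt ℝ f x := differentiableAt_on hf.contDiffOn hx

theorem norm_bounded (hf : SmoothField Ω f) : ∃ C : ℝ, ∀ x ∈ Ω.carrier, ‖f x‖ ≤ C := by
  simpa using hf.bounded 0

end SmoothField

/-! ### Integrals over the period cell -/

theorem volume_cell_lt_top (Ω : Domain d) : volume Ω.cell < ⊤ := Ω.bounded_cell.measure_lt_top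

theorem aestronglyMeasurable_cell {F : Type*} [NormedAddCommGroup F] {f : Space d → F} (hf : ContinuousOn f Ω.carrier)
    [SecondCountableTopologyEither (Space d) F] :
    AEStronglyMeasurable f (volume.restrict Ω.cell) :=
  (hf.aestronglyMeasurable Ω.isOpen.measurableSet).mono_set Ω.cell_subset

theorem SmoothField.integrableOn {f : Space d → ℝ} (hf : SmoothField Ω f) :
    IntegrableOn f Ω.cell := by
  obtain ⟨C, hC⟩ := hf.norm_bounded
  have : IsFiniteMeasure (volume.restrict Ω.cell) :=
    ⟨by rw [Measure.restrict_apply_univ]; exact volume_cell_lt_top Ω⟩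
  exact Integrable.of_bound (aestronglyMeasurable_cell hf.contDiffOn.continuousOn) C
    (ae_restrict_of_forall_mem Ω.measurable_cell fun x hx => hC x (Ω.cell_subset hx))

/-- Dominated convergence: the family is uniformly bounded and the cell has finite measure. -/
theorem FamConv.tendsto_integral {f : ℝ → Space d → ℝ} {f₀ : Space d → ℝ} (hf : FamConv Ω f f₀) :
    Tendsto (fun ε => ∫ x in Ω.cell, f ε x) (𝓝[>] 0) (𝓝 (∫ x in Ω.cell, f₀ x)) := by
  obtain ⟨C, hC⟩ := hf.bdd.bounded 0
  have : IsFiniteMeasure (volume.restrict Ω.cell) :=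
    ⟨by rw [Measure.restrict_apply_univ]; exact volume_cell_lt_top Ω⟩
  refine tendsto_integral_filter_of_dominated_convergence (fun _ => C) ?_ ?_
    (integrable_const C) ?_
  · filter_upwards [hf.bdd.smooth] with ε h using aestronglyMeasurable_cell h.continuousOn
  · filter_upwards [hC] with ε h
    refine ae_restrict_of_forall_mem Ω.measurable_cell fun x hx => ?_
    simpa using h x (Ω.cell_subset hx)
  · exact ae_restrict_of_forall_mem Ω.measurable_cell fun x hx => hf.tendsto_at (Ω.cell_subset hx)

/-! ### Solenoidal fields and uniqueness of the projection -/

/-- A divergence-free field with no flux through the walls. -/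
structure Solenoidal (Ω : Domain d) (v : Space d → Space d) : Prop where
  field : SmoothField Ω v
  div_zero : ∀ x ∈ Ω.carrier, div v x = 0
  orthogonal : ∀ φ : Space d → ℝ, SmoothField Ω φ →
    ∫ x in Ω.cell, inner ℝ (v x) (gradient φ x) = 0

theorem NoFlux.solenoidal {v : Space d → Space d} (h : NoFlux Ω v) (hv : SmoothField Ω v)
    (hdiv : ∀ x ∈ Ω.carrier, div v x = 0) : Solenoidal Ω v := by
  refine ⟨hv, hdiv, fun φ hφ => ?_⟩
  rw [← h φ hφ]
  refine setIntegral_congr_fun Ω.measurable_cell fun x hx => ?_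
  simp [hdiv x (Ω.cell_subset hx)]

/-- The weak wall condition involves `v` and its first derivatives linearly, so it survives the
limit for each fixed test field, with no regularity of the boundary. -/
theorem NoFlux.of_famConv {v : ℝ → Space d → Space d} {v₀ : Space d → Space d}
    (hv : FamConv Ω v v₀) (h : ∀ᶠ ε in 𝓝[>] (0 : ℝ), NoFlux Ω (v ε)) : NoFlux Ω v₀ := by
  intro φ hφ
  have ht := ((hv.inner (FamConv.const hφ).gradient).add
    ((FamConv.const hφ).mul hv.div)).tendsto_integral
  refine tendsto_nhds_unique (ht.congr' ?_) tendsto_const_nhds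
  filter_upwards [h] with ε hε using hε φ hφ

namespace Solenoidal

variable {v w : Space d → Space d}

theorem congr (hv : Solenoidal Ω v) (h : EqOn w v Ω.carrier) : Solenoidal Ω w := by
  refine ⟨hv.field.congr h, fun x hx => ?_, fun φ hφ => ?_⟩
  · rw [div_congr_on h hx, hv.div_zero x hx]
  · rw [← hv.orthogonal φ hφ]
    exact setIntegral_congr_fun Ω.measurable_cell fun x hx => by
      simp only [h (Ω.cell_subset hx)]

theorem zero : Solenoidal Ω (fun _ => 0) :=
  ⟨.zero, fun x _ => by simp [div], fun φ _ => by simp⟩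

theorem add (hv : Solenoidal Ω v) (hw : Solenoidal Ω w) : Solenoidal Ω (fun x => v x + w x) := by
  refine ⟨hv.field.add hw.field, fun x hx => ?_, fun φ hφ => ?_⟩
  · rw [div_eq_trace ((hv.field.add hw.field).differentiableAt hx),
      fderiv_fun_add (hv.field.differentiableAt hx) (hw.field.differentiableAt hx), map_add,
      ← div_eq_trace (hv.field.differentiableAt hx), ← div_eq_trace (hw.field.differentiableAt hx),
      hv.div_zero x hx, hw.div_zero x hx, add_zero]
  · simp only [inner_add_left]
    rw [integral_add (hv.field.inner hφ.gradient).integrableOn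
      (hw.field.inner hφ.gradient).integrableOn, hv.orthogonal φ hφ, hw.orthogonal φ hφ, add_zero]

theorem const_smul (c : ℝ) (hv : Solenoidal Ω v) : Solenoidal Ω (fun x => c • v x) := by
  refine ⟨hv.field.const_smul c, fun x hx => ?_, fun φ hφ => ?_⟩
  · rw [div_eq_trace ((hv.field.const_smul c).differentiableAt hx),
      fderiv_fun_const_smul (hv.field.differentiableAt hx), map_smul,
      ← div_eq_trace (hv.field.differentiableAt hx), hv.div_zero x hx, smul_zero]
  · simp only [inner_smul_left]
    rw [integral_const_mul, hv.orthogonal φ hφ, mul_zero]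

theorem sum {ι : Type*} (s : Finset ι) {v : ι → Space d → Space d}
    (h : ∀ i ∈ s, Solenoidal Ω (v i)) : Solenoidal Ω (fun x => ∑ i ∈ s, v i x) := by
  classical
  induction s using Finset.induction_on with
  | empty => simpa using zero
  | insert i s hi ih =>
    simp only [Finset.sum_insert hi]
    exact (h i (Finset.mem_insert_self _ _)).add
      (ih fun j hj => h j (Finset.mem_insert_of_mem hj))

end Solenoidal

/-- A field which vanishes almost everywhere on the period cell vanishes on the domain. -/
theorem SmoothField.eqOn_zero_of_ae_cell {v : Space d → F} (hv : SmoothField Ω v)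
    (h : ∀ᵐ x ∂(volume.restrict Ω.cell), v x = 0) : EqOn v 0 Ω.carrier := by
  by_contra hne
  have hne' : ∃ x ∈ Ω.carrier, v x ≠ 0 := by
    simpa [EqOn] using hne
  obtain ⟨x₀, hx₀, hvx₀⟩ := hne'
  set U := Ω.carrier ∩ v ⁻¹' {0}ᶜ with hU
  have hUo : IsOpen U := hv.contDiffOn.continuousOn.isOpen_inter_preimage Ω.isOpen isOpen_compl_singleton
  have hpos : 0 < volume U := hUo.measure_pos volume ⟨x₀, hx₀, hvx₀⟩
  -- Discreteness makes the periods countable, so the translates of a null subset of the cell, which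
  -- cover the set where `v` is nonzero, still form a null set.
  have := Ω.discrete
  have : Countable Ω.periods := by
    exact TopologicalSpace.separableSpace_iff_countable.mp inferInstance
  have hN : volume (Ω.cell ∩ {x | v x ≠ 0}) = 0 := by
    have := (ae_restrict_iff' Ω.measurable_cell).mp h
    rw [ae_iff] at this
    convert this using 2
    ext x
    simp
  have hsub : U ⊆ ⋃ p : Ω.periods, (fun x => x + (p : Space d)) ⁻¹' (Ω.cell ∩ {x | v x ≠ 0}) := by
    rintro x ⟨hx, hvx⟩
    obtain ⟨p, hp, -⟩ := Ω.existsUnique_cell x hx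
    refine mem_iUnion.mpr ⟨p, hp, ?_⟩
    simpa [hv.periodic p p.2 x hx] using hvx
  have hzero : volume (⋃ p : Ω.periods,
      (fun x => x + (p : Space d)) ⁻¹' (Ω.cell ∩ {x | v x ≠ 0})) = 0 := by
    refine measure_iUnion_null fun p => ?_
    rw [measure_preimage_add_right, hN]
  exact hpos.ne' (measure_mono_null hsub hzero)

/-- Weighted orthogonality: a solenoidal field of the form `ρ ∇ψ` vanishes. -/
theorem Solenoidal.eqOn_zero {v : Space d → Space d} (hv : Solenoidal Ω v) {ρ ψ : Space d → ℝ}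
    {c : ℝ} (hc : 0 < c) (hρ : ∀ x ∈ Ω.carrier, c ≤ ρ x) (hψ : SmoothField Ω ψ)
    (h : ∀ x ∈ Ω.carrier, v x = ρ x • gradient ψ x) : EqOn v 0 Ω.carrier := by
  refine hv.field.eqOn_zero_of_ae_cell ?_
  -- Test the orthogonality with `ψ` itself: the integrand is `ρ |∇ψ|²`.
  have hnn : 0 ≤ᵐ[volume.restrict Ω.cell] fun x => inner ℝ (v x) (gradient ψ x) := by
    refine ae_restrict_of_forall_mem Ω.measurable_cell fun x hx => ?_
    have hx := Ω.cell_subset hx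
    simp only [h x hx, inner_smul_left, real_inner_self_eq_norm_sq, Pi.zero_apply, conj_trivial]
    exact mul_nonneg (hc.le.trans (hρ x hx)) (sq_nonneg _)
  have h0 := (setIntegral_eq_zero_iff_of_nonneg_ae hnn
    (hv.field.inner hψ.gradient).integrableOn).mp (hv.orthogonal ψ hψ)
  filter_upwards [h0, ae_restrict_mem Ω.measurable_cell] with x hx hxc
  have hxc := Ω.cell_subset hxc
  simp only [h x hxc, inner_smul_left, real_inner_self_eq_norm_sq, Pi.zero_apply, conj_trivial,
    mul_eq_zero, (hc.trans_le (hρ x hxc)).ne', false_or, pow_eq_zero_iff, ne_eq, OfNat.ofNat_ne_zero,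
    not_false_eq_true, norm_eq_zero] at hx
  rw [h x hxc, hx, smul_zero]

end

section

variable {d : ℕ} {Ω : Domain d} {T : ℝ}
  {F G H : Type*} [NormedAddCommGroup F] [NormedSpace ℝ F] [NormedAddCommGroup G] [NormedSpace ℝ G]
  [NormedAddCommGroup H] [NormedSpace ℝ H]

/-! ### Time-dependent fields -/

theorem uniqueDiffOn_cylinder (Ω : Domain d) (hT : 0 < T) :
    UniqueDiffOn ℝ (Icc 0 T ×ˢ Ω.carrier) :=
  (uniqueDiffOn_Icc hT).prod Ω.isOpen.uniqueDiffOn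

/-- The derivative in time and space of a time-dependent field. -/
def cylDeriv (Ω : Domain d) (T : ℝ) (f : ℝ → Space d → F) (z : ℝ × Space d) :
    ℝ × Space d →L[ℝ] F :=
  fderivWithin ℝ (fun z : ℝ × Space d => f z.1 z.2) (Icc 0 T ×ˢ Ω.carrier) z

/-- The partial derivative in time on the time interval `[0, T]`. -/
def timeDeriv (T : ℝ) (f : ℝ → Space d → F) (t : ℝ) (x : Space d) : F :=
  derivWithin (fun τ => f τ x) (Icc 0 T) t

namespace SmoothTimeField

variable {f : ℝ → Space d → F}

theorem hasFDerivWithinAt (hf : SmoothTimeField Ω T f) {z : ℝ × Space d}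
    (hz : z ∈ Icc 0 T ×ˢ Ω.carrier) :
    HasFDerivWithinAt (fun z : ℝ × Space d => f z.1 z.2) (cylDeriv Ω T f z)
      (Icc 0 T ×ˢ Ω.carrier) z :=
  (hf.contDiffOn.differentiableOn (by simp) z hz).hasFDerivWithinAt

theorem hasDerivWithinAt_cylDeriv (hf : SmoothTimeField Ω T f) {t : ℝ} (ht : t ∈ Icc 0 T)
    {x : Space d} (hx : x ∈ Ω.carrier) :
    HasDerivWithinAt (fun τ => f τ x) (cylDeriv Ω T f (t, x) (1, 0)) (Icc 0 T) t := by
  have h1 : HasDerivWithinAt (fun τ : ℝ => (τ, x)) (1, 0) (Icc 0 T) t :=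
    (hasDerivWithinAt_id t _).prodMk (hasDerivWithinAt_const t _ x)
  exact (hf.hasFDerivWithinAt (z := (t, x)) ⟨ht, hx⟩).comp_hasDerivWithinAt t h1
    (show MapsTo (fun τ => (τ, x)) (Icc 0 T) (Icc 0 T ×ˢ Ω.carrier) from fun τ hτ => ⟨hτ, hx⟩)

theorem hasFDerivAt_cylDeriv (hf : SmoothTimeField Ω T f) {t : ℝ} (ht : t ∈ Icc 0 T)
    {x : Space d} (hx : x ∈ Ω.carrier) :
    HasFDerivAt (f t) ((cylDeriv Ω T f (t, x)).comp (ContinuousLinearMap.inr ℝ ℝ (Space d))) x := by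
  have h1 : HasFDerivWithinAt (fun y : Space d => (t, y)) (ContinuousLinearMap.inr ℝ ℝ (Space d))
      Ω.carrier x := (hasFDerivAt_prodMk_right t x).hasFDerivWithinAt
  exact ((hf.hasFDerivWithinAt (z := (t, x)) ⟨ht, hx⟩).comp x h1
    fun y hy => ⟨ht, hy⟩).hasFDerivAt (Ω.isOpen.mem_nhds hx)

theorem timeDeriv_eq (hf : SmoothTimeField Ω T f) (hT : 0 < T) {t : ℝ} (ht : t ∈ Icc 0 T)
    {x : Space d} (hx : x ∈ Ω.carrier) : timeDeriv T f t x = cylDeriv Ω T f (t, x) (1, 0) :=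
  (hf.hasDerivWithinAt_cylDeriv ht hx).derivWithin (uniqueDiffOn_Icc hT t ht)

theorem hasDerivWithinAt (hf : SmoothTimeField Ω T f) (hT : 0 < T) {t : ℝ} (ht : t ∈ Icc 0 T)
    {x : Space d} (hx : x ∈ Ω.carrier) :
    HasDerivWithinAt (fun τ => f τ x) (timeDeriv T f t x) (Icc 0 T) t := by
  rw [hf.timeDeriv_eq hT ht hx]
  exact hf.hasDerivWithinAt_cylDeriv ht hx

theorem contDiffOn_cylDeriv (hf : SmoothTimeField Ω T f) (hT : 0 < T) :
    ContDiffOn ℝ ∞ (cylDeriv Ω T f) (Icc 0 T ×ˢ Ω.carrier) :=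
  hf.contDiffOn.fderivWithin (uniqueDiffOn_cylinder Ω hT) (by simp)

theorem timeDeriv (hf : SmoothTimeField Ω T f) (hT : 0 < T) :
    SmoothTimeField Ω T (timeDeriv T f) := by
  have heq : EqOn (fun z : ℝ × Space d => LowMach.timeDeriv T f z.1 z.2)
      (fun z => cylDeriv Ω T f z (1, 0)) (Icc 0 T ×ˢ Ω.carrier) := fun z hz =>
    hf.timeDeriv_eq hT hz.1 hz.2
  have hc := hf.contDiffOn_cylDeriv hT
  refine ⟨(hc.clm_apply contDiffOn_const).congr heq, fun n => ?_, fun t ht v hv x hx => ?_⟩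
  · obtain ⟨C, hC⟩ := hf.bounded (n + 1)
    let L := ContinuousLinearMap.apply ℝ F ((1 : ℝ), (0 : Space d))
    refine ⟨‖L‖ * C, fun z hz => ?_⟩
    rw [iteratedFDerivWithin_congr heq hz]
    refine (L.norm_iteratedFDerivWithin_comp_left (hc z hz) (uniqueDiffOn_cylinder Ω hT) hz
      (by exact_mod_cast le_top)).trans (mul_le_mul_of_nonneg_left ?_ (norm_nonneg _))
    have := norm_iteratedFDerivWithin_fderivWithin (𝕜 := ℝ) (n := n)
      (f := fun z : ℝ × Space d => f z.1 z.2) (uniqueDiffOn_cylinder Ω hT) hz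
    exact this.trans_le (hC z hz)
  · refine derivWithin_congr (fun τ hτ => hf.periodic τ hτ v hv x hx) (hf.periodic t ht v hv x hx)

theorem const_smul (c : ℝ) (hf : SmoothTimeField Ω T f) (hT : 0 < T) :
    SmoothTimeField Ω T (fun t x => c • f t x) := by
  refine ⟨hf.contDiffOn.const_smul c, fun n => ?_, fun t ht v hv x hx => ?_⟩
  · obtain ⟨C, hC⟩ := hf.bounded n
    refine ⟨‖(c • ContinuousLinearMap.id ℝ F)‖ * C, fun z hz => ?_⟩
    exact ((c • ContinuousLinearMap.id ℝ F).norm_iteratedFDerivWithin_comp_left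
      (hf.contDiffOn z hz) (uniqueDiffOn_cylinder Ω hT) hz
      (by exact_mod_cast le_top)).trans (mul_le_mul_of_nonneg_left (hC z hz) (norm_nonneg _))
  · rw [hf.periodic t ht v hv x hx]

/-- Differentiation in time and in space commute. -/
theorem hasDerivWithinAt_fderiv (hf : SmoothTimeField Ω T f) (hT : 0 < T) {t : ℝ}
    (ht : t ∈ Icc 0 T) {x : Space d} (hx : x ∈ Ω.carrier) :
    HasDerivWithinAt (fun τ => fderiv ℝ (f τ) x) (fderiv ℝ (LowMach.timeDeriv T f t) x)
      (Icc 0 T) t := by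
  have hz : (t, x) ∈ Icc 0 T ×ˢ Ω.carrier := ⟨ht, hx⟩
  have hu := uniqueDiffOn_cylinder Ω hT
  -- At `t = 0` and `t = T` the point is on the boundary of the cylinder; symmetry of the second
  -- derivative there needs approximation from the interior.
  have hcl : (t, x) ∈ closure (interior (Icc 0 T ×ˢ Ω.carrier)) := by
    rw [interior_prod_eq, closure_prod_eq, interior_Icc, closure_Ioo hT.ne, Ω.isOpen.interior_eq]
    exact ⟨ht, subset_closure hx⟩
  have hsymm : IsSymmSndFDerivWithinAt ℝ (fun z : ℝ × Space d => f z.1 z.2)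
      (Icc 0 T ×ˢ Ω.carrier) (t, x) :=
    (hf.contDiffOn _ hz).isSymmSndFDerivWithinAt
      (by
          simp only [minSmoothness_of_isRCLikeNormedField]
          exact WithTop.coe_le_coe.mpr (le_top : (2 : ℕ∞) ≤ ⊤)) hu hcl hz
  have hD : HasFDerivWithinAt (cylDeriv Ω T f)
      (fderivWithin ℝ (cylDeriv Ω T f) (Icc 0 T ×ˢ Ω.carrier) (t, x)) (Icc 0 T ×ˢ Ω.carrier) (t, x) :=
    ((hf.contDiffOn_cylDeriv hT).differentiableOn (by simp) _ hz).hasFDerivWithinAt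
  set D2 := fderivWithin ℝ (cylDeriv Ω T f) (Icc 0 T ×ˢ Ω.carrier) (t, x) with hD2
  -- the derivative in time of the spatial derivative
  have h1 : HasDerivWithinAt (fun τ : ℝ => (τ, x)) (1, 0) (Icc 0 T) t :=
    (hasDerivWithinAt_id t _).prodMk (hasDerivWithinAt_const t _ x)
  have h2 := hD.comp_hasDerivWithinAt t h1
    (show MapsTo (fun τ => (τ, x)) (Icc 0 T) (Icc 0 T ×ˢ Ω.carrier) from fun τ hτ => ⟨hτ, hx⟩)
  have h3 : HasDerivWithinAt (fun τ => fderiv ℝ (f τ) x)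
      ((D2 (1, 0)).comp (ContinuousLinearMap.inr ℝ ℝ (Space d))) (Icc 0 T) t := by
    have h4 := (((ContinuousLinearMap.compL ℝ (Space d) (ℝ × Space d) F).flip
      (ContinuousLinearMap.inr ℝ ℝ (Space d))).hasFDerivAt (x := cylDeriv Ω T f (t, x))
      ).comp_hasDerivWithinAt t h2
    exact h4.congr (fun τ hτ => (hf.hasFDerivAt_cylDeriv hτ hx).fderiv)
      (hf.hasFDerivAt_cylDeriv ht hx).fderiv
  convert h3 using 1
  -- the spatial derivative of the derivative in time
  have h5 : HasFDerivWithinAt (fun y : Space d => (t, y)) (ContinuousLinearMap.inr ℝ ℝ (Space d))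
      Ω.carrier x := (hasFDerivAt_prodMk_right t x).hasFDerivWithinAt
  have h6 := (hD.comp x h5 fun y hy => ⟨ht, hy⟩).hasFDerivAt (Ω.isOpen.mem_nhds hx)
  have h7 := (ContinuousLinearMap.apply ℝ F ((1 : ℝ), (0 : Space d))).hasFDerivAt.comp x h6
  rw [fderiv_congr_on (Ω := Ω) (fun y hy => hf.timeDeriv_eq hT ht hy) hx]
  refine h7.fderiv.trans ?_
  ext v
  exact hsymm (0, v) (1, 0)

/-- The time slices of a time-dependent field are fields. -/
theorem slice (hf : SmoothTimeField Ω T f) (hT : 0 < T) {t : ℝ} (ht : t ∈ Icc 0 T) :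
    SmoothField Ω (f t) := by
  have hι : ContDiff ℝ ∞ (fun y : Space d => (t, y)) := contDiff_const.prodMk contDiff_id
  refine ⟨hf.contDiffOn.comp hι.contDiffOn fun y hy => ⟨ht, hy⟩, fun n => ?_, hf.periodic t ht⟩
  choose C hC using hf.bounded
  -- Bound for a composition: the inclusion `y ↦ (t, y)` has first derivative of norm at most `1`
  -- and no higher ones, whence the base `1`.
  refine ⟨n.factorial * (∑ i ∈ Finset.range (n + 1), |C i|) * 1 ^ n, fun x hx => ?_⟩
  rw [iteratedFDeriv_eq_within Ω n _ hx]
  refine norm_iteratedFDerivWithin_comp_le (g := fun z : ℝ × Space d => f z.1 z.2)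
    (f := fun y : Space d => (t, y)) hf.contDiffOn hι.contDiffOn (by exact_mod_cast le_top)
    (uniqueDiffOn_cylinder Ω hT) Ω.isOpen.uniqueDiffOn (fun y hy => ⟨ht, hy⟩) hx ?_ ?_
  · intro i hi
    exact (hC i _ ⟨ht, hx⟩).trans ((le_abs_self _).trans
      (Finset.single_le_sum (f := fun i => |C i|) (fun _ _ => abs_nonneg _)
        (Finset.mem_range.mpr (Nat.lt_succ_of_le hi))))
  · intro i h1 _
    obtain ⟨i, rfl⟩ := Nat.exists_eq_succ_of_ne_zero (by omega : i ≠ 0)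
    rw [← iteratedFDeriv_eq_within Ω _ _ hx, Nat.succ_eq_add_one, ← norm_iteratedFDeriv_fderiv]
    have : fderiv ℝ (fun y : Space d => (t, y))
        = fun _ => ContinuousLinearMap.inr ℝ ℝ (Space d) := by
      funext y
      exact (hasFDerivAt_prodMk_right t y).fderiv
    rw [this, one_pow]
    rcases Nat.eq_zero_or_pos i with rfl | hi
    · rw [norm_iteratedFDeriv_zero]
      exact ContinuousLinearMap.opNorm_le_bound _ zero_le_one fun v => by simp
    · simp [iteratedFDeriv_const_of_ne hi.ne']

theorem norm_bounded (hf : SmoothTimeField Ω T f) :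
    ∃ C : ℝ, ∀ t ∈ Icc 0 T, ∀ x ∈ Ω.carrier, ‖f t x‖ ≤ C := by
  obtain ⟨C, hC⟩ := hf.bounded 0
  exact ⟨C, fun t ht x hx => by simpa using hC (t, x) ⟨ht, hx⟩⟩

end SmoothTimeField

theorem SmoothField.const_time {ρ : Space d → F} (hρ : SmoothField Ω ρ) (hT : 0 < T) :
    SmoothTimeField Ω T (fun _ => ρ) := by
  refine ⟨hρ.contDiffOn.comp contDiff_snd.contDiffOn fun z hz => hz.2, fun n => ?_,
    fun _ _ => hρ.periodic⟩
  choose C hC using hρ.bounded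
  refine ⟨n.factorial * (∑ i ∈ Finset.range (n + 1), |C i|) * 1 ^ n, fun z hz => ?_⟩
  have hu := uniqueDiffOn_cylinder Ω hT
  refine norm_iteratedFDerivWithin_comp_le (g := ρ) (f := Prod.snd) hρ.contDiffOn
    contDiff_snd.contDiffOn (by exact_mod_cast le_top) Ω.isOpen.uniqueDiffOn hu
    (fun z hz => hz.2) hz ?_ ?_
  · intro i hi
    rw [← iteratedFDeriv_eq_within Ω _ _ hz.2]
    exact (hC i _ hz.2).trans ((le_abs_self _).trans
      (Finset.single_le_sum (f := fun i => |C i|) (fun _ _ => abs_nonneg _)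
        (Finset.mem_range.mpr (Nat.lt_succ_of_le hi))))
  · intro i h1 _
    obtain ⟨i, rfl⟩ := Nat.exists_eq_succ_of_ne_zero (by omega : i ≠ 0)
    rw [Nat.succ_eq_add_one, ← norm_iteratedFDerivWithin_fderivWithin hu hz]
    have : EqOn (fderivWithin ℝ (Prod.snd : ℝ × Space d → Space d) (Icc 0 T ×ˢ Ω.carrier))
        (fun _ => ContinuousLinearMap.snd ℝ ℝ (Space d)) (Icc 0 T ×ˢ Ω.carrier) := fun y hy =>
      fderivWithin_snd (hu y hy)
    rw [iteratedFDerivWithin_congr this hz, one_pow]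
    rcases Nat.eq_zero_or_pos i with rfl | hi
    · rw [norm_iteratedFDerivWithin_zero]
      exact ContinuousLinearMap.norm_snd_le ℝ ℝ (Space d)
    · simp [iteratedFDerivWithin_const_of_ne hi.ne']

theorem SmoothTimeField.smul {ρ : ℝ → Space d → ℝ} {f : ℝ → Space d → F}
    (hρ : SmoothTimeField Ω T ρ) (hf : SmoothTimeField Ω T f) (hT : 0 < T) :
    SmoothTimeField Ω T (fun t x => ρ t x • f t x) := by
  refine ⟨hρ.contDiffOn.smul hf.contDiffOn, fun n => ?_, fun t ht v hv x hx => ?_⟩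
  · choose C hC using hρ.bounded
    choose D hD using hf.bounded
    refine ⟨‖ContinuousLinearMap.lsmul ℝ ℝ (E := F)‖ * ∑ i ∈ Finset.range (n + 1),
      (n.choose i : ℝ) * C i * D (n - i), fun z hz => ?_⟩
    refine ((ContinuousLinearMap.lsmul ℝ ℝ (E := F)).norm_iteratedFDerivWithin_le_of_bilinear
      hρ.contDiffOn hf.contDiffOn (uniqueDiffOn_cylinder Ω hT) hz
      (by exact_mod_cast le_top)).trans (mul_le_mul_of_nonneg_left ?_ (by positivity))
    refine Finset.sum_le_sum fun i _ => ?_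
    have h1 := hC i z hz
    have h2 := hD (n - i) z hz
    have h3 : 0 ≤ C i := (norm_nonneg _).trans h1
    gcongr
  · rw [hρ.periodic t ht v hv x hx, hf.periodic t ht v hv x hx]

/-- The Taylor coefficients in time, as functions of time and space. -/
def timeCoeff (T : ℝ) (f : ℝ → Space d → F) : ℕ → ℝ → Space d → F
  | 0 => f
  | m + 1 => fun t x => ((m : ℝ) + 1)⁻¹ • timeDeriv T (timeCoeff T f m) t x

namespace SmoothTimeField

variable {f : ℝ → Space d → F}

theorem timeCoeff (hf : SmoothTimeField Ω T f) (hT : 0 < T) (m : ℕ) :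
    SmoothTimeField Ω T (timeCoeff T f m) := by
  induction m with
  | zero => exact hf
  | succ m ih => exact (ih.timeDeriv hT).const_smul _ hT

theorem hasDerivWithinAt_timeCoeff (hf : SmoothTimeField Ω T f) (hT : 0 < T) (m : ℕ) {t : ℝ}
    (ht : t ∈ Icc 0 T) {x : Space d} (hx : x ∈ Ω.carrier) :
    HasDerivWithinAt (fun τ => LowMach.timeCoeff T f m τ x)
      (((m : ℝ) + 1) • LowMach.timeCoeff T f (m + 1) t x) (Icc 0 T) t := by
  convert (hf.timeCoeff hT m).hasDerivWithinAt hT ht hx using 1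
  rw [LowMach.timeCoeff, smul_smul, mul_inv_cancel₀ (by positivity), one_smul]

theorem iteratedDerivWithin_eq (hf : SmoothTimeField Ω T f) (hT : 0 < T) (m : ℕ) {t : ℝ}
    (ht : t ∈ Icc 0 T) {x : Space d} (hx : x ∈ Ω.carrier) :
    iteratedDerivWithin m (fun τ => f τ x) (Icc 0 T) t
      = (m.factorial : ℝ) • LowMach.timeCoeff T f m t x := by
  induction m generalizing t with
  | zero => simp [LowMach.timeCoeff]
  | succ m ih =>
    rw [iteratedDerivWithin_succ, derivWithin_congr (fun τ hτ => ih hτ) (ih ht)]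
    refine (((hf.hasDerivWithinAt_timeCoeff hT m ht hx).const_smul
        (m.factorial : ℝ)).derivWithin (uniqueDiffOn_Icc hT t ht)).trans ?_
    rw [smul_smul, Nat.factorial_succ]
    push_cast
    rw [mul_comm]

/-- The Taylor remainder is uniform in `x` because the coefficient of order `n + 1` is bounded on
the whole space-time cylinder. -/
theorem taylor_bound (hf : SmoothTimeField Ω T f) (hT : 0 < T) (n : ℕ) :
    ∃ C : ℝ, ∀ t ∈ Icc 0 T, ∀ x ∈ Ω.carrier,
      ‖f t x - ∑ m ∈ Finset.range (n + 1), t ^ m • LowMach.timeCoeff T f m 0 x‖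
        ≤ C * t ^ (n + 1) := by
  obtain ⟨C, hC⟩ := (hf.timeCoeff hT (n + 1)).norm_bounded
  refine ⟨(n + 1).factorial * C / n.factorial, fun t ht x hx => ?_⟩
  have h0 : (0 : ℝ) ∈ Icc 0 T := left_mem_Icc.mpr hT.le
  have hs : ContDiffOn ℝ (n + 1) (fun τ => f τ x) (Icc 0 T) :=
    (hf.contDiffOn.comp (contDiff_id.prodMk contDiff_const).contDiffOn
      (fun τ hτ => ⟨hτ, hx⟩)).of_le (by exact_mod_cast le_top)
  have h := taylor_mean_remainder_bound (C := (n + 1).factorial * C) hT.le hs ht fun y hy => by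
    rw [hf.iteratedDerivWithin_eq hT _ hy hx, norm_smul, Real.norm_of_nonneg (by positivity)]
    exact mul_le_mul_of_nonneg_left (hC y hy x hx) (by positivity)
  rw [taylor_within_apply, sub_zero] at h
  convert h using 1
  · congr 2
    refine Finset.sum_congr rfl fun m _ => ?_
    rw [hf.iteratedDerivWithin_eq hT m h0 hx, smul_smul]
    congr 1
    have : (m.factorial : ℝ) ≠ 0 := by positivity
    field_simp
  · ring

end SmoothTimeField

/-- The time derivative of a family of solenoidal fields is solenoidal. -/
theorem Solenoidal.of_timeDeriv {w w' : ℝ → Space d → Space d} (hT : 0 < T)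
    (hw' : SmoothTimeField Ω T w')
    (hd : ∀ t ∈ Icc 0 T, ∀ x ∈ Ω.carrier,
      HasDerivWithinAt (fun τ => w τ x) (w' t x) (Icc 0 T) t)
    (hd' : ∀ t ∈ Icc 0 T, ∀ x ∈ Ω.carrier,
      HasDerivWithinAt (fun τ => fderiv ℝ (w τ) x) (fderiv ℝ (w' t) x) (Icc 0 T) t)
    (h : ∀ t ∈ Icc 0 T, Solenoidal Ω (w t)) {t : ℝ} (ht : t ∈ Icc 0 T) : Solenoidal Ω (w' t) := by
  refine ⟨hw'.slice hT ht, fun x hx => ?_, fun φ hφ => ?_⟩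
  · have h1 := (traceCLM d).hasFDerivAt.comp_hasDerivWithinAt t (hd' t ht x hx)
    have h2 : HasDerivWithinAt (fun _ : ℝ => (0 : ℝ)) (traceCLM d (fderiv ℝ (w' t) x)) (Icc 0 T) t := by
      refine h1.congr (fun τ hτ => ?_) ?_
      · simp [← div_eq_trace ((h τ hτ).field.differentiableAt hx), (h τ hτ).div_zero x hx]
      · simp [← div_eq_trace ((h t ht).field.differentiableAt hx), (h t ht).div_zero x hx]
    rw [div_eq_trace ((hw'.slice hT ht).differentiableAt hx)]
    exact (uniqueDiffOn_Icc hT t ht).eq_deriv _ h2 (hasDerivWithinAt_const t _ 0)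
  · obtain ⟨C, hC⟩ := hw'.norm_bounded
    obtain ⟨D, hD⟩ := hφ.gradient.norm_bounded
    have : IsFiniteMeasure (volume.restrict Ω.cell) :=
      ⟨by rw [Measure.restrict_apply_univ]; exact volume_cell_lt_top Ω⟩
    have : NeBot (𝓝[Icc 0 T \ {t}] t) := by
      have := uniqueDiffOn_Icc hT t ht
      rw [uniqueDiffWithinAt_iff_accPt, accPt_principal_iff_nhdsWithin] at this
      exact this
    -- Differentiation under the integral: the mean value inequality bounds the difference quotients
    -- by `C`. Each quotient is a combination of solenoidal fields, so all these integrals are zero.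
    have hlim : Tendsto (fun τ => ∫ x in Ω.cell, inner ℝ (slope (fun τ => w τ x) t τ) (gradient φ x))
        (𝓝[Icc 0 T \ {t}] t) (𝓝 (∫ x in Ω.cell, inner ℝ (w' t x) (gradient φ x))) := by
      refine tendsto_integral_filter_of_dominated_convergence (fun _ => C * D) ?_ ?_
        (integrable_const _) ?_
      · filter_upwards [self_mem_nhdsWithin] with τ hτ
        refine aestronglyMeasurable_cell ?_
        exact (((((h τ hτ.1).field.sub (h t ht).field).const_smul (τ - t)⁻¹).inner
          hφ.gradient).contDiffOn).continuousOn
      · filter_upwards [self_mem_nhdsWithin] with τ hτ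
        refine ae_restrict_of_forall_mem Ω.measurable_cell fun x hx => ?_
        have hx := Ω.cell_subset hx
        have hC0 : 0 ≤ C := (norm_nonneg _).trans (hC t ht x hx)
        have hm := (convex_Icc 0 T).norm_image_sub_le_of_norm_hasDerivWithin_le
          (fun y hy => hd y hy x hx) (fun y hy => hC y hy x hx) ht hτ.1
        have hs : ‖slope (fun τ => w τ x) t τ‖ ≤ C := by
          have hne : 0 < ‖τ - t‖ := norm_pos_iff.mpr (sub_ne_zero.mpr hτ.2)
          rw [slope_def_module, norm_smul, norm_inv, inv_mul_le_iff₀ hne, mul_comm]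
          exact hm
        exact (norm_inner_le_norm _ _).trans
          (mul_le_mul hs (hD x hx) (norm_nonneg _) hC0)
      · refine ae_restrict_of_forall_mem Ω.measurable_cell fun x hx => ?_
        have hx := Ω.cell_subset hx
        exact (hasDerivWithinAt_iff_tendsto_slope.mp (hd t ht x hx)).inner tendsto_const_nhds
    refine tendsto_nhds_unique (hlim.congr' ?_) tendsto_const_nhds
    filter_upwards [self_mem_nhdsWithin] with τ hτ
    exact (((h τ hτ.1).add ((h t ht).const_smul (-1))).const_smul (τ - t)⁻¹).congr
      (fun x _ => by simp [slope_def_module, sub_eq_add_neg]) |>.orthogonal φ hφ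

theorem SmoothTimeField.solenoidal_timeCoeff {w : ℝ → Space d → Space d} (hT : 0 < T)
    (hw : SmoothTimeField Ω T w) (h : ∀ t ∈ Icc 0 T, Solenoidal Ω (w t)) (m : ℕ) {t : ℝ}
    (ht : t ∈ Icc 0 T) : Solenoidal Ω (LowMach.timeCoeff T w m t) := by
  induction m generalizing t with
  | zero => exact h t ht
  | succ m ih =>
    exact (Solenoidal.of_timeDeriv hT ((hw.timeCoeff hT m).timeDeriv hT)
      (fun t ht x hx => (hw.timeCoeff hT m).hasDerivWithinAt hT ht hx)
      (fun t ht x hx => (hw.timeCoeff hT m).hasDerivWithinAt_fderiv hT ht hx)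
      (fun t ht => ih ht) ht).const_smul _

end

/-! ### The limit operators as linear algebra on a space of fields. -/

section

variable {d : ℕ} {Ω : Domain d} {T : ℝ}
  {F G H : Type*} [NormedAddCommGroup F] [NormedSpace ℝ F] [NormedAddCommGroup G] [NormedSpace ℝ G]
  [NormedAddCommGroup H] [NormedSpace ℝ H]

/-! ### The vector space of fields -/

/-- The fields on the domain, extended by zero. -/
def fieldSpace (Ω : Domain d) (F : Type*) [NormedAddCommGroup F] [NormedSpace ℝ F] :
    Submodule ℝ (Space d → F) where
  carrier := {f | SmoothField Ω f ∧ ∀ x ∉ Ω.carrier, f x = 0}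
  add_mem' := fun {f g} hf hg => ⟨hf.1.add hg.1, fun x hx => by simp [hf.2 x hx, hg.2 x hx]⟩
  zero_mem' := ⟨.zero, fun _ _ => rfl⟩
  smul_mem' := fun c f hf => ⟨hf.1.const_smul c, fun x hx => by simp [hf.2 x hx]⟩

/-- The element of `fieldSpace` given by a field. -/
def SmoothField.toSpace {f : Space d → F} (hf : SmoothField Ω f) : fieldSpace Ω F :=
  ⟨Ω.carrier.indicator f, hf.congr fun _ hx => indicator_of_mem hx f,
    fun _ hx => indicator_of_notMem hx f⟩

theorem SmoothField.toSpace_apply {f : Space d → F} (hf : SmoothField Ω f) {x : Space d}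
    (hx : x ∈ Ω.carrier) : (hf.toSpace : Space d → F) x = f x := indicator_of_mem hx f

/-- This is what extension by zero is for: identities on the domain become equalities in a vector
space. -/
theorem fieldSpace_ext {f g : fieldSpace Ω F}
    (h : EqOn (f : Space d → F) g Ω.carrier) : f = g := by
  refine Subtype.ext (funext fun x => ?_)
  by_cases hx : x ∈ Ω.carrier
  · exact h hx
  · rw [f.2.2 x hx, g.2.2 x hx]

theorem fieldSpace_differentiableAt (f : fieldSpace Ω F) {x : Space d} (hx : x ∈ Ω.carrier) :
    DifferentiableAt ℝ (f : Space d → F) x := f.2.1.differentiableAt hx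

/-! ### Bilinearity of the differential operators -/

theorem gradient_add_at {f g : Space d → ℝ} {x : Space d} (hf : DifferentiableAt ℝ f x)
    (hg : DifferentiableAt ℝ g x) :
    gradient (fun y => f y + g y) x = gradient f x + gradient g x := by
  rw [gradient_eq, gradient_eq, gradient_eq, fderiv_fun_add hf hg, map_add]

theorem gradient_const_mul_at {f : Space d → ℝ} {x : Space d} (c : ℝ)
    (hf : DifferentiableAt ℝ f x) : gradient (fun y => c * f y) x = c • gradient f x := by
  rw [gradient_eq, gradient_eq]
  have := fderiv_fun_const_smul hf c
  simp only [smul_eq_mul] at this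
  rw [this, map_smul]

theorem gradient_mul_at {f g : Space d → ℝ} {x : Space d} (hf : DifferentiableAt ℝ f x)
    (hg : DifferentiableAt ℝ g x) :
    gradient (fun y => f y * g y) x = f x • gradient g x + g x • gradient f x := by
  rw [gradient_eq, gradient_eq, gradient_eq, fderiv_fun_mul hf hg, map_add, map_smul, map_smul]

theorem divTensor_add_left_at {v v' w : Space d → Space d} {x : Space d}
    (hv : DifferentiableAt ℝ v x) (hv' : DifferentiableAt ℝ v' x) (hw : DifferentiableAt ℝ w x) :
    divTensor (fun y => v y + v' y) w x = divTensor v w x + divTensor v' w x := by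
  rw [divTensor_eq hv hw, divTensor_eq hv' hw, divTensor_eq (hv.fun_add hv') hw,
    fderiv_fun_add hv hv']
  simp only [add_apply, smul_add]
  abel

theorem divTensor_add_right_at {v w w' : Space d → Space d} {x : Space d}
    (hv : DifferentiableAt ℝ v x) (hw : DifferentiableAt ℝ w x) (hw' : DifferentiableAt ℝ w' x) :
    divTensor v (fun y => w y + w' y) x = divTensor v w x + divTensor v w' x := by
  rw [divTensor_eq hv hw, divTensor_eq hv hw', divTensor_eq hv (hw.fun_add hw'),
    fderiv_fun_add hw hw']
  simp only [map_add, add_smul]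
  abel

theorem divTensor_smul_left_at {v w : Space d → Space d} {x : Space d} (c : ℝ)
    (hv : DifferentiableAt ℝ v x) (hw : DifferentiableAt ℝ w x) :
    divTensor (fun y => c • v y) w x = c • divTensor v w x := by
  rw [divTensor_eq hv hw, divTensor_eq (hv.fun_const_smul c) hw, fderiv_fun_const_smul hv]
  simp only [smul_apply, smul_add]
  rw [smul_comm]

theorem divTensor_smul_right_at {v w : Space d → Space d} {x : Space d} (c : ℝ)
    (hv : DifferentiableAt ℝ v x) (hw : DifferentiableAt ℝ w x) :
    divTensor v (fun y => c • w y) x = c • divTensor v w x := by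
  rw [divTensor_eq hv hw, divTensor_eq hv (hw.fun_const_smul c), fderiv_fun_const_smul hw]
  simp only [map_smul, smul_add, smul_assoc]

theorem divTensor_congr_on {v v' w w' : Space d → Space d} (hv : EqOn v v' Ω.carrier)
    (hw : EqOn w w' Ω.carrier) {x : Space d} (hx : x ∈ Ω.carrier) :
    divTensor v w x = divTensor v' w' x := by
  unfold divTensor
  congr 1
  funext i
  exact div_congr_on (Ω := Ω) (fun y hy => by simp only [hv hy, hw hy]) hx

section Operators

variable {r a : Space d → ℝ} (hr : SmoothField Ω r) (ha : SmoothField Ω a)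

/-- Momentum advection `(q, q') ↦ - ∇·(q ⊗ r q')`, where `r` is the specific volume. -/
def advection : fieldSpace Ω (Space d) →ₗ[ℝ] fieldSpace Ω (Space d) →ₗ[ℝ] fieldSpace Ω (Space d) :=
  LinearMap.mk₂ ℝ (fun q q' => (q.2.1.divTensor (hr.smul q'.2.1)).neg.toSpace)
    (fun q₁ q₂ q' => fieldSpace_ext fun x hx => by
      simp only [Submodule.coe_add, Pi.add_apply, SmoothField.toSpace_apply _ hx]
      erw [divTensor_add_left_at (fieldSpace_differentiableAt q₁ hx)
        (fieldSpace_differentiableAt q₂ hx) ((hr.smul q'.2.1).differentiableAt hx), neg_add])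
    (fun c q q' => fieldSpace_ext fun x hx => by
      simp only [Submodule.coe_smul, Pi.smul_apply, SmoothField.toSpace_apply _ hx]
      erw [divTensor_smul_left_at c (fieldSpace_differentiableAt q hx)
        ((hr.smul q'.2.1).differentiableAt hx), smul_neg])
    (fun q q₁ q₂ => fieldSpace_ext fun x hx => by
      simp only [Submodule.coe_add, Pi.add_apply, SmoothField.toSpace_apply _ hx, smul_add]
      rw [divTensor_add_right_at (fieldSpace_differentiableAt q hx)
        ((hr.smul q₁.2.1).differentiableAt hx) ((hr.smul q₂.2.1).differentiableAt hx), neg_add])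
    (fun c q q' => fieldSpace_ext fun x hx => by
      simp only [Submodule.coe_smul, Pi.smul_apply, SmoothField.toSpace_apply _ hx, smul_comm _ c]
      rw [divTensor_smul_right_at c (fieldSpace_differentiableAt q hx)
        ((hr.smul q'.2.1).differentiableAt hx), smul_neg])

/-- Transport `(q, θ) ↦ - r q · ∇θ`. -/
def transport : fieldSpace Ω (Space d) →ₗ[ℝ] fieldSpace Ω ℝ →ₗ[ℝ] fieldSpace Ω ℝ :=
  LinearMap.mk₂ ℝ (fun q θ => ((hr.smul q.2.1).inner θ.2.1.gradient).neg.toSpace)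
    (fun q₁ q₂ θ => fieldSpace_ext fun x hx => by
      simp only [Submodule.coe_add, Pi.add_apply, SmoothField.toSpace_apply _ hx, smul_add,
        inner_add_left, neg_add])
    (fun c q θ => fieldSpace_ext fun x hx => by
      simp only [Submodule.coe_smul, Pi.smul_apply, SmoothField.toSpace_apply _ hx, smul_comm _ c,
        real_inner_smul_left, smul_eq_mul, mul_neg])
    (fun q θ₁ θ₂ => fieldSpace_ext fun x hx => by
      simp only [Submodule.coe_add, Pi.add_apply, SmoothField.toSpace_apply _ hx]
      erw [gradient_add_at (fieldSpace_differentiableAt θ₁ hx) (fieldSpace_differentiableAt θ₂ hx)]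
      rw [inner_add_right, neg_add])
    (fun c q θ => fieldSpace_ext fun x hx => by
      simp only [Submodule.coe_smul, Pi.smul_apply, SmoothField.toSpace_apply _ hx]
      erw [gradient_const_mul_at c (fieldSpace_differentiableAt θ hx)]
      rw [real_inner_smul_right, smul_eq_mul, mul_neg])

/-- The explicit part `θ ↦ - ∇(a θ)` of the pressure gradient. -/
def pressureForce : fieldSpace Ω ℝ →ₗ[ℝ] fieldSpace Ω (Space d) where
  toFun θ := (ha.mul θ.2.1).gradient.neg.toSpace
  map_add' θ₁ θ₂ := fieldSpace_ext fun x hx => by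
    simp only [Submodule.coe_add, Pi.add_apply, SmoothField.toSpace_apply _ hx, mul_add]
    rw [gradient_add_at ((ha.mul θ₁.2.1).differentiableAt hx)
      ((ha.mul θ₂.2.1).differentiableAt hx), neg_add]
  map_smul' c θ := fieldSpace_ext fun x hx => by
    simp only [Submodule.coe_smul, Pi.smul_apply, SmoothField.toSpace_apply _ hx, smul_eq_mul,
      RingHom.id_apply, mul_left_comm _ c]
    rw [gradient_const_mul_at c ((ha.mul θ.2.1).differentiableAt hx), smul_neg]

theorem advection_apply (q q' : fieldSpace Ω (Space d)) {x : Space d} (hx : x ∈ Ω.carrier) :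
    (advection hr q q' : Space d → Space d) x
      = -divTensor q (fun y => r y • (q' : Space d → Space d) y) x :=
  SmoothField.toSpace_apply (q.2.1.divTensor (hr.smul q'.2.1)).neg hx

theorem transport_apply (q : fieldSpace Ω (Space d)) (θ : fieldSpace Ω ℝ) {x : Space d}
    (hx : x ∈ Ω.carrier) : (transport hr q θ : Space d → ℝ) x
      = -inner ℝ (r x • (q : Space d → Space d) x) (gradient (θ : Space d → ℝ) x) :=
  SmoothField.toSpace_apply ((hr.smul q.2.1).inner θ.2.1.gradient).neg hx

theorem pressureForce_apply (θ : fieldSpace Ω ℝ) {x : Space d} (hx : x ∈ Ω.carrier) :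
    (pressureForce ha θ : Space d → Space d) x = -gradient (fun y => a y * (θ : Space d → ℝ) y) x :=
  SmoothField.toSpace_apply (ha.mul θ.2.1).gradient.neg hx

end Operators

/-! ### The projection onto solenoidal fields -/

/-- A single-valued linear relation extends to a map: the first projection is injective on `S`, and
any linear left inverse followed by the second projection works. -/
theorem exists_linearMap_of_graph {E E' : Type*} [AddCommGroup E] [Module ℝ E] [AddCommGroup E']
    [Module ℝ E'] (S : Submodule ℝ (E × E')) (hS : ∀ b : E', (0, b) ∈ S → b = 0) :
    ∃ P : E →ₗ[ℝ] E', ∀ a b, (a, b) ∈ S → P a = b := by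
  obtain ⟨g, hg⟩ := (LinearMap.fst ℝ E E' ∘ₗ S.subtype).exists_leftInverse_of_injective (by
    rw [LinearMap.ker_eq_bot']
    rintro ⟨⟨a, b⟩, h⟩ h0
    obtain rfl : a = 0 := h0
    simp [hS b h])
  refine ⟨LinearMap.snd ℝ E E' ∘ₗ S.subtype ∘ₗ g, fun a b hab => ?_⟩
  have h := LinearMap.congr_fun hg ⟨(a, b), hab⟩
  simp only [LinearMap.comp_apply, Submodule.subtype_apply, LinearMap.fst_apply,
    LinearMap.id_apply] at h
  simp [h]

/-- There is a linear map on all fields which agrees with the weighted projection onto solenoidal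
fields wherever the latter is a field. -/
theorem exists_projection {ρ : Space d → ℝ} {c : ℝ} (hc : 0 < c)
    (hρc : ∀ x ∈ Ω.carrier, c ≤ ρ x) :
    ∃ P : fieldSpace Ω (Space d) →ₗ[ℝ] fieldSpace Ω (Space d),
      ∀ (f v : fieldSpace Ω (Space d)) (ψ : Space d → ℝ), Solenoidal Ω v → SmoothField Ω ψ →
        (∀ x ∈ Ω.carrier, (v : Space d → Space d) x = (f : Space d → Space d) x
          - ρ x • gradient ψ x) → P f = v := by
  let S : Submodule ℝ (fieldSpace Ω (Space d) × fieldSpace Ω (Space d)) :=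
    { carrier := {p | Solenoidal Ω p.2 ∧ ∃ ψ : Space d → ℝ, SmoothField Ω ψ ∧
        ∀ x ∈ Ω.carrier, (p.2 : Space d → Space d) x = (p.1 : Space d → Space d) x
          - ρ x • gradient ψ x}
      add_mem' := by
        rintro p p' ⟨h1, ψ, h2, h3⟩ ⟨h1', ψ', h2', h3'⟩
        refine ⟨h1.add h1', _, h2.add h2', fun x hx => ?_⟩
        rw [gradient_add_at (h2.differentiableAt hx) (h2'.differentiableAt hx)]
        simp only [Prod.snd_add, Prod.fst_add, Submodule.coe_add, Pi.add_apply, h3 x hx, h3' x hx,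
          smul_add]
        abel
      zero_mem' := ⟨.zero, _, .zero, fun x _ => by
        rw [gradient_eq]
        simp⟩
      smul_mem' := by
        rintro a p ⟨h1, ψ, h2, h3⟩
        refine ⟨h1.const_smul a, _, h2.const_smul a, fun x hx => ?_⟩
        simp only [smul_eq_mul]
        rw [gradient_const_mul_at a (h2.differentiableAt hx)]
        simp only [Prod.smul_snd, Prod.smul_fst, Submodule.coe_smul, Pi.smul_apply, h3 x hx,
          smul_sub, smul_comm a] }
  -- Single-valuedness: over `f = 0` the solenoidal value is the weighted gradient of `-ψ`, hence
  -- zero.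
  obtain ⟨P, hP⟩ := exists_linearMap_of_graph S (by
    rintro v ⟨h1, ψ, h2, h3⟩
    refine fieldSpace_ext ?_
    refine h1.eqOn_zero hc hρc h2.neg fun x hx => ?_
    have h4 := h3 x hx
    have h5 : gradient (fun y => -ψ y) x = -gradient ψ x := by
      simpa using gradient_const_mul_at (-1) (h2.differentiableAt hx)
    rw [h5, smul_neg]
    simpa using h4)
  exact ⟨P, fun f v ψ h1 h2 h3 => hP f v ⟨h1, ψ, h2, h3⟩⟩

end

/-! ### Hydrostatic balance and the recursion for the exact solution. -/

section

variable {d : ℕ} {Ω : Domain d} {T : ℝ}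
  {F G H : Type*} [NormedAddCommGroup F] [NormedSpace ℝ F] [NormedAddCommGroup G] [NormedSpace ℝ G]
  [NormedAddCommGroup H] [NormedSpace ℝ H]

/-! ### The hydrostatic background -/

namespace Background

variable (B : Background d)

/-- Specific volume of the background. -/
def specVol (x : Space d) : ℝ := (B.ρ₀ x)⁻¹

/-- The coefficient of `θ₂` in `p₂`. -/
def thermoCoeff (x : Space d) : ℝ := B.γ * B.p₀ x / (B.ρ₀ x * B.θ₀ x) * B.ρ₀ x

/-- The coefficient of `ρ₂` in the potential which remains after the hydrostatic balance. -/
def buoyCoeff (x : Space d) : ℝ := B.γ * B.p₀ x * ((B.ρ₀ x)⁻¹ * (B.ρ₀ x)⁻¹)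

namespace IsHydrostatic

variable {B} (hB : B.IsHydrostatic Ω)
include hB

theorem rho_pos {x : Space d} (hx : x ∈ Ω.carrier) : 0 < B.ρ₀ x := by
  obtain ⟨c, hc, h⟩ := hB.density_pos
  exact hc.trans_le (h x hx)

theorem theta_pos {x : Space d} (hx : x ∈ Ω.carrier) : 0 < B.θ₀ x := by
  obtain ⟨c, hc, h⟩ := hB.theta_const
  rwa [h x hx]

theorem field_specVol : SmoothField Ω B.specVol := by
  obtain ⟨c, hc, h⟩ := hB.density_pos
  exact hB.field_ρ₀.inv hc h

theorem field_theta : SmoothField Ω B.θ₀ := by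
  obtain ⟨c, -, h⟩ := hB.theta_const
  exact (SmoothField.const c).congr h

theorem gradient_theta {x : Space d} (hx : x ∈ Ω.carrier) : gradient B.θ₀ x = 0 := by
  obtain ⟨c, -, h⟩ := hB.theta_const
  rw [gradient_congr_on (g := fun _ => c) h hx, gradient_eq]
  simp

theorem field_pressureCoeff :
    SmoothField Ω (fun x => B.γ * B.p₀ x / (B.ρ₀ x * B.θ₀ x)) := by
  obtain ⟨c, hc, h⟩ := hB.density_pos
  obtain ⟨t, ht, h'⟩ := hB.theta_const
  have hi := (hB.field_ρ₀.mul hB.field_theta).inv (c := c * t) (by positivity) fun x hx => by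
    rw [h' x hx]
    exact mul_le_mul_of_nonneg_right (h x hx) ht.le
  exact ((SmoothField.const B.γ).mul hB.field_p₀).mul hi

theorem field_thermoCoeff : SmoothField Ω B.thermoCoeff :=
  hB.field_pressureCoeff.mul hB.field_ρ₀

theorem field_buoyCoeff : SmoothField Ω B.buoyCoeff :=
  ((SmoothField.const B.γ).mul hB.field_p₀).mul (hB.field_specVol.mul hB.field_specVol)

/-- Chain rule for `(ρ₀ θ₀) ^ γ`; constancy of `θ₀` leaves only `∇ρ₀`. -/
theorem gradient_pressure {x : Space d} (hx : x ∈ Ω.carrier) :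
    gradient B.p₀ x = (B.γ * B.p₀ x * (B.ρ₀ x)⁻¹) • gradient B.ρ₀ x := by
  obtain ⟨t, ht, h'⟩ := hB.theta_const
  have hρ := hB.rho_pos hx
  have heq : EqOn B.p₀ (fun y => (B.ρ₀ y * t) ^ B.γ) Ω.carrier := fun y hy => by
    rw [hB.eos y hy, h' y hy]
  have hd := (((hB.field_ρ₀.differentiableAt hx).hasFDerivAt).mul_const t).rpow_const (p := B.γ)
    (Or.inl (by positivity))
  rw [gradient_congr_on heq hx, gradient_eq, gradient_eq, hd.fderiv, map_smul, map_smul, smul_smul,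
    heq hx]
  congr 1
  have hpos : 0 < B.ρ₀ x * t := by positivity
  simp only
  rw [Real.rpow_sub_one hpos.ne']
  field_simp

/-- Dividing the balance by `ρ₀` writes gravity through `∇ρ₀` with the very coefficient `γ p₀ / ρ₀²`
that makes it cancel against part of the pressure gradient. -/
theorem gradient_potential {x : Space d} (hx : x ∈ Ω.carrier) :
    gradient B.Φ x = -(B.buoyCoeff x • gradient B.ρ₀ x) := by
  have hρ := (hB.rho_pos hx).ne'
  have h := hB.balance x hx
  rw [hB.gradient_pressure hx] at h
  have h2 : B.ρ₀ x • gradient B.Φ x = -((B.γ * B.p₀ x * (B.ρ₀ x)⁻¹) • gradient B.ρ₀ x) := by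
    rw [h, neg_neg]
  have h3 := congrArg (fun v => (B.ρ₀ x)⁻¹ • v) h2
  simp only [smul_smul, inv_mul_cancel₀ hρ, one_smul, smul_neg] at h3
  rw [h3, buoyCoeff]
  congr 2
  ring

/-- With the linearised equation of state, the sum of pressure gradient and gravity is the
gradient of the thermal part and a weighted gradient. -/
theorem gradient_add_gravity {θ σ : Space d → ℝ} (hθ : SmoothField Ω θ) (hσ : SmoothField Ω σ)
    {x : Space d} (hx : x ∈ Ω.carrier) :
    gradient (fun y => B.γ * B.p₀ y / (B.ρ₀ y * B.θ₀ y) * (B.ρ₀ y * θ y + B.θ₀ y * σ y)) x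
        + σ x • gradient B.Φ x
      = gradient (fun y => B.thermoCoeff y * θ y) x
        + B.ρ₀ x • gradient (fun y => B.buoyCoeff y * σ y) x := by
  have heq : EqOn
      (fun y => B.γ * B.p₀ y / (B.ρ₀ y * B.θ₀ y) * (B.ρ₀ y * θ y + B.θ₀ y * σ y))
      (fun y => B.thermoCoeff y * θ y + B.ρ₀ y * (B.buoyCoeff y * σ y)) Ω.carrier := by
    intro y hy
    have h1 := (hB.rho_pos hy).ne'
    have h2 := (hB.theta_pos hy).ne'
    simp only [thermoCoeff, buoyCoeff]
    field_simp
  have h1 := (hB.field_thermoCoeff.mul hθ).differentiableAt hx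
  have h2 := (hB.field_buoyCoeff.mul hσ).differentiableAt hx
  have h3 := (hB.field_ρ₀.mul (hB.field_buoyCoeff.mul hσ)).differentiableAt hx
  -- In `∇(ρ₀ g σ)`, with `g` the buoyancy coefficient, the term `g σ ∇ρ₀` cancels `σ ∇Φ`.
  rw [gradient_congr_on heq hx, gradient_add_at h1 h3,
    gradient_mul_at (hB.field_ρ₀.differentiableAt hx) h2, hB.gradient_potential hx, smul_neg,
    smul_smul, mul_comm (σ x)]
  abel

end IsHydrostatic

end Background

/-! ### Taylor coefficients of the exact solution -/

/-- On the antidiagonal `m + 1` is the sum of the two indices; distribute it and shift one index in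
each part. This is the product rule for normalised Taylor coefficients. -/
theorem sum_antidiagonal_leibniz {E : Type*} [AddCommGroup E] [Module ℝ E] (g : ℕ → ℕ → E) (m : ℕ) :
    ∑ p ∈ Finset.HasAntidiagonal.antidiagonal m,
        (((p.1 : ℝ) + 1) • g (p.1 + 1) p.2 + ((p.2 : ℝ) + 1) • g p.1 (p.2 + 1))
      = ((m : ℝ) + 1) • ∑ p ∈ Finset.HasAntidiagonal.antidiagonal (m + 1), g p.1 p.2 := by
  have h1 : ((m : ℝ) + 1) • ∑ p ∈ Finset.HasAntidiagonal.antidiagonal (m + 1), g p.1 p.2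
      = ∑ p ∈ Finset.HasAntidiagonal.antidiagonal (m + 1), (p.1 : ℝ) • g p.1 p.2
        + ∑ p ∈ Finset.HasAntidiagonal.antidiagonal (m + 1), (p.2 : ℝ) • g p.1 p.2 := by
    rw [Finset.smul_sum, ← Finset.sum_add_distrib]
    refine Finset.sum_congr rfl fun p hp => ?_
    rw [← add_smul]
    congr 1
    exact_mod_cast (Finset.HasAntidiagonal.mem_antidiagonal.mp hp).symm
  rw [h1, Finset.Nat.sum_antidiagonal_succ, Finset.Nat.sum_antidiagonal_succ',
    Finset.sum_add_distrib]
  simp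

namespace SmoothTimeField

variable {f f' : ℝ → Space d → ℝ} {v v' w w' : ℝ → Space d → Space d}

theorem hasDerivWithinAt_fderiv_of {f f' : ℝ → Space d → F} (hf : SmoothTimeField Ω T f)
    (hT : 0 < T)
    (hd : ∀ t ∈ Icc 0 T, ∀ x ∈ Ω.carrier, HasDerivWithinAt (fun τ => f τ x) (f' t x) (Icc 0 T) t)
    {t : ℝ} (ht : t ∈ Icc 0 T) {x : Space d} (hx : x ∈ Ω.carrier) :
    DifferentiableAt ℝ (f' t) x ∧
    HasDerivWithinAt (fun τ => fderiv ℝ (f τ) x) (fderiv ℝ (f' t) x) (Icc 0 T) t := by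
  have heq : EqOn (f' t) (LowMach.timeDeriv T f t) Ω.carrier := fun y hy =>
    (uniqueDiffOn_Icc hT t ht).eq_deriv _ (hd t ht y hy) (hf.hasDerivWithinAt hT ht hy)
  refine ⟨(((hf.timeDeriv hT).slice hT ht).congr heq).differentiableAt hx, ?_⟩
  rw [fderiv_congr_on heq hx]
  exact hf.hasDerivWithinAt_fderiv hT ht hx

theorem hasDerivWithinAt_gradient (hf : SmoothTimeField Ω T f) (hT : 0 < T)
    (hd : ∀ t ∈ Icc 0 T, ∀ x ∈ Ω.carrier, HasDerivWithinAt (fun τ => f τ x) (f' t x) (Icc 0 T) t)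
    {t : ℝ} (ht : t ∈ Icc 0 T) {x : Space d} (hx : x ∈ Ω.carrier) :
    HasDerivWithinAt (fun τ => gradient (f τ) x) (gradient (f' t) x) (Icc 0 T) t := by
  simp only [gradient_eq]
  exact (gradCLM d).hasFDerivAt.comp_hasDerivWithinAt t
    (hf.hasDerivWithinAt_fderiv_of hT hd ht hx).2

theorem hasDerivWithinAt_divTensor (hv : SmoothTimeField Ω T v) (hw : SmoothTimeField Ω T w)
    (hT : 0 < T)
    (hvd : ∀ t ∈ Icc 0 T, ∀ x ∈ Ω.carrier, HasDerivWithinAt (fun τ => v τ x) (v' t x) (Icc 0 T) t)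
    (hwd : ∀ t ∈ Icc 0 T, ∀ x ∈ Ω.carrier, HasDerivWithinAt (fun τ => w τ x) (w' t x) (Icc 0 T) t)
    {t : ℝ} (ht : t ∈ Icc 0 T) {x : Space d} (hx : x ∈ Ω.carrier) :
    HasDerivWithinAt (fun τ => divTensor (v τ) (w τ) x)
      (divTensor (v' t) (w t) x + divTensor (v t) (w' t) x) (Icc 0 T) t := by
  obtain ⟨hv1, hv2⟩ := hv.hasDerivWithinAt_fderiv_of hT hvd ht hx
  obtain ⟨hw1, hw2⟩ := hw.hasDerivWithinAt_fderiv_of hT hwd ht hx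
  have hvs := fun τ (hτ : τ ∈ Icc 0 T) => (hv.slice hT hτ).differentiableAt hx
  have hws := fun τ (hτ : τ ∈ Icc 0 T) => (hw.slice hT hτ).differentiableAt hx
  rw [divTensor_eq hv1 (hws t ht), divTensor_eq (hvs t ht) hw1]
  have h := (hv2.clm_apply (hwd t ht x hx)).add
    (((traceCLM d).hasFDerivAt.comp_hasDerivWithinAt t hw2).smul (hvd t ht x hx))
  refine (h.congr_deriv ?_).congr (fun τ hτ => divTensor_eq (hvs τ hτ) (hws τ hτ))
    (divTensor_eq (hvs t ht) (hws t ht))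
  simp only [Function.comp_apply]
  abel

end SmoothTimeField

section Exact

variable {B : Background d} (hB : B.IsHydrostatic Ω) (hT : 0 < T)
  {u₀ : ℝ → Space d → Space d} {ρ₂ p₂ θ₂ : ℝ → Space d → ℝ}
  (hsol : IsLimitSolution Ω B T u₀ ρ₂ p₂ θ₂)

/-- Taylor coefficients of the momentum. -/
def momCoeff (B : Background d) (T : ℝ) (u₀ : ℝ → Space d → Space d) :
    ℕ → ℝ → Space d → Space d :=
  timeCoeff T fun t y => B.ρ₀ y • u₀ t y

theorem Background.IsHydrostatic.vel_eq {B : Background d} (hB : B.IsHydrostatic Ω)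
    {u₀ : ℝ → Space d → Space d} {t : ℝ} :
    EqOn (u₀ t) (fun y => B.specVol y • momCoeff B T u₀ 0 t y) Ω.carrier := by
  intro y hy
  simp only [Background.specVol, momCoeff, timeCoeff, smul_smul,
    inv_mul_cancel₀ (hB.rho_pos hy).ne', one_smul]

include hB hT hsol

theorem IsLimitSolution.field_mom : SmoothTimeField Ω T (fun t y => B.ρ₀ y • u₀ t y) :=
  (hB.field_ρ₀.const_time hT).smul hsol.field_u₀ hT

theorem IsLimitSolution.solenoidal_momCoeff (m : ℕ) {t : ℝ} (ht : t ∈ Icc 0 T) :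
    Solenoidal Ω (momCoeff B T u₀ m t) :=
  SmoothTimeField.solenoidal_timeCoeff hT (hsol.field_mom hB hT) (fun t ht =>
    (hsol.noFlux t ht).solenoidal ((hsol.field_mom hB hT).slice hT ht) (hsol.div_zero t ht)) m ht

/-- Order zero is the momentum equation with `p₂` eliminated by the closure; differentiating the
identity in time raises the order. It is therefore proved at every `t`, although only `t = 0` is
used in the end. -/
theorem IsLimitSolution.momCoeff_succ (m : ℕ) {t : ℝ} (ht : t ∈ Icc 0 T) {x : Space d}
    (hx : x ∈ Ω.carrier) :
    ((m : ℝ) + 1) • momCoeff B T u₀ (m + 1) t x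
      = -(∑ p ∈ Finset.HasAntidiagonal.antidiagonal m, divTensor (momCoeff B T u₀ p.1 t)
          (fun y => B.specVol y • momCoeff B T u₀ p.2 t y) x)
        - gradient (fun y => B.thermoCoeff y * timeCoeff T θ₂ m t y) x
        - B.ρ₀ x • gradient (fun y => B.buoyCoeff y * timeCoeff T ρ₂ m t y) x := by
  have hw := hsol.field_mom hB hT
  have hW : ∀ m, SmoothTimeField Ω T (momCoeff B T u₀ m) := fun m => hw.timeCoeff hT m
  have hrW : ∀ m, SmoothTimeField Ω T (fun t y => B.specVol y • momCoeff B T u₀ m t y) := fun m =>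
    (hB.field_specVol.const_time hT).smul (hW m) hT
  have haΘ : ∀ m, SmoothTimeField Ω T (fun t y => B.thermoCoeff y * timeCoeff T θ₂ m t y) := fun m =>
    (hB.field_thermoCoeff.const_time hT).smul (hsol.field_θ₂.timeCoeff hT m) hT
  have hgR : ∀ m, SmoothTimeField Ω T (fun t y => B.buoyCoeff y * timeCoeff T ρ₂ m t y) := fun m =>
    (hB.field_buoyCoeff.const_time hT).smul (hsol.field_ρ₂.timeCoeff hT m) hT
  have hu := uniqueDiffOn_Icc hT
  induction m generalizing t with
  | zero =>
    have h1 : ((0 : ℕ) : ℝ) + 1 = 1 := by norm_num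
    have h2 : momCoeff B T u₀ (0 + 1) t x
        = derivWithin (fun τ => B.ρ₀ x • u₀ τ x) (Icc 0 T) t := by
      simp [momCoeff, timeCoeff, timeDeriv]
    have hm := hsol.momentum t ht x hx
    have hcl : EqOn (p₂ t) (fun y => B.γ * B.p₀ y / (B.ρ₀ y * B.θ₀ y)
        * (B.ρ₀ y * θ₂ t y + B.θ₀ y * ρ₂ t y)) Ω.carrier := fun y hy => hsol.closure t ht y hy
    have hg := hB.gradient_add_gravity (hsol.field_θ₂.slice hT ht) (hsol.field_ρ₂.slice hT ht) hx
    rw [← gradient_congr_on hcl hx] at hg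
    rw [divTensor_congr_on (fun _ _ => rfl) (hB.vel_eq (T := T)) hx] at hm
    rw [h1, one_smul, h2]
    simp only [Finset.Nat.antidiagonal_zero, Finset.sum_singleton]
    have h3 : divTensor (momCoeff B T u₀ 0 t) (fun y => B.specVol y • momCoeff B T u₀ 0 t y) x
        = divTensor (fun y => B.ρ₀ y • u₀ t y) (fun y => B.specVol y • momCoeff B T u₀ 0 t y) x := rfl
    have h4 : timeCoeff T θ₂ 0 t = θ₂ t := rfl
    have h5 : timeCoeff T ρ₂ 0 t = ρ₂ t := rfl
    rw [h3, h4, h5, sub_sub, ← hg, ← sub_eq_zero]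
    rw [← sub_eq_zero] at hm
    rw [← hm]
    abel
  | succ m ih =>
    have hWd : ∀ m, ∀ t ∈ Icc 0 T, ∀ x ∈ Ω.carrier,
        HasDerivWithinAt (fun τ => momCoeff B T u₀ m τ x)
          (((m : ℝ) + 1) • momCoeff B T u₀ (m + 1) t x) (Icc 0 T) t := fun m t ht x hx =>
      hw.hasDerivWithinAt_timeCoeff hT m ht hx
    have hrWd : ∀ m, ∀ t ∈ Icc 0 T, ∀ x ∈ Ω.carrier,
        HasDerivWithinAt (fun τ => B.specVol x • momCoeff B T u₀ m τ x)
          (((m : ℝ) + 1) • (B.specVol x • momCoeff B T u₀ (m + 1) t x)) (Icc 0 T) t := by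
      intro m t ht x hx
      rw [smul_comm]
      exact (hWd m t ht x hx).fun_const_smul _
    have haΘd : ∀ m, ∀ t ∈ Icc 0 T, ∀ x ∈ Ω.carrier,
        HasDerivWithinAt (fun τ => B.thermoCoeff x * timeCoeff T θ₂ m τ x)
          (((m : ℝ) + 1) * (B.thermoCoeff x * timeCoeff T θ₂ (m + 1) t x)) (Icc 0 T) t := by
      intro m t ht x hx
      rw [mul_left_comm]
      exact (hsol.field_θ₂.hasDerivWithinAt_timeCoeff hT m ht hx).const_mul _
    have hgRd : ∀ m, ∀ t ∈ Icc 0 T, ∀ x ∈ Ω.carrier,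
        HasDerivWithinAt (fun τ => B.buoyCoeff x * timeCoeff T ρ₂ m τ x)
          (((m : ℝ) + 1) * (B.buoyCoeff x * timeCoeff T ρ₂ (m + 1) t x)) (Icc 0 T) t := by
      intro m t ht x hx
      rw [mul_left_comm]
      exact (hsol.field_ρ₂.hasDerivWithinAt_timeCoeff hT m ht hx).const_mul _
    have hL := (hWd (m + 1) t ht x hx).const_smul ((m : ℝ) + 1)
    have hR1 := HasDerivWithinAt.fun_sum (u := Finset.HasAntidiagonal.antidiagonal m) fun p _ =>
      (hW p.1).hasDerivWithinAt_divTensor (hrW p.2) hT (hWd p.1) (hrWd p.2) ht hx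
    have hR2 := (haΘ m).hasDerivWithinAt_gradient hT (haΘd m) ht hx
    have hR3 := ((hgR m).hasDerivWithinAt_gradient hT (hgRd m) ht hx).const_smul (B.ρ₀ x)
    have hR := ((hR1.neg.sub hR2).sub hR3).congr (fun τ hτ => ih hτ) (ih ht)
    have heq := (hu t ht).eq_deriv _ hL hR
    have hW1 := fun m => ((hW m).slice hT ht).differentiableAt hx
    have hrW1 := fun m => ((hrW m).slice hT ht).differentiableAt hx
    simp only [divTensor_smul_left_at _ (hW1 _) (hrW1 _), divTensor_smul_right_at _ (hW1 _) (hrW1 _),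
      gradient_const_mul_at _ (((haΘ (m + 1)).slice hT ht).differentiableAt hx),
      gradient_const_mul_at _ (((hgR (m + 1)).slice hT ht).differentiableAt hx)] at heq
    -- Every term of the differentiated identity carries the factor `m + 1`, which cancels.
    rw [sum_antidiagonal_leibniz (fun i j => divTensor (momCoeff B T u₀ i t)
      (fun y => B.specVol y • momCoeff B T u₀ j t y) x), smul_comm (B.ρ₀ x), ← smul_neg, ← smul_sub,
      ← smul_sub] at heq
    exact smul_right_injective _ (by positivity : ((m : ℝ) + 1) ≠ 0) heq

theorem IsLimitSolution.thetaCoeff_succ (m : ℕ) {t : ℝ} (ht : t ∈ Icc 0 T) {x : Space d}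
    (hx : x ∈ Ω.carrier) :
    ((m : ℝ) + 1) • timeCoeff T θ₂ (m + 1) t x
      = -(∑ p ∈ Finset.HasAntidiagonal.antidiagonal m,
        inner ℝ (B.specVol x • momCoeff B T u₀ p.1 t x) (gradient (timeCoeff T θ₂ p.2 t) x)) := by
  have hw := hsol.field_mom hB hT
  have hΘ : ∀ m, SmoothTimeField Ω T (timeCoeff T θ₂ m) := fun m => hsol.field_θ₂.timeCoeff hT m
  have hu := uniqueDiffOn_Icc hT
  induction m generalizing t with
  | zero =>
    have h1 : ((0 : ℕ) : ℝ) + 1 = 1 := by norm_num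
    have h2 : timeCoeff T θ₂ (0 + 1) t x = derivWithin (fun τ => θ₂ τ x) (Icc 0 T) t := by
      simp [timeCoeff, timeDeriv]
    have hm := hsol.transport t ht x hx
    rw [hB.vel_eq (u₀ := u₀) (T := T) hx] at hm
    rw [h1, one_smul, h2]
    simp only [Finset.Nat.antidiagonal_zero, Finset.sum_singleton]
    exact eq_neg_of_add_eq_zero_left hm
  | succ m ih =>
    have hWd : ∀ m, HasDerivWithinAt (fun τ => B.specVol x • momCoeff B T u₀ m τ x)
          (B.specVol x • (((m : ℝ) + 1) • momCoeff B T u₀ (m + 1) t x)) (Icc 0 T) t := fun m =>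
      (hw.hasDerivWithinAt_timeCoeff hT m ht hx).fun_const_smul _
    have hΘd : ∀ m, ∀ t ∈ Icc 0 T, ∀ x ∈ Ω.carrier,
        HasDerivWithinAt (fun τ => timeCoeff T θ₂ m τ x)
          (((m : ℝ) + 1) * timeCoeff T θ₂ (m + 1) t x) (Icc 0 T) t := fun m t ht x hx =>
      hsol.field_θ₂.hasDerivWithinAt_timeCoeff hT m ht hx
    have hL := (hΘd (m + 1) t ht x hx).const_smul ((m : ℝ) + 1)
    have hR1 := HasDerivWithinAt.fun_sum (u := Finset.HasAntidiagonal.antidiagonal m) fun p _ =>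
      (hWd p.1).inner ℝ ((hΘ p.2).hasDerivWithinAt_gradient hT (hΘd p.2) ht hx)
    have hR := hR1.neg.congr (fun τ hτ => ih hτ) (ih ht)
    have heq := (hu t ht).eq_deriv _ hL hR
    have hΘ1 := fun m => ((hΘ m).slice hT ht).differentiableAt hx
    simp only [gradient_const_mul_at _ (hΘ1 _), smul_comm (B.specVol x), real_inner_smul_left,
      real_inner_smul_right, smul_eq_mul] at heq
    have hl := sum_antidiagonal_leibniz (fun i j => B.specVol x * inner ℝ (momCoeff B T u₀ i t x)
      (gradient (timeCoeff T θ₂ j t) x)) m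
    simp only [smul_eq_mul] at hl
    -- The derivative of the inner product lists the two product-rule terms in the opposite order.
    have hc := Finset.sum_congr (rfl : Finset.HasAntidiagonal.antidiagonal m = _) fun p _ =>
      add_comm (((p.1 : ℝ) + 1) * (B.specVol x * inner ℝ (momCoeff B T u₀ (p.1 + 1) t x)
        (gradient (timeCoeff T θ₂ p.2 t) x))) (((p.2 : ℝ) + 1) * (B.specVol x *
        inner ℝ (momCoeff B T u₀ p.1 t x) (gradient (timeCoeff T θ₂ (p.2 + 1) t) x)))
    rw [hc] at hl
    rw [hl, ← mul_neg] at heq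
    simp only [real_inner_smul_left, smul_eq_mul]
    exact mul_left_cancel₀ (by positivity : ((m : ℝ) + 1) ≠ 0) heq

end Exact

end

section

variable {d : ℕ} {Ω : Domain d} {T : ℝ}

/-! ### Accuracy of the limit scheme -/

section LimitAccuracy

variable {r a : Space d → ℝ} (hr : SmoothField Ω r) (ha : SmoothField Ω a)
  (P : fieldSpace Ω (Space d) →ₗ[ℝ] fieldSpace Ω (Space d))

/-- The bilinear part of the projected limit system for momentum and potential temperature. -/
def limitBilin : (fieldSpace Ω (Space d) × fieldSpace Ω ℝ) →ₗ[ℝ]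
    (fieldSpace Ω (Space d) × fieldSpace Ω ℝ) →ₗ[ℝ] (fieldSpace Ω (Space d) × fieldSpace Ω ℝ) :=
  LinearMap.mk₂ ℝ (fun y z => (P (advection hr y.1 z.1), transport hr y.1 z.2))
    (fun y₁ y₂ z => by simp) (fun c y z => by simp) (fun y z₁ z₂ => by simp) (fun c y z => by simp)

/-- The linear part of the projected limit system. -/
def limitLin : (fieldSpace Ω (Space d) × fieldSpace Ω ℝ) →ₗ[ℝ]
    (fieldSpace Ω (Space d) × fieldSpace Ω ℝ) :=
  LinearMap.inl ℝ _ _ ∘ₗ P ∘ₗ pressureForce ha ∘ₗ LinearMap.snd ℝ _ _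

theorem limit_quad_apply (y z z' : fieldSpace Ω (Space d) × fieldSpace Ω ℝ) :
    limitBilin hr P y z + limitLin ha P z'
      = (P (advection hr y.1 z.1 + pressureForce ha z'.2), transport hr y.1 z.2) := by
  simp [limitBilin, limitLin]

theorem quadCoeff_limit (y : ℕ → fieldSpace Ω (Space d) × fieldSpace Ω ℝ) (m : ℕ) :
    quadCoeff (limitBilin hr P) (limitLin ha P) y m
      = (P (∑ p ∈ Finset.HasAntidiagonal.antidiagonal m, advection hr (y p.1).1 (y p.2).1
          + pressureForce ha (y m).2),
        ∑ p ∈ Finset.HasAntidiagonal.antidiagonal m, transport hr (y p.1).1 (y p.2).2) := by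
  ext1
  · simp [quadCoeff, limitBilin, limitLin, Prod.fst_sum]
  · simp [quadCoeff, limitBilin, limitLin, Prod.snd_sum]

theorem fieldSpace_sum_apply {F : Type*} [NormedAddCommGroup F] [NormedSpace ℝ F] {ι : Type*}
    (t : Finset ι) (f : ι → fieldSpace Ω F) (x : Space d) :
    ((∑ i ∈ t, f i : fieldSpace Ω F) : Space d → F) x = ∑ i ∈ t, (f i : Space d → F) x := by
  rw [Submodule.coe_sum, Finset.sum_apply]

theorem fieldSpace_sum_bound {F : Type*} [NormedAddCommGroup F] [NormedSpace ℝ F]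
    (f : ℕ → fieldSpace Ω F) (N : ℕ) (T : ℝ) : ∃ C : ℝ, ∀ t, 0 ≤ t → t ≤ T → ∀ x ∈ Ω.carrier,
      ‖((∑ m ∈ Finset.range N, t ^ m • f m : fieldSpace Ω F) : Space d → F) x‖ ≤ C := by
  choose C hC using fun m => (f m).2.1.norm_bounded
  refine ⟨∑ m ∈ Finset.range N, T ^ m * C m, fun t h0 hT x hx => ?_⟩
  rw [fieldSpace_sum_apply]
  refine (norm_sum_le _ _).trans (Finset.sum_le_sum fun m _ => ?_)
  rw [Submodule.coe_smul, Pi.smul_apply, norm_smul, norm_pow, Real.norm_of_nonneg h0]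
  exact mul_le_mul (pow_le_pow_left₀ h0 hT m) (hC m x hx) (norm_nonneg _) (pow_nonneg (h0.trans hT) m)

theorem eqOn_smul {F : Type*} [NormedAddCommGroup F] [NormedSpace ℝ F] (a : Space d → ℝ)
    {f g : Space d → F} (h : EqOn f g Ω.carrier) :
    EqOn (fun y => a y • f y) (fun y => a y • g y) Ω.carrier := fun y hy => by
  simp only [h hy]

theorem eqOn_mul (a : Space d → ℝ) {f g : Space d → ℝ} (h : EqOn f g Ω.carrier) :
    EqOn (fun y => a y * f y) (fun y => a y * g y) Ω.carrier := eqOn_smul a h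

theorem norm_expansion_sub_le {F : Type*} [NormedAddCommGroup F] [NormedSpace ℝ F] {a b e : F}
    {t C D : ℝ} {k : ℕ} (ht : 0 ≤ t) (h1 : ‖e - a‖ ≤ C * t ^ (k + 1)) (h2 : ‖b‖ ≤ D) :
    ‖a + t ^ (k + 1) • b - e‖ ≤ (C + D) * t ^ (k + 1) := by
  have h3 : a + t ^ (k + 1) • b - e = t ^ (k + 1) • b - (e - a) := by abel
  rw [h3]
  refine (norm_sub_le _ _).trans ?_
  rw [norm_smul, norm_pow, Real.norm_of_nonneg ht, add_mul, add_comm, mul_comm]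
  have := mul_le_mul_of_nonneg_right h2 (pow_nonneg ht (k + 1))
  linarith

end LimitAccuracy

/-- The stages of the scheme in the limit of vanishing Mach number. -/
structure IsLimitStage {s : ℕ} (Ω : Domain d) (B : Background d) (tab : Tableau s) (dt : ℝ)
    (q₀ : Space d → Space d) (ϑ₀ : Space d → ℝ) (q : Fin (s + 1) → Space d → Space d)
    (θ σ : Fin (s + 1) → Space d → ℝ) (K : Fin (s + 1) → Space d → Space d) : Prop where
  field_q : ∀ i, SmoothField Ω (q i)
  field_θ : ∀ i, SmoothField Ω (θ i)
  field_σ : ∀ i, SmoothField Ω (σ i)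
  solenoidal : ∀ i, Solenoidal Ω (K i)
  slope : ∀ i, ∀ x ∈ Ω.carrier, K i x = -divTensor (q i) (fun y => B.specVol y • q i y) x
    - gradient (fun y => B.thermoCoeff y * θ i y) x
    - B.ρ₀ x • gradient (fun y => B.buoyCoeff y * σ i y) x
  mom : ∀ i, ∀ x ∈ Ω.carrier, q i x = q₀ x + dt • ∑ j ∈ Finset.Iio i, tab.Ae i j • K j x
  theta : ∀ i, ∀ x ∈ Ω.carrier, θ i x = ϑ₀ x + dt • ∑ j ∈ Finset.Iio i,
    tab.Ae i j • -inner ℝ (B.specVol x • q j x) (gradient (θ j) x)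

/-- After projection the exact solution and the limit stages obey the same quadratic equation in
momentum and potential temperature; `ρ₂` and `σ` survive only as the potentials that the projection
removes. The constant adds the Taylor remainder to a bound for the remainder polynomial on `[0, T]`,
so it is fixed before the stages are. -/
theorem IsLimitSolution.exists_accuracy {s k : ℕ} {B : Background d} (hB : B.IsHydrostatic Ω)
    {tab : Tableau s} (hk : tab.HasOrder k) (hT : 0 < T)
    {u₀ : ℝ → Space d → Space d} {ρ₂ p₂ θ₂ : ℝ → Space d → ℝ}
    (hsol : IsLimitSolution Ω B T u₀ ρ₂ p₂ θ₂) {q₀ : Space d → Space d} {ϑ₀ : Space d → ℝ}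
    (hq₀ : ∀ x ∈ Ω.carrier, B.ρ₀ x • u₀ 0 x = q₀ x) (hϑ₀ : ∀ x ∈ Ω.carrier, θ₂ 0 x = ϑ₀ x) :
    ∃ C : ℝ, ∀ dt, 0 < dt → dt ≤ T → ∀ q θ σ K, IsLimitStage Ω B tab dt q₀ ϑ₀ q θ σ K →
      ∀ x ∈ Ω.carrier, ‖q₀ x + dt • ∑ i, tab.b i • K i x - B.ρ₀ x • u₀ dt x‖ ≤ C * dt ^ (k + 1) ∧
        ‖ϑ₀ x + dt • ∑ i, tab.b i • -inner ℝ (B.specVol x • q i x) (gradient (θ i) x) - θ₂ dt x‖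
          ≤ C * dt ^ (k + 1) := by
  obtain ⟨c, hc, hρc⟩ := hB.density_pos
  obtain ⟨P, hP⟩ := exists_projection hc hρc
  have h0 : (0 : ℝ) ∈ Icc 0 T := left_mem_Icc.mpr hT.le
  have hr := hB.field_specVol
  have ha := hB.field_thermoCoeff
  have hw := hsol.field_mom hB hT
  have hW := fun m => (hw.timeCoeff hT m).slice hT h0
  have hΘ := fun m => (hsol.field_θ₂.timeCoeff hT m).slice hT h0
  let y : ℕ → fieldSpace Ω (Space d) × fieldSpace Ω ℝ := fun m => ((hW m).toSpace, (hΘ m).toSpace)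
  have hyW : ∀ m, EqOn ((y m).1 : Space d → Space d) (momCoeff B T u₀ m 0) Ω.carrier := fun m x hx =>
    (hW m).toSpace_apply hx
  have hyΘ : ∀ m, EqOn ((y m).2 : Space d → ℝ) (timeCoeff T θ₂ m 0) Ω.carrier := fun m x hx =>
    (hΘ m).toSpace_apply hx
  have hy : ∀ m : ℕ, ((m : ℝ) + 1) • y (m + 1)
      = quadCoeff (limitBilin hr P) (limitLin ha P) y m := by
    intro m
    rw [quadCoeff_limit]
    refine Prod.ext ?_ ?_
    · refine (hP _ _ (fun x => B.buoyCoeff x * timeCoeff T ρ₂ m 0 x) ?_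
        (hB.field_buoyCoeff.mul ((hsol.field_ρ₂.timeCoeff hT m).slice hT h0)) ?_).symm
      · exact ((hsol.solenoidal_momCoeff hB hT (m + 1) h0).const_smul ((m : ℝ) + 1)).congr
          fun x hx => by
            simp only [Prod.smul_fst, Submodule.coe_smul, Pi.smul_apply, hyW (m + 1) hx]
      · intro x hx
        simp only [Prod.smul_fst, Submodule.coe_smul, Pi.smul_apply, hyW (m + 1) hx,
          Submodule.coe_add, Pi.add_apply, fieldSpace_sum_apply]
        rw [hsol.momCoeff_succ hB hT m h0 hx, pressureForce_apply ha _ hx,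
          gradient_congr_on (eqOn_mul B.thermoCoeff (hyΘ m)) hx, ← sub_eq_add_neg]
        congr 2
        rw [← Finset.sum_neg_distrib]
        refine Finset.sum_congr rfl fun p _ => ?_
        rw [advection_apply hr _ _ hx, divTensor_congr_on (hyW p.1)
          (eqOn_smul B.specVol (hyW p.2)) hx]
    · refine fieldSpace_ext fun x hx => ?_
      simp only [Prod.smul_snd, Submodule.coe_smul, Pi.smul_apply, hyΘ (m + 1) hx,
        fieldSpace_sum_apply]
      rw [hsol.thetaCoeff_succ hB hT m h0 hx, ← Finset.sum_neg_distrib]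
      refine Finset.sum_congr rfl fun p _ => ?_
      rw [transport_apply hr _ _ hx, hyW p.1 hx, gradient_congr_on (hyΘ p.2) hx]
  obtain ⟨N, w, hexp⟩ := hk.exists_update_expansion (limitBilin hr P) (limitLin ha P) hy
  obtain ⟨C₁, hC₁⟩ := hw.taylor_bound hT k
  obtain ⟨C₂, hC₂⟩ := hsol.field_θ₂.taylor_bound hT k
  obtain ⟨D₁, hD₁⟩ := fieldSpace_sum_bound (fun m => (w m).1) N T
  obtain ⟨D₂, hD₂⟩ := fieldSpace_sum_bound (fun m => (w m).2) N T
  refine ⟨max (C₁ + D₁) (C₂ + D₂), fun dt hdt hdtT q θ σ K hst => ?_⟩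
  have hmem : dt ∈ Icc 0 T := ⟨hdt.le, hdtT⟩
  let Y : Fin (s + 1) → fieldSpace Ω (Space d) × fieldSpace Ω ℝ := fun i =>
    ((hst.field_q i).toSpace, (hst.field_θ i).toSpace)
  have hYq : ∀ i, EqOn ((Y i).1 : Space d → Space d) (q i) Ω.carrier := fun i x hx =>
    (hst.field_q i).toSpace_apply hx
  have hYθ : ∀ i, EqOn ((Y i).2 : Space d → ℝ) (θ i) Ω.carrier := fun i x hx =>
    (hst.field_θ i).toSpace_apply hx
  have hf1 : ∀ i, EqOn ((limitBilin hr P (Y i) (Y i) + limitLin ha P (Y i)).1 : Space d → Space d)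
      (K i) Ω.carrier := by
    intro i x hx
    -- The slope is solenoidal and differs from the unprojected force by a weighted gradient, so it
    -- is the projected force, whatever `σ i` is.
    have hKi : P (advection hr (Y i).1 (Y i).1 + pressureForce ha (Y i).2)
        = (hst.solenoidal i).field.toSpace := by
      refine hP _ _ (fun x => B.buoyCoeff x * σ i x)
        ((hst.solenoidal i).congr fun x hx => (hst.solenoidal i).field.toSpace_apply hx)
        (hB.field_buoyCoeff.mul (hst.field_σ i)) fun x hx => ?_
      rw [SmoothField.toSpace_apply _ hx, hst.slope i x hx]
      simp only [Submodule.coe_add, Pi.add_apply]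
      rw [advection_apply hr _ _ hx, pressureForce_apply ha _ hx, ← sub_eq_add_neg,
        gradient_congr_on (eqOn_mul B.thermoCoeff (hYθ i)) hx,
        divTensor_congr_on (hYq i) (eqOn_smul B.specVol (hYq i)) hx]
    rw [limit_quad_apply, hKi]
    exact (hst.solenoidal i).field.toSpace_apply hx
  have hf2 : ∀ i, EqOn ((limitBilin hr P (Y i) (Y i) + limitLin ha P (Y i)).2 : Space d → ℝ)
      (fun x => -inner ℝ (B.specVol x • q i x) (gradient (θ i) x)) Ω.carrier := by
    intro i x hx
    rw [limit_quad_apply, transport_apply hr _ _ hx, hYq i hx, gradient_congr_on (hYθ i) hx]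
  have hy0q : EqOn ((y 0).1 : Space d → Space d) q₀ Ω.carrier := fun x hx =>
    (hyW 0 hx).trans (hq₀ x hx)
  have hy0θ : EqOn ((y 0).2 : Space d → ℝ) ϑ₀ Ω.carrier := fun x hx =>
    (hyΘ 0 hx).trans (hϑ₀ x hx)
  have hupd := hexp dt Y (fun i => by
    refine Prod.ext (fieldSpace_ext fun x hx => ?_) (fieldSpace_ext fun x hx => ?_)
    · simp only [Prod.fst_add, Prod.smul_fst, Prod.fst_sum, Submodule.coe_add, Submodule.coe_smul,
        Pi.add_apply, Pi.smul_apply, fieldSpace_sum_apply]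
      rw [hYq i hx, hst.mom i x hx, hy0q hx]
      congr 2
      exact Finset.sum_congr rfl fun j _ => by rw [← hf1 j hx]; rfl
    · simp only [Prod.snd_add, Prod.smul_snd, Prod.snd_sum, Submodule.coe_add, Submodule.coe_smul,
        Pi.add_apply, Pi.smul_apply, fieldSpace_sum_apply]
      rw [hYθ i hx, hst.theta i x hx, hy0θ hx]
      congr 2
      exact Finset.sum_congr rfl fun j _ => congrArg (tab.Ae i j • ·) (hf2 j hx).symm)
  intro x hx
  constructor
  · have h1 : ((y 0).1 : Space d → Space d) x + dt • ∑ i, tab.b i •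
          ((limitBilin hr P (Y i) (Y i) + limitLin ha P (Y i)).1 : Space d → Space d) x
        = ∑ m ∈ Finset.range (k + 1), dt ^ m • ((y m).1 : Space d → Space d) x
          + dt ^ (k + 1) • ((∑ m ∈ Finset.range N, dt ^ m • (w m).1 :
            fieldSpace Ω (Space d)) : Space d → Space d) x := by
      have h := congrArg (fun z : fieldSpace Ω (Space d) × fieldSpace Ω ℝ =>
        (z.1 : Space d → Space d) x) hupd
      simpa only [Prod.fst_add, Prod.smul_fst, Prod.fst_sum, Submodule.coe_add, Submodule.coe_smul,
        Pi.add_apply, Pi.smul_apply, fieldSpace_sum_apply] using h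
    rw [hy0q hx, Finset.sum_congr rfl fun i _ => congrArg (tab.b i • ·) (hf1 i hx),
      Finset.sum_congr (rfl : Finset.range (k + 1) = _) fun m _ =>
        congrArg (dt ^ m • ·) (hyW m hx)] at h1
    rw [h1]
    exact (norm_expansion_sub_le hdt.le (hC₁ dt hmem x hx) (hD₁ dt hdt.le hdtT x hx)).trans
      (mul_le_mul_of_nonneg_right (le_max_left _ _) (by positivity))
  · have h1 : ((y 0).2 : Space d → ℝ) x + dt • ∑ i, tab.b i •
          ((limitBilin hr P (Y i) (Y i) + limitLin ha P (Y i)).2 : Space d → ℝ) x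
        = ∑ m ∈ Finset.range (k + 1), dt ^ m • ((y m).2 : Space d → ℝ) x
          + dt ^ (k + 1) • ((∑ m ∈ Finset.range N, dt ^ m • (w m).2 :
            fieldSpace Ω ℝ) : Space d → ℝ) x := by
      have h := congrArg (fun z : fieldSpace Ω (Space d) × fieldSpace Ω ℝ =>
        (z.2 : Space d → ℝ) x) hupd
      simpa only [Prod.snd_add, Prod.smul_snd, Prod.snd_sum, Submodule.coe_add, Submodule.coe_smul,
        Pi.add_apply, Pi.smul_apply, fieldSpace_sum_apply] using h
    rw [hy0θ hx, Finset.sum_congr rfl fun i _ => congrArg (tab.b i • ·) (hf2 i hx),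
      Finset.sum_congr (rfl : Finset.range (k + 1) = _) fun m _ =>
        congrArg (dt ^ m • ·) (hyΘ m hx)] at h1
    rw [h1]
    exact (norm_expansion_sub_le hdt.le (hC₂ dt hmem x hx) (hD₂ dt hdt.le hdtT x hx)).trans
      (mul_le_mul_of_nonneg_right (le_max_right _ _) (by positivity))

end

/-! ### Asymptotics of the right-hand side as the Mach number vanishes. -/

section

variable {d : ℕ} {Ω : Domain d}
  {F : Type*} [NormedAddCommGroup F] [NormedSpace ℝ F]

/-! ### Expansions in the Mach number -/

theorem tendsto_sq_zero : Tendsto (fun ε : ℝ => ε ^ 2) (𝓝[>] 0) (𝓝 0) := by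
  have h : Tendsto (fun ε : ℝ => ε ^ 2) (𝓝 0) (𝓝 (0 ^ 2)) := (continuous_pow 2).tendsto 0
  simpa using h.mono_left nhdsWithin_le_nhds

theorem tendsto_one_sub_sq : Tendsto (fun ε : ℝ => 1 - ε ^ 2) (𝓝[>] 0) (𝓝 1) := by
  simpa using tendsto_sq_zero.const_sub 1

theorem tendsto_pow_zero {m : ℕ} (hm : m ≠ 0) :
    Tendsto (fun ε : ℝ => ε ^ m) (𝓝[>] 0) (𝓝 0) := by
  have h : Tendsto (fun ε : ℝ => ε ^ m) (𝓝 0) (𝓝 (0 ^ m)) := (continuous_pow m).tendsto 0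
  simpa [hm] using h.mono_left nhdsWithin_le_nhds

namespace HasExpansion

variable {m : ℕ} {f : ℝ → Space d → F} {f₀ g : Space d → F}

theorem famConv_quotient (h : HasExpansion Ω m f f₀ g)
    (hf : ∀ᶠ ε in 𝓝[>] (0 : ℝ), SmoothField Ω (f ε)) :
    FamConv Ω (fun ε x => (ε ^ m)⁻¹ • (f ε x - f₀ x)) g := by
  refine FamConv.of_smoothLimit ?_ h.2.1 h.2.2
  filter_upwards [hf] with ε hε using (hε.sub h.1).const_smul _

theorem famConv (h : HasExpansion Ω m f f₀ g) (hm : m ≠ 0)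
    (hf : ∀ᶠ ε in 𝓝[>] (0 : ℝ), SmoothField Ω (f ε)) : FamConv Ω f f₀ := by
  refine ((FamConv.const h.1).add
    ((h.famConv_quotient hf).tendsto_smul (tendsto_pow_zero hm))).congr ?_ fun x _ => by simp
  filter_upwards [self_mem_nhdsWithin] with ε hε x _
  have hε' : ε ^ m ≠ 0 := pow_ne_zero _ (ne_of_gt hε)
  simp [smul_smul, hε']

end HasExpansion

theorem div_smul_at {φ : Space d → ℝ} {v : Space d → Space d} {x : Space d}
    (hφ : DifferentiableAt ℝ φ x) (hv : DifferentiableAt ℝ v x) :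
    div (fun y => φ y • v y) x = φ x * div v x + inner ℝ (v x) (gradient φ x) := by
  have h : traceCLM d ((fderiv ℝ φ x).smulRight (v x)) = fderiv ℝ φ x (v x) := by
    conv_rhs => rw [show v x = ∑ j, v x j • EuclideanSpace.single j (1 : ℝ) by
      ext i
      simp [Finset.sum_apply, Pi.single_apply]]
    simp [traceCLM, mul_comm]
  rw [div_eq_trace (hφ.fun_smul hv), fderiv_fun_smul hφ hv, map_add, map_smul, h, ← div_eq_trace hv,
    gradient_eq, real_inner_comm, inner_gradCLM, smul_eq_mul]

/-- The background enthalpy balances gravity. -/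
theorem Background.IsHydrostatic.gradient_enthalpy {B : Background d} (hB : B.IsHydrostatic Ω)
    {x : Space d} (hx : x ∈ Ω.carrier) :
    gradient (fun y => B.γ / (B.γ - 1) * (B.p₀ y * B.specVol y)) x = -gradient B.Φ x := by
  have hρ := hB.field_ρ₀.differentiableAt hx
  have hs := hB.field_specVol.differentiableAt hx
  have hp := hB.field_p₀.differentiableAt hx
  have h0 := (hB.rho_pos hx).ne'
  have hγ : B.γ - 1 ≠ 0 := (sub_pos.mpr hB.one_lt_γ).ne'
  have h1 : B.ρ₀ x • gradient B.specVol x + B.specVol x • gradient B.ρ₀ x = 0 := by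
    have h : EqOn (fun y => B.ρ₀ y * B.specVol y) (fun _ => 1) Ω.carrier := fun y hy =>
      mul_inv_cancel₀ (hB.rho_pos hy).ne'
    rw [← gradient_mul_at hρ hs, gradient_congr_on h hx, gradient_eq]
    simp
  have h2 : gradient B.specVol x = -((B.specVol x * B.specVol x) • gradient B.ρ₀ x) := by
    have h3 := congrArg (fun v => B.specVol x • v) h1
    have h4 : B.specVol x * B.ρ₀ x = 1 := inv_mul_cancel₀ h0
    simp only [smul_add, smul_smul, h4, one_smul, smul_zero] at h3
    exact eq_neg_of_add_eq_zero_left h3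
  -- In units of `p₀ ρ₀⁻² ∇ρ₀`, the part `∇p₀ / ρ₀` contributes `γ` and `p₀ ∇(1 / ρ₀)` contributes
  -- `-1`; the sum cancels the denominator `γ - 1`.
  rw [gradient_const_mul_at _ (hp.fun_mul hs), gradient_mul_at hp hs, h2, hB.gradient_pressure hx,
    hB.gradient_potential hx, neg_neg, smul_neg, smul_smul, smul_smul, ← sub_eq_neg_add, ← sub_smul,
    smul_smul]
  congr 1
  simp only [specVol, buoyCoeff]
  field_simp

/-! ### The limit of the right-hand side -/

section RhsLimit

variable {B : Background d} (hB : B.IsHydrostatic Ω) {E I : ℝ → State d}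
  {q qI : Space d → Space d} {θ σ : Space d → ℝ}

/-- The leading-order state with momentum `q` and potential temperature perturbation `θ`. -/
def limitState (B : Background d) (q : Space d → Space d) (θ : Space d → ℝ) : State d :=
  fun x => (B.ρ₀ x, q x, (B.γ - 1)⁻¹ * B.p₀ x, θ x)

theorem FamConv.rho {U : State d} (h : FamConv Ω E U) : FamConv Ω (fun ε => (E ε).rho) U.rho := h.fst
theorem FamConv.mom {U : State d} (h : FamConv Ω E U) : FamConv Ω (fun ε => (E ε).mom) U.mom :=
  h.snd.fst
theorem FamConv.energy {U : State d} (h : FamConv Ω E U) :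
    FamConv Ω (fun ε => (E ε).energy) U.energy := h.snd.snd.fst
theorem FamConv.theta2 {U : State d} (h : FamConv Ω E U) :
    FamConv Ω (fun ε => (E ε).theta2) U.theta2 := h.snd.snd.snd

theorem famConv_vel (hB : B.IsHydrostatic Ω) (hρ : FamConv Ω (fun ε => (E ε).rho) B.ρ₀)
    (hq : FamConv Ω (fun ε => (E ε).mom) q) :
    FamConv Ω (fun ε => (E ε).vel) (fun x => B.specVol x • q x) := by
  obtain ⟨c, hc, h⟩ := hB.density_pos
  exact (hρ.inv hc h).smul hq

theorem famConv_kinetic (hB : B.IsHydrostatic Ω) (hρ : FamConv Ω (fun ε => (E ε).rho) B.ρ₀)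
    (hq : FamConv Ω (fun ε => (E ε).mom) q) :
    FamConv Ω (fun ε x => ε ^ 2 * (E ε).rho x * ‖(E ε).vel x‖ ^ 2 / 2) (fun _ => 0) := by
  have hv := famConv_vel hB hρ hq
  refine (((hρ.mul (hv.inner hv)).tendsto_smul tendsto_sq_zero).const_smul (1 / 2)).congr
    (Eventually.of_forall fun ε x _ => ?_) fun x _ => by simp
  simp only [real_inner_self_eq_norm_sq, smul_eq_mul]
  ring

theorem famConv_pressure (hB : B.IsHydrostatic Ω) (hE : FamConv Ω E (limitState B q θ)) :
    FamConv Ω (fun ε => (E ε).pressure B.γ ε) B.p₀ := by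
  have hγ : B.γ - 1 ≠ 0 := (sub_pos.mpr hB.one_lt_γ).ne'
  refine ((hE.energy.sub (famConv_kinetic hB hE.rho hE.mom)).const_smul (B.γ - 1)).congr
    (Eventually.of_forall fun ε x _ => rfl) fun x _ => ?_
  simp [State.energy, limitState, hγ]

theorem FamConv.potTemp (hB : B.IsHydrostatic Ω) {U : State d} (hE : FamConv Ω E U) :
    FamConv Ω (fun ε => potTemp B ε (E ε)) B.θ₀ :=
  ((FamConv.const hB.field_theta).add (hE.theta2.tendsto_smul tendsto_sq_zero)).congr
    (Eventually.of_forall fun ε x _ => rfl) fun x _ => by simp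

theorem famConv_p2I (hB : B.IsHydrostatic Ω) (hE : FamConv Ω E (limitState B q θ))
    (hσ : FamConv Ω (fun ε => rho2I B ε (I ε)) σ) :
    FamConv Ω (fun ε => p2I B ε (E ε) (I ε))
      (fun y => B.γ * B.p₀ y / (B.ρ₀ y * B.θ₀ y) * (B.ρ₀ y * θ y + B.θ₀ y * σ y)) :=
  (FamConv.const hB.field_pressureCoeff).mul
    (((FamConv.const hB.field_ρ₀).mul hE.theta2).add ((hE.potTemp hB).mul hσ))

theorem famConv_pI (hB : B.IsHydrostatic Ω) (hE : FamConv Ω E (limitState B q θ))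
    (hσ : FamConv Ω (fun ε => rho2I B ε (I ε)) σ) :
    FamConv Ω (fun ε => pI B ε (E ε) (I ε)) B.p₀ :=
  ((FamConv.const hB.field_p₀).add ((famConv_p2I hB hE hσ).tendsto_smul tendsto_sq_zero)).congr
    (Eventually.of_forall fun ε x _ => rfl) fun x _ => by simp

/-- The density of the implicit state in terms of its perturbation. -/
theorem famConv_rho_of_rho2I (hB : B.IsHydrostatic Ω)
    (hσ : FamConv Ω (fun ε => rho2I B ε (I ε)) σ) : FamConv Ω (fun ε => (I ε).rho) B.ρ₀ := by
  refine ((FamConv.const hB.field_ρ₀).add (hσ.tendsto_smul tendsto_sq_zero)).congr ?_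
    fun x _ => by simp
  filter_upwards [self_mem_nhdsWithin] with ε hε x _
  have hε' : ε ≠ 0 := ne_of_gt hε
  simp only [rho2I, smul_eq_mul]
  field_simp
  ring

theorem famConv_enthalpyI (hB : B.IsHydrostatic Ω) (hE : FamConv Ω E (limitState B q θ))
    (hσ : FamConv Ω (fun ε => rho2I B ε (I ε)) σ) (hI : FamConv Ω (fun ε => (I ε).mom) qI) :
    FamConv Ω (fun ε => enthalpyI B ε (E ε) (I ε))
      (fun y => B.γ / (B.γ - 1) * (B.p₀ y * B.specVol y)) := by
  obtain ⟨c, hc, h⟩ := hB.density_pos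
  have hρ := famConv_rho_of_rho2I hB hσ
  have hi := hρ.inv hc h
  refine ((((famConv_pI hB hE hσ).mul hi).const_smul (B.γ / (B.γ - 1))).add
    ((((hI.inner hI).mul (hi.mul hi)).tendsto_smul tendsto_sq_zero).const_smul (1 / 2))).congr
    (Eventually.of_forall fun ε x _ => ?_) fun x _ => by simp [Background.specVol]
  simp only [enthalpyI, real_inner_self_eq_norm_sq, smul_eq_mul]
  ring

theorem famConv_rhs_rho {U : State d} (hE : FamConv Ω E U)
    (hI : FamConv Ω (fun ε => (I ε).mom) qI) :
    FamConv Ω (fun ε x => (rhs B ε (E ε) (I ε) x).1) (fun x => -div qI x) :=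
  ((hE.mom.div.tendsto_smul tendsto_sq_zero).add
    (hI.div.tendsto_smul tendsto_one_sub_sq)).neg.congr
    (Eventually.of_forall fun ε x _ => rfl) fun x _ => by simp

/-- The limit slope of the momentum. -/
def momSlope (B : Background d) (q : Space d → Space d) (θ σ : Space d → ℝ) (x : Space d) :
    Space d :=
  -divTensor q (fun y => B.specVol y • q y) x - gradient (fun y => B.thermoCoeff y * θ y) x
    - B.ρ₀ x • gradient (fun y => B.buoyCoeff y * σ y) x

/-- The limit slope of the potential temperature. -/
def thetaSlope (B : Background d) (q : Space d → Space d) (θ : Space d → ℝ) (x : Space d) : ℝ :=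
  -inner ℝ (B.specVol x • q x) (gradient θ x)

/-- The background parts of `∇p_I + ρ_I ∇Φ` cancel exactly, leaving `ε² (∇p₂ + ρ₂ ∇Φ)` and a bounded
quotient. No convergence of the implicit momentum is required, since only the implicit density
occurs. -/
theorem famConv_rhs_mom (hB : B.IsHydrostatic Ω) (hE : FamConv Ω E (limitState B q θ))
    (hσ : FamConv Ω (fun ε => rho2I B ε (I ε)) σ) :
    FamConv Ω (fun ε x => (rhs B ε (E ε) (I ε) x).2.1) (momSlope B q θ σ) := by
  have hp2 := famConv_p2I hB hE hσ
  have hΦ := FamConv.const hB.field_Φ.gradient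
  refine ((((hE.mom.divTensor (famConv_vel hB hE.rho hE.mom)).add
    (famConv_pressure hB hE).gradient).add (hE.rho.smul hΦ)).add
    ((hp2.gradient.add (hσ.smul hΦ)).tendsto_smul tendsto_one_sub_sq)).neg.congr ?_ fun x hx => ?_
  · filter_upwards [hp2.bdd.smooth, self_mem_nhdsWithin] with ε hs hε x hx
    have hε' : ε ≠ 0 := ne_of_gt hε
    have hg : gradient (pI B ε (E ε) (I ε)) x
        = gradient B.p₀ x + ε ^ 2 • gradient (p2I B ε (E ε) (I ε)) x := by
      have hd := differentiableAt_on hs hx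
      rw [← gradient_const_mul_at _ hd,
        ← gradient_add_at (hB.field_p₀.differentiableAt hx) (hd.const_mul _)]
      rfl
    have hr : (I ε).rho x = B.ρ₀ x + ε ^ 2 * rho2I B ε (I ε) x := by
      simp only [rho2I]
      field_simp
      ring
    have hst : ((1 - ε ^ 2) / ε ^ 2) • (gradient (pI B ε (E ε) (I ε)) x
        + (I ε).rho x • gradient B.Φ x)
        = (1 - ε ^ 2) • (gradient (p2I B ε (E ε) (I ε)) x
          + rho2I B ε (I ε) x • gradient B.Φ x) := by
      have h1 : gradient (pI B ε (E ε) (I ε)) x + (I ε).rho x • gradient B.Φ x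
          = ε ^ 2 • (gradient (p2I B ε (E ε) (I ε)) x
          + rho2I B ε (I ε) x • gradient B.Φ x) := by
        rw [hg, hr, hB.balance x hx, add_smul, smul_add, smul_smul]
        abel
      rw [h1, smul_smul, div_mul_cancel₀ _ (pow_ne_zero 2 hε')]
    simp only [rhs, hst]
  · have h := hB.gradient_add_gravity hE.theta2.field hσ.field hx
    simp only [State.theta2, State.rho, State.mom, limitState] at h ⊢
    have hq : (limitState B q θ).mom = q := rfl
    rw [hB.balance x hx, one_smul, h, momSlope, hq]
    abel

/-- `∇·(H q) + q·∇Φ = H ∇·q + q·(∇H + ∇Φ)`, and the bracket vanishes for the background enthalpy.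
The energy slope is thus tied to the divergence alone. -/
theorem famConv_rhs_energy (hB : B.IsHydrostatic Ω) (hE : FamConv Ω E (limitState B q θ))
    (hσ : FamConv Ω (fun ε => rho2I B ε (I ε)) σ) (hI : FamConv Ω (fun ε => (I ε).mom) qI) :
    FamConv Ω (fun ε x => (rhs B ε (E ε) (I ε) x).2.2.1)
      (fun x => -(B.γ / (B.γ - 1) * (B.p₀ x * B.specVol x) * div qI x)) := by
  have hH := famConv_enthalpyI hB hE hσ hI
  have hΦ := FamConv.const hB.field_Φ.gradient
  have h1 := ((((hE.energy.add (famConv_pressure hB hE)).smul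
    (famConv_vel hB hE.rho hE.mom)).div.add (hE.mom.inner hΦ)).tendsto_smul tendsto_sq_zero)
  have h2 := (((hH.smul hI).div.add (hI.inner hΦ)).tendsto_smul tendsto_one_sub_sq)
  refine (h1.add h2).neg.congr (Eventually.of_forall fun ε x _ => rfl) fun x hx => ?_
  simp only [zero_smul, zero_add, one_smul]
  rw [div_smul_at (hH.field.differentiableAt hx) (hI.field.differentiableAt hx),
    hB.gradient_enthalpy hx, inner_neg_right, neg_add_cancel_right]

theorem famConv_rhs_theta (hB : B.IsHydrostatic Ω) (hE : FamConv Ω E (limitState B q θ)) :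
    FamConv Ω (fun ε x => (rhs B ε (E ε) (I ε) x).2.2.2) (thetaSlope B q θ) := by
  refine ((famConv_vel hB hE.rho hE.mom).inner hE.theta2.gradient).neg.congr
    (Eventually.of_forall fun ε x hx => ?_) fun x _ => rfl
  simp only [rhs, hB.gradient_theta hx, inner_zero_right, mul_zero, add_zero]

theorem famConv_rhs (hB : B.IsHydrostatic Ω) (hE : FamConv Ω E (limitState B q θ))
    (hσ : FamConv Ω (fun ε => rho2I B ε (I ε)) σ) (hI : FamConv Ω (fun ε => (I ε).mom) qI) :
    FamConv Ω (fun ε => rhs B ε (E ε) (I ε)) (fun x => (-div qI x, momSlope B q θ σ x,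
      -(B.γ / (B.γ - 1) * (B.p₀ x * B.specVol x) * div qI x), thetaSlope B q θ x)) :=
  (famConv_rhs_rho (B := B) hE hI).prodMk ((famConv_rhs_mom hB hE hσ).prodMk
    ((famConv_rhs_energy hB hE hσ hI).prodMk (famConv_rhs_theta (I := I) hB hE)))

end RhsLimit

end

section

variable {d : ℕ} {Ω : Domain d} {B : Background d}
  {F : Type*} [NormedAddCommGroup F] [NormedSpace ℝ F]

/-! ### The limit of the stages -/

theorem SmoothField.state {U : State d} (h : SmoothField Ω U) :
    SmoothField Ω U.rho ∧ SmoothField Ω U.mom ∧ SmoothField Ω U.energy ∧ SmoothField Ω U.theta2 :=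
  have h' := FamConv.const h
  ⟨h'.rho.field, h'.mom.field, h'.energy.field, h'.theta2.field⟩

theorem SmoothField.pressure {U : State d} (h : SmoothField Ω U) {c : ℝ} (hc : 0 < c)
    (hρ : ∀ x ∈ Ω.carrier, c ≤ U.rho x) (γ ε : ℝ) : SmoothField Ω (U.pressure γ ε) := by
  obtain ⟨h1, h2, h3, -⟩ := h.state
  have hv : SmoothField Ω U.vel := (h1.inv hc hρ).smul h2
  refine ((h3.sub ((h1.mul (hv.inner hv)).const_smul (ε ^ 2 / 2))).const_smul (γ - 1)).congr
    fun x _ => ?_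
  simp only [State.pressure, real_inner_self_eq_norm_sq, smul_eq_mul]
  ring

/-- The data prescribe pressure and `θ`, the state contains energy and `θ₂`: the energy is recovered
up to a vanishing kinetic part, and `θ₂` is the quotient in the expansion of `θ`. -/
theorem WellPrepared.famConv (hB : B.IsHydrostatic Ω) {U : ℝ → State d}
    {q₀ q₁ : Space d → Space d} {r₂ π₂ ϑ₂ : Space d → ℝ}
    (h : WellPrepared Ω B U q₀ q₁ r₂ π₂ ϑ₂) : FamConv Ω U (limitState B q₀ ϑ₂) := by
  have hγ : B.γ - 1 ≠ 0 := (sub_pos.mpr hB.one_lt_γ).ne'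
  obtain ⟨c, hc, hρc⟩ := hB.density_pos
  have hρ := h.rho.famConv two_ne_zero (h.field.mono fun ε hε => hε.state.1)
  have hq := h.mom.famConv one_ne_zero (h.field.mono fun ε hε => hε.state.2.1)
  have hp : FamConv Ω (fun ε => (U ε).pressure B.γ ε) B.p₀ := by
    refine h.pressure.famConv two_ne_zero ?_
    filter_upwards [h.field, hρ.eventually_lower_bound hc hρc] with ε h1 h2 using
      h1.pressure (half_pos hc) h2 B.γ ε
  have hθ : FamConv Ω (fun ε => (U ε).theta2) ϑ₂ := by
    refine (h.theta.famConv_quotient ?_).congr ?_ fun x _ => rfl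
    · filter_upwards [h.field] with ε hε using hB.field_theta.add (hε.state.2.2.2.const_smul (ε ^ 2))
    · filter_upwards [self_mem_nhdsWithin] with ε hε x _
      have hε' : ε ≠ 0 := ne_of_gt hε
      simp only [potTemp, add_sub_cancel_left, smul_eq_mul]
      field_simp
  have he : FamConv Ω (fun ε => (U ε).energy) (fun x => (B.γ - 1)⁻¹ * B.p₀ x) := by
    refine ((hp.const_smul (B.γ - 1)⁻¹).add (famConv_kinetic hB hρ hq)).congr
      (Eventually.of_forall fun ε x _ => ?_) fun x _ => by simp
    simp only [State.pressure, smul_eq_mul]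
    field_simp
    ring
  exact hρ.prodMk (hq.prodMk (he.prodMk hθ))

theorem FamConv.add_smul_sum {ι : Type*} {U : ℝ → Space d → F} {u : Space d → F}
    (hU : FamConv Ω U u) (c : ℝ) (t : Finset ι) (a : ι → ℝ) {R : ι → ℝ → Space d → F}
    {r : ι → Space d → F} (hR : ∀ j ∈ t, FamConv Ω (R j) (r j)) :
    FamConv Ω (fun ε => U ε + c • ∑ j ∈ t, a j • R j ε)
      (fun x => u x + c • ∑ j ∈ t, a j • r j x) :=
  (hU.add ((FamConv.sum t fun j hj => (hR j hj).const_smul (a j)).const_smul c)).congr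
    (Eventually.of_forall fun ε x _ => by simp [Finset.sum_apply]) fun x _ => rfl

theorem limitState_add_smul_sum {ι : Type*} (q₀ : Space d → Space d) (ϑ₀ : Space d → ℝ) (c : ℝ)
    (t : Finset ι) (a : ι → ℝ) (K : ι → Space d → Space d) (Θ : ι → Space d → ℝ) (x : Space d) :
    limitState B q₀ ϑ₀ x + c • ∑ j ∈ t, a j • ((0 : ℝ), K j x, (0 : ℝ), Θ j x)
      = limitState B (fun y => q₀ y + c • ∑ j ∈ t, a j • K j y)
        (fun y => ϑ₀ y + c • ∑ j ∈ t, a j • Θ j y) x := by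
  simp [limitState, Prod.ext_iff, Prod.fst_sum, Prod.snd_sum]

theorem momSlope_congr {q q' : Space d → Space d} {θ θ' σ σ' : Space d → ℝ}
    (hq : EqOn q q' Ω.carrier) (hθ : EqOn θ θ' Ω.carrier) (hσ : EqOn σ σ' Ω.carrier) :
    EqOn (momSlope B q θ σ) (momSlope B q' θ' σ') Ω.carrier := by
  intro x hx
  rw [momSlope, momSlope, divTensor_congr_on hq (eqOn_smul _ hq) hx,
    gradient_congr_on (eqOn_mul _ hθ) hx, gradient_congr_on (eqOn_mul _ hσ) hx]

section Stages

variable {s : ℕ} {tab : Tableau s} {dt : ℝ} {U0 U1 : ℝ → State d}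
  {UE UI : ℝ → Fin (s + 1) → State d} {q₀ : Space d → Space d} {ϑ₀ : Space d → ℝ}
  {σ : Fin (s + 1) → Space d → ℝ}

/-- Convergence of one stage: to the explicit state `(q, θ)` and to the implicit momentum `qI`. -/
structure StageLimit (Ω : Domain d) (B : Background d) (E I : ℝ → State d)
    (q : Space d → Space d) (θ σ : Space d → ℝ) (qI : Space d → Space d) : Prop where
  explicit : FamConv Ω E (limitState B q θ)
  mom : FamConv Ω (fun ε => (I ε).mom) qI
  div_zero : ∀ x ∈ Ω.carrier, div qI x = 0
  slope : FamConv Ω (fun ε => rhs B ε (E ε) (I ε))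
    (fun x => (0, momSlope B q θ σ x, 0, thetaSlope B q θ x))

/-- Strong induction on the stage. Vanishing density and energy slopes at earlier stages keep the
explicit value and the intermediate value `U_⋆` on the background, and the assumed density expansion
yields the divergence constraint for the new one. -/
theorem exists_stageLimit (hB : B.IsHydrostatic Ω) (hdt : dt ≠ 0)
    (hdiag : ∀ i, i ≠ 0 → tab.Ai i i ≠ 0)
    (hstep : ∀ᶠ ε in 𝓝[>] (0 : ℝ), IsSchemeStep Ω B tab dt ε (U0 ε) (UE ε) (UI ε) (U1 ε))
    (h0 : FamConv Ω U0 (limitState B q₀ ϑ₀)) (hdiv : ∀ x ∈ Ω.carrier, div q₀ x = 0)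
    (hσ : ∀ i, FamConv Ω (fun ε => rho2I B ε (UI ε i)) (σ i)) (i : Fin (s + 1)) :
    ∃ q θ qI, StageLimit Ω B (fun ε => UE ε i) (fun ε => UI ε i) q θ (σ i) qI := by
  induction i using WellFoundedLT.induction with
  | ind i ih =>
  choose! q θ qI hS using ih
  have hlt : ∀ j ∈ Finset.Iio i, j < i := fun j hj => Finset.mem_Iio.mp hj
  obtain ⟨qE, θE, hE⟩ : ∃ qE θE, FamConv Ω (fun ε => UE ε i) (limitState B qE θE) := by
    refine ⟨_, _, (h0.add_smul_sum dt (Finset.Iio i) (tab.Ae i)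
      fun j hj => (hS j (hlt j hj)).slope).congr ?_ fun x _ => (limitState_add_smul_sum ..).symm⟩
    filter_upwards [hstep] with ε hε using hε.explicit i
  have hstar : FamConv Ω (fun ε => tab.starStage dt (rhs B ε) (U0 ε) (UE ε) (UI ε) i) (limitState B
      (fun y => q₀ y + dt • ∑ j ∈ Finset.Iio i, tab.Ai i j • momSlope B (q j) (θ j) (σ j) y)
      (fun y => ϑ₀ y + dt • ∑ j ∈ Finset.Iio i, tab.Ai i j • thetaSlope B (q j) (θ j) y)) :=
    (h0.add_smul_sum dt (Finset.Iio i) (tab.Ai i) fun j hj => (hS j (hlt j hj)).slope).congr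
      (Eventually.of_forall fun ε x _ => rfl) fun x _ => (limitState_add_smul_sum ..).symm
  -- The implicit momentum converges before anything is known about its divergence, because its
  -- slope depends on the implicit state only through the density.
  have hI := (hstar.mom.add ((famConv_rhs_mom hB hE (hσ i)).const_smul (dt * tab.Ai i i))).congr
    (f' := fun ε => (UI ε i).mom) (by
      filter_upwards [hstep] with ε hε x hx
      simp only [State.mom, hε.implicit i hx]
      rfl) fun x _ => rfl
  have hR := famConv_rhs hB hE (hσ i) hI
  have hdivI : ∀ x ∈ Ω.carrier, div (fun y => q₀ y + dt • ∑ j ∈ Finset.Iio i,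
      tab.Ai i j • momSlope B (q j) (θ j) (σ j) y
      + (dt * tab.Ai i i) • momSlope B qE θE (σ i) y) x = 0 := by
    intro x hx
    -- A zero diagonal entry occurs at most in the first stage, where the implicit momentum is the
    -- initial one and the data give the constraint.
    by_cases hii : tab.Ai i i = 0
    · have hi : i = 0 := by
        by_contra hne
        exact hdiag i hne hii
      have hemp : Finset.Iio i = ∅ := by
        ext j
        simp [hi]
      rw [← hdiv x hx]
      refine div_congr_on (fun y _ => ?_) hx
      simp [hii, hemp]
    · have hρ := (hstar.rho.add (hR.rho.const_smul (dt * tab.Ai i i))).congr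
        (f' := fun ε => (UI ε i).rho) (by
          filter_upwards [hstep] with ε hε x hx
          simp only [State.rho, hε.implicit i hx]
          rfl) fun x _ => rfl
      -- Two limits of the same density: `ρ₀ - dt a_ii ∇·q_I` from the stage equation and `ρ₀` from
      -- the expansion.
      have hu := hρ.unique (famConv_rho_of_rho2I hB (hσ i)) hx
      simpa [State.rho, State.mom, limitState, hdt, hii] using hu
  refine ⟨_, _, _, hE, hI, hdivI, hR.congr (Eventually.of_forall fun ε x _ => rfl) fun x hx => ?_⟩
  have hd := hdivI x hx
  simp only [State.mom, limitState] at hd ⊢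
  simp only [hd, neg_zero, mul_zero]

theorem StageLimit.mom_unique {i : Fin (s + 1)} {q : Fin (s + 1) → Space d → Space d}
    {θ : Fin (s + 1) → Space d → ℝ} {qI : Fin (s + 1) → Space d → Space d}
    (hstep : ∀ᶠ ε in 𝓝[>] (0 : ℝ), IsSchemeStep Ω B tab dt ε (U0 ε) (UE ε) (UI ε) (U1 ε))
    (h0 : FamConv Ω U0 (limitState B q₀ ϑ₀))
    (hS : ∀ j, StageLimit Ω B (fun ε => UE ε j) (fun ε => UI ε j) (q j) (θ j) (σ j) (qI j)) :
    EqOn (qI i) (fun y => q₀ y + dt • ∑ j ∈ Finset.Iio i,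
      tab.Ai i j • momSlope B (q j) (θ j) (σ j) y
      + (dt * tab.Ai i i) • momSlope B (q i) (θ i) (σ i) y) Ω.carrier := by
  refine (hS i).mom.unique (((h0.mom.add_smul_sum dt (Finset.Iio i) (tab.Ai i)
    fun j _ => (hS j).slope.mom).add ((hS i).slope.mom.const_smul (dt * tab.Ai i i))).congr ?_
    fun x _ => rfl)
  filter_upwards [hstep] with ε hε x hx
  simp only [State.mom, hε.implicit i hx]
  simp [Tableau.implicitStage, Tableau.starStage, State.mom, Finset.sum_apply, Prod.snd_sum,
    Prod.fst_sum]

theorem StageLimit.solenoidal_mom {E I : ℝ → State d} {q qI : Space d → Space d}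
    {θ σ : Space d → ℝ} (h : StageLimit Ω B E I q θ σ qI)
    (hI : ∀ᶠ ε in 𝓝[>] (0 : ℝ), NoFlux Ω (I ε).mom) : Solenoidal Ω qI :=
  (NoFlux.of_famConv h.mom hI).solenoidal h.mom.field h.div_zero

/-- The limits of the stages form a step of the limit scheme. -/
theorem isLimitStage_of_stageLimit {q : Fin (s + 1) → Space d → Space d}
    {θ : Fin (s + 1) → Space d → ℝ} {qI : Fin (s + 1) → Space d → Space d} (hdt : dt ≠ 0)
    (hdiag : ∀ i, i ≠ 0 → tab.Ai i i ≠ 0)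
    (hstep : ∀ᶠ ε in 𝓝[>] (0 : ℝ), IsSchemeStep Ω B tab dt ε (U0 ε) (UE ε) (UI ε) (U1 ε))
    (h0 : FamConv Ω U0 (limitState B q₀ ϑ₀)) (hq₀ : Solenoidal Ω q₀)
    (hσ : ∀ i, SmoothField Ω (σ i))
    (hS : ∀ j, StageLimit Ω B (fun ε => UE ε j) (fun ε => UI ε j) (q j) (θ j) (σ j) (qI j))
    (hfirst : tab.Ai 0 0 = 0 → Solenoidal Ω (momSlope B (q 0) (θ 0) (σ 0))) :
    IsLimitStage Ω B tab dt q₀ ϑ₀ q θ σ (fun i => momSlope B (q i) (θ i) (σ i)) := by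
  have hE : ∀ i, EqOn (limitState B (q i) (θ i)) (limitState B
      (fun y => q₀ y + dt • ∑ j ∈ Finset.Iio i, tab.Ae i j • momSlope B (q j) (θ j) (σ j) y)
      (fun y => ϑ₀ y + dt • ∑ j ∈ Finset.Iio i, tab.Ae i j • thetaSlope B (q j) (θ j) y))
      Ω.carrier := fun i => by
    refine (hS i).explicit.unique ((h0.add_smul_sum dt (Finset.Iio i) (tab.Ae i)
      fun j _ => (hS j).slope).congr ?_ fun x _ => (limitState_add_smul_sum ..).symm)
    filter_upwards [hstep] with ε hε using hε.explicit i
  have hK : ∀ i, Solenoidal Ω (momSlope B (q i) (θ i) (σ i)) := by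
    intro i
    induction i using WellFoundedLT.induction with
    | ind i ih =>
    by_cases hii : tab.Ai i i = 0
    · obtain rfl : i = 0 := by
        by_contra hne
        exact hdiag i hne hii
      exact hfirst hii
    -- Solve the implicit momentum equation for the newest slope: it combines the implicit momentum,
    -- the initial momentum and earlier slopes, all solenoidal.
    · have hqI := (hS i).solenoidal_mom (hstep.mono fun ε hε => hε.noFlux i)
      have hsum := Solenoidal.sum (Finset.Iio i) fun j hj =>
        (ih j (Finset.mem_Iio.mp hj)).const_smul (tab.Ai i j)
      refine (((hqI.add (hq₀.const_smul (-1))).add (hsum.const_smul (-dt))).const_smul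
        (dt * tab.Ai i i)⁻¹).congr fun x hx => ?_
      have hne : dt * tab.Ai i i ≠ 0 := mul_ne_zero hdt hii
      simp only [StageLimit.mom_unique hstep h0 hS hx]
      rw [eq_inv_smul_iff₀ hne, neg_smul, neg_smul, one_smul]
      abel
  exact ⟨fun i => (hS i).explicit.mom.field, fun i => (hS i).explicit.theta2.field, hσ, hK,
    fun i x _ => rfl, fun i x hx => congrArg (fun v => v.2.1) (hE i hx),
    fun i x hx => congrArg (fun v => v.2.2.2) (hE i hx)⟩

/-- An explicit first stage has the exact slope at the initial time. -/
theorem IsLimitSolution.momSlope_initial (hB : B.IsHydrostatic Ω) {T : ℝ} (hT : 0 < T)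
    {u₀ : ℝ → Space d → Space d} {ρ₂ p₂ θ₂ : ℝ → Space d → ℝ}
    (hsol : IsLimitSolution Ω B T u₀ ρ₂ p₂ θ₂) :
    EqOn (momSlope B (fun y => B.ρ₀ y • u₀ 0 y) (θ₂ 0) (ρ₂ 0)) (momCoeff B T u₀ 1 0)
      Ω.carrier := by
  intro x hx
  have h := hsol.momCoeff_succ hB hT 0 (left_mem_Icc.mpr hT.le) hx
  simp only [Nat.cast_zero, zero_add, one_smul, Finset.Nat.antidiagonal_zero,
    Finset.sum_singleton] at h
  exact h.symm

end Stages

end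

end LowMach

end

/-! ### Assembling the limit scheme and its accuracy. -/

open LowMach

theorem theorem4p2 {d s k : ℕ} (Ω : Domain d) (B : Background d) (hB : B.IsHydrostatic Ω)
    (tab : Tableau s) (hSA : tab.StifflyAccurate) (hk : tab.HasOrder k)
    (hdiag : ∀ i, i ≠ 0 → tab.Ai i i ≠ 0)
    -- well-prepared initial data
    (U0 : ℝ → State d) (q₀ q₁ : Space d → Space d) (r₂ π₂ ϑ₂ : Space d → ℝ)
    (hU0 : WellPrepared Ω B U0 q₀ q₁ r₂ π₂ ϑ₂)
    -- the exact solution of the limit system with these initial data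
    (T : ℝ) (hT : 0 < T) (u₀ : ℝ → Space d → Space d) (ρ₂ p₂ θ₂ : ℝ → Space d → ℝ)
    (hsol : IsLimitSolution Ω B T u₀ ρ₂ p₂ θ₂)
    (hmom0 : ∀ x ∈ Ω.carrier, B.ρ₀ x • u₀ 0 x = q₀ x)
    (htheta0 : ∀ x ∈ Ω.carrier, θ₂ 0 x = ϑ₂ x)
    -- only needed if the first stage is explicit: `ρ₂` also agrees initially
    (hrho0 : tab.Ai 0 0 = 0 → ∀ x ∈ Ω.carrier, ρ₂ 0 x = r₂ x) :
    ∃ C : ℝ, ∀ dt : ℝ, 0 < dt → dt ≤ T →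
      ∀ (UE UI : ℝ → Fin (s + 1) → State d) (U1 : ℝ → State d),
        (∀ᶠ ε in 𝓝[>] (0 : ℝ), IsSchemeStep Ω B tab dt ε (U0 ε) (UE ε) (UI ε) (U1 ε)) →
        -- `ρ = ρ₀ + ε² ρ₂` in the implicit stages
        (∀ i, ∃ σ : Space d → ℝ, HasExpansion Ω 2 (fun ε => (UI ε i).rho) B.ρ₀ σ) →
        SmoothLimit Ω (fun ε => potTemp B ε (U1 ε)) B.θ₀ ∧
        SmoothLimit Ω (fun ε => div (fun x => (U1 ε).rho x • (U1 ε).vel x)) (fun _ => 0) ∧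
        SmoothLimit Ω (fun ε x => gradient ((U1 ε).pressure B.γ ε) x
          + (U1 ε).rho x • gradient B.Φ x) (fun _ => 0) ∧
        ∃ V : Space d → Val d, SmoothField Ω V ∧
          SmoothLimit Ω (fun ε => numVec B ε (U1 ε)) V ∧
          ∀ x ∈ Ω.carrier, ‖V x - exactVec B u₀ θ₂ dt x‖ ≤ C * dt ^ (k + 1) := by
  have h0 := hU0.famConv hB
  have h0T : (0 : ℝ) ∈ Icc 0 T := left_mem_Icc.mpr hT.le
  have hq₀ : Solenoidal Ω q₀ :=
    (hsol.solenoidal_momCoeff hB hT 0 h0T).congr fun x hx => (hmom0 x hx).symm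
  obtain ⟨c, hc, hρc⟩ := hB.density_pos
  obtain ⟨C, hC⟩ := hsol.exists_accuracy hB hk hT hmom0 htheta0
  refine ⟨C, fun dt hdt hdtT UE UI U1 hstep hexp => ?_⟩
  choose σ hexp using hexp
  have hσ : ∀ i, FamConv Ω (fun ε => rho2I B ε (UI ε i)) (σ i) := fun i => by
    refine ((hexp i).famConv_quotient (hstep.mono fun ε hε => (hε.field i).2.state.1)).congr
      (Eventually.of_forall fun ε x _ => ?_) fun x _ => rfl
    simp only [rho2I, smul_eq_mul, div_eq_inv_mul]
  choose q θ qI hS using exists_stageLimit hB hdt.ne' hdiag hstep h0 hU0.div_zero hσ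
  -- An explicit first stage imposes no constraint on its own slope. Agreement of `ρ₂` at time zero
  -- identifies that slope with the initial time derivative of the exact momentum, which is
  -- solenoidal.
  have hfirst : tab.Ai 0 0 = 0 → Solenoidal Ω (momSlope B (q 0) (θ 0) (σ 0)) := by
    intro ha
    have hemp : Finset.Iio (0 : Fin (s + 1)) = ∅ := by
      ext j
      simp
    have hE : EqOn (limitState B (q 0) (θ 0)) (limitState B q₀ ϑ₂) Ω.carrier := by
      refine (hS 0).explicit.unique (h0.congr ?_ fun x _ => rfl)
      filter_upwards [hstep] with ε hε x hx
      simp [hε.explicit 0 hx, Tableau.explicitStage, hemp]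
    have hσ0 : EqOn (σ 0) r₂ Ω.carrier := by
      refine (hσ 0).unique ((hU0.rho.famConv_quotient
        (hU0.field.mono fun ε hε => hε.state.1)).congr ?_ fun x _ => rfl)
      filter_upwards [hstep] with ε hε x hx
      simp [rho2I, State.rho, hε.implicit 0 hx, Tableau.implicitStage, Tableau.starStage, ha,
        hemp, div_eq_inv_mul]
    refine (hsol.solenoidal_momCoeff hB hT 1 h0T).congr
      ((momSlope_congr ?_ ?_ ?_).trans (hsol.momSlope_initial hB hT))
    · exact fun x hx => (congrArg (fun v => v.2.1) (hE hx)).trans (hmom0 x hx).symm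
    · exact fun x hx => (congrArg (fun v => v.2.2.2) (hE hx)).trans (htheta0 x hx).symm
    · exact fun x hx => (hσ0 hx).trans (hrho0 ha x hx).symm
  have hL := isLimitStage_of_stageLimit hdt.ne' hdiag hstep h0 hq₀ (fun i => (hσ i).field) hS hfirst
  have hacc := hC dt hdt hdtT q θ σ _ hL
  obtain ⟨qn, hqn⟩ : ∃ qn : Space d → Space d,
      qn = fun y => q₀ y + dt • ∑ i, tab.b i • momSlope B (q i) (θ i) (σ i) y := ⟨_, rfl⟩
  obtain ⟨θn, hθn⟩ : ∃ θn : Space d → ℝ,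
      θn = fun y => ϑ₂ y + dt • ∑ i, tab.b i • thetaSlope B (q i) (θ i) y := ⟨_, rfl⟩
  have h1 : FamConv Ω U1 (limitState B qn θn) := by
    refine (h0.add_smul_sum dt Finset.univ tab.b fun j _ => (hS j).slope).congr ?_
      fun x _ => by simp only [limitState_add_smul_sum, hqn, hθn]
    filter_upwards [hstep] with ε hε using hε.update
  -- The new momentum is the initial one plus a combination of solenoidal slopes.
  have hdivn : ∀ x ∈ Ω.carrier, div qn x = 0 := by
    rw [hqn]
    exact (hq₀.add ((Solenoidal.sum Finset.univ fun i _ =>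
      (hL.solenoidal i).const_smul (tab.b i)).const_smul dt)).div_zero
  have hp := famConv_pressure hB h1
  have hV := h1.rho.prodMk (h1.mom.prodMk (hp.prodMk h1.theta2))
  refine ⟨(h1.potTemp hB).smoothLimit, ?_, ?_, _, hV.field, hV.smoothLimit, fun x hx => ?_⟩
  · refine (h1.mom.div.congr ?_ fun x hx => (hdivn x hx).symm).smoothLimit
    filter_upwards [h1.rho.eventually_lower_bound hc hρc] with ε hε x hx
    refine div_congr_on (fun y hy => ?_) hx
    exact smul_inv_smul₀ ((half_pos hc).trans_le (hε y hy)).ne' _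
  · refine ((hp.gradient.add (h1.rho.smul (FamConv.const hB.field_Φ.gradient))).congr
      (Eventually.of_forall fun ε x _ => rfl) fun x hx => ?_).smoothLimit
    simp only [hB.balance x hx]
    exact (neg_add_cancel _).symm
  · obtain ⟨hm, ht⟩ := hacc x hx
    -- Density and pressure are exact in the limit, so for them the bound reduces to its
    -- nonnegativity.
    have h2 : 0 ≤ C * dt ^ (k + 1) := (norm_nonneg _).trans hm
    simp only [exactVec, State.rho, State.mom, State.theta2, limitState, Prod.norm_def,
      Prod.fst_sub, Prod.snd_sub, sub_self, norm_zero, hqn, hθn]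
    exact max_le h2 (max_le hm (max_le h2 ht))
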